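/- Let $n\ge 1$, let $B$ be a closed (compact, without boundary) smooth manifold of dimension $2n-1$, and let $D^2_\varepsilon\subset\mathbb R^2$ be the closed disc of radius $\varepsilon$, with $D^2=D^2_1$, Cartesian coordinates $x,y$ and polar coordinates $(r,\theta)$. Identify $B$ with $B\times\{0\}\subset B\times D^2$ and, for $\theta\in\mathbb R$, let $$\Sigma_\theta=\{(b,re^{i\theta}) : b\in B,\ 0\le r\le 1\}$$ be the page of angle $\theta$. Call a smooth $1$-form $\alpha$ on $B\times D^2$ *adapted* if it is a contact form (that is, $\alpha\wedge(d\alpha)^n\neq 0$ everywhere) and 1. $\alpha_B:=\alpha|_{TB}$ is a contact form on $B$, i.e. $\alpha_B\wedge(d\alpha_B)^{n-1}\ne0$ everywhere, and $\alpha$ is positive: $\alpha\wedge(d\alpha)^n>0$ for the product orientation of $B\times D^2$, where $B$ is oriented by $\alpha_B\wedge(d\alpha_B)^{n-1}$ and $D^2$ by $dx\wedge dy$; 2. for each $\theta$, the $2$-form $d\alpha|_{T\Sigma_\theta}$ is symplectic on $\Sigma_\theta\setminus B$; 3. if $B$ is oriented by $\alpha_B$ and $\Sigma_\theta$ by $(d\alpha|_{T\Sigma_\theta})^n$,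 then $B$ is oriented as the boundary of $\Sigma_\theta$ (outward normal $-\partial_r$ first). Let $\alpha$ be adapted, with $\alpha_B=\alpha|_{TB}$, and let $U$ be an open neighbourhood of $B\times\{0\}$. Then for every sufficiently small $\varepsilon>0$ there are * a path $(\alpha_t)_{t\in[0,1]}$ of adapted forms on $B\times D^2$, smooth jointly in $t$ and the point, with $\alpha_0=\alpha$, with $\alpha_t=\alpha$ outside $U$ for all $t$, and with $\alpha_t|_{TB}=c_t\,\alpha_B$ for constants $c_t>0$; * a smooth embedding $\Psi\colon B\times D^2_\varepsilon\to B\times D^2$ which is the identity on $B\times\{0\}$ and maps $\Sigma_\theta\cap(B\times D^2_\varepsilon)$ into $\Sigma_\theta$ for every $\theta$; * smooth functions $h_1,h_2\colon[0,\varepsilon]\to\mathbb R$ such that $$\Psi^*\alpha_1=h_1(r)\,\alpha_B+h_2(r)\,d\theta \quad\text{on } B\times D^2_\varepsilon,$$ and such that * $h_1(0)>0$, and $h_2(r)=r^2$ near $r=0$; * $h_1^{n-1}(h_1h_2'-h_1'h_2)>0$ for $0<r\le\varepsilon$; * $h_1'<0$ for $0<r\le\varepsilon$. -/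

import Mathlib

open Set Topology
open scoped Manifold ContDiff

noncomputable section

section LinearAlgebra

variable {V : Type*}

/-- The value `(a ∧ w ∧ ⋯ ∧ w)(v₀, …, v₂ₖ)`, with `k` factors `w`, of the wedge product of a linear
form `a` and the `k`-th power of an alternating bilinear form `w`
(convention: `(a ∧ b)(u, v) = a u * b v - a v * b u` for linear forms). -/
def wedgeOnePow (k : ℕ) (a : V → ℝ) (w : V → V → ℝ) (v : Fin (2 * k + 1) → V) : ℝ :=
  (1 / 2 ^ k) * ∑ σ : Equiv.Perm (Fin (2 * k + 1)),
    ((Equiv.Perm.sign σ : ℤ) : ℝ) * (a (v (σ 0)) *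
      ∏ i : Fin k, w (v (σ ⟨2 * i.val + 1, by omega⟩)) (v (σ ⟨2 * i.val + 2, by omega⟩)))

/-- The value `(w ∧ ⋯ ∧ w)(v₀, …, v₂ₖ₋₁)` of the `k`-th power of an alternating bilinear form. -/
def wedgePow (k : ℕ) (w : V → V → ℝ) (v : Fin (2 * k) → V) : ℝ :=
  (1 / 2 ^ k) * ∑ σ : Equiv.Perm (Fin (2 * k)),
    ((Equiv.Perm.sign σ : ℤ) : ℝ) *
      ∏ i : Fin k, w (v (σ ⟨2 * i.val, by omega⟩)) (v (σ ⟨2 * i.val + 1, by omega⟩))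

end LinearAlgebra

section Forms

variable {E : Type*} [NormedAddCommGroup E] [NormedSpace ℝ E] {H : Type*} [TopologicalSpace H]
  (I : ModelWithCorners ℝ E H) {M : Type*} [TopologicalSpace M] [ChartedSpace H M]

variable (M) in
/-- (Not necessarily continuous) differential 1-forms on `M`. -/
abbrev OneForm : Type _ := (p : M) → (TangentSpace I p →L[ℝ] ℝ)

/-- The 1-form `α` is smooth on the set `S`, as a section of the cotangent bundle. -/
def OneForm.SmoothOn [IsManifold I 1 M] (α : OneForm I M) (S : Set M) : Prop :=
  ContMDiffOn I (I.prod 𝓘(ℝ, E →L[ℝ] ℝ)) ∞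
    (fun p ↦ Bundle.TotalSpace.mk' (E →L[ℝ] ℝ)
      (E := fun p : M ↦ (TangentSpace I p →L[ℝ] ℝ)) p (α p)) S

/-- The 1-forms `α t`, `t ∈ T`, are smooth on `S`, jointly in the point and the parameter. -/
def OneForm.SmoothFamilyOn [IsManifold I 1 M] (α : ℝ → OneForm I M) (T : Set ℝ) (S : Set M) :
    Prop :=
  ContMDiffOn (𝓘(ℝ, ℝ).prod I) (I.prod 𝓘(ℝ, E →L[ℝ] ℝ)) ∞
    (fun q : ℝ × M ↦ Bundle.TotalSpace.mk' (E →L[ℝ] ℝ)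
      (E := fun p : M ↦ (TangentSpace I p →L[ℝ] ℝ)) q.2 (α q.1 q.2)) (T ×ˢ S)

/-- The expression of the 1-form `α` in the preferred chart at `p`: its pullback under the inverse
of the chart, as a 1-form on the model vector space. -/
def OneForm.inChart (α : OneForm I M) (p : M) (y : E) : E →L[ℝ] ℝ :=
  (α ((extChartAt I p).symm y)).comp
    (mfderivWithin 𝓘(ℝ, E) I (extChartAt I p).symm (range I) y)

/-- The exterior derivative `(dα)_p (u, v)` of a 1-form `α` on a set `S` (typically open, or a
codimension-zero submanifold with boundary). It is computed in the preferred chart at `p` by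
`dα (u, v) = D_u (α (v)) - D_v (α (u))`; recall that `TangentSpace I p` is the model space `E`,
identified with the actual tangent space by this same chart. -/
def OneForm.dWithin (α : OneForm I M) (S : Set M) (p : M) (u v : TangentSpace I p) : ℝ :=
  let D : E →L[ℝ] (E →L[ℝ] ℝ) := fderivWithin ℝ (OneForm.inChart I α p)
    ((extChartAt I p).symm ⁻¹' S ∩ range I) (extChartAt I p p)
  D u v - D v u

/-- The value of the top-degree form `α ∧ (dα)^k` at `p`. -/
def OneForm.contactVolume (k : ℕ) (α : OneForm I M) (S : Set M) (p : M)
    (v : Fin (2 * k + 1) → TangentSpace I p) : ℝ :=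
  wedgeOnePow k (α p) (OneForm.dWithin I α S p) v

/-- `α` is a contact form on `S`, where `S` has dimension `2 * k + 1`: it is smooth and
`α ∧ (dα)^k` vanishes nowhere. -/
structure OneForm.IsContactOn [IsManifold I 1 M] (k : ℕ) (α : OneForm I M) (S : Set M) :
    Prop where
  smooth : OneForm.SmoothOn I α S
  volume_ne_zero : ∀ p ∈ S, ∃ v : Fin (2 * k + 1) → TangentSpace I p,
    OneForm.contactVolume I k α S p v ≠ 0

/-- The pullback of `α` under a map `f` that is defined on the set `S`. -/
def OneForm.pullbackWithin (f : M → M) (S : Set M) (α : OneForm I M) : OneForm I M :=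
  fun p ↦ (α (f p)).comp (mfderivWithin I I f S p)

/-- `f` is a smooth embedding of `S` (a codimension-zero submanifold with boundary) into `M`:
a smooth immersion which is a homeomorphism onto its image. -/
structure IsSmoothEmbeddingOn (f : M → M) (S : Set M) : Prop where
  smooth : ContMDiffOn I I ∞ f S
  immersion : ∀ p ∈ S, Function.Injective (mfderivWithin I I f S p)
  embedding : IsEmbedding (fun x : S ↦ f x)

end Forms

section Binding

/-- The model of `B × ℂ`, where `B` is a manifold of dimension `2 * m + 1`. -/
abbrev bindingModel (m : ℕ) :
    ModelWithCorners ℝ (EuclideanSpace ℝ (Fin (2 * m + 1)) × ℂ)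
      (ModelProd (EuclideanSpace ℝ (Fin (2 * m + 1))) ℂ) :=
  (𝓡 (2 * m + 1)).prod 𝓘(ℝ, ℂ)

/-- `B × D²_ε`, with `D²_ε` the closed disc of radius `ε` in the plane `ℂ`. -/
def solidTube (B : Type*) (ε : ℝ) : Set (B × ℂ) := univ ×ˢ Metric.closedBall (0 : ℂ) ε

/-- The page `Σ_θ = {(b, r e^{iθ}) : b ∈ B, 0 ≤ r ≤ 1}`. -/
def page (B : Type*) (θ : ℝ) : Set (B × ℂ) :=
  {p | ∃ r : ℝ, 0 ≤ r ∧ r ≤ 1 ∧ p.2 = (r : ℂ) * Complex.exp (θ * Complex.I)}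

variable (m : ℕ) {B : Type*} [TopologicalSpace B]
  [ChartedSpace (EuclideanSpace ℝ (Fin (2 * m + 1))) B]

/-- The restriction of `α` to `TB`, where `B = B × {0}`. -/
def restrictBinding (α : OneForm (bindingModel m) (B × ℂ)) : OneForm (𝓡 (2 * m + 1)) B :=
  fun b ↦ (α (b, 0)).comp
    (ContinuousLinearMap.inl ℝ (EuclideanSpace ℝ (Fin (2 * m + 1))) ℂ)

/-- The 2-form `dα|_{TΣ_θ}` at the point `(b, r e^{iθ})` of the page. The pair `(u, s)` stands for
the tangent vector `u + s ∂_r` of the page. -/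
def pageForm (α : OneForm (bindingModel m) (B × ℂ)) (θ : ℝ) (b : B) (r : ℝ)
    (x y : EuclideanSpace ℝ (Fin (2 * m + 1)) × ℝ) : ℝ :=
  OneForm.dWithin (bindingModel m) α (solidTube B 1) (b, (r : ℂ) * Complex.exp (θ * Complex.I))
    (x.1, (x.2 : ℂ) * Complex.exp (θ * Complex.I))
    (y.1, (y.2 : ℂ) * Complex.exp (θ * Complex.I))

/-- The orientation of `B` given by `α|_{TB}`: the frame `v` of `T_b B` is positive. -/
def IsPositiveBindingFrame (α : OneForm (bindingModel m) (B × ℂ)) (b : B)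
    (v : Fin (2 * m + 1) → EuclideanSpace ℝ (Fin (2 * m + 1))) : Prop :=
  0 < OneForm.contactVolume (𝓡 (2 * m + 1)) m (restrictBinding m α) univ b v

/-- `α` is a positive contact form on `B × D²` which is adapted to the binding `B` and to the
pages `Σ_θ`. Here `dim B = 2 * m + 1`. -/
structure IsAdaptedContactForm [IsManifold (𝓡 (2 * m + 1)) ∞ B]
    (α : OneForm (bindingModel m) (B × ℂ)) : Prop where
  contact : OneForm.IsContactOn (bindingModel m) (m + 1) α (solidTube B 1)
  /-- `α ∧ (dα)^(m+1)` is positive for the product orientation of `B × D²`, where `B` is oriented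
  by `α|_{TB}`, and `D²` by `dx ∧ dy`. -/
  positive : ∀ p ∈ solidTube B 1, ∀ v, IsPositiveBindingFrame m α p.1 v →
    0 < OneForm.contactVolume (bindingModel m) (m + 1) α (solidTube B 1) p
      (Fin.cons ((0, 1) : EuclideanSpace ℝ (Fin (2 * m + 1)) × ℂ)
        (Fin.cons ((0, Complex.I) : EuclideanSpace ℝ (Fin (2 * m + 1)) × ℂ)
          fun i ↦ ((v i, 0) : EuclideanSpace ℝ (Fin (2 * m + 1)) × ℂ)))
  /-- `α|_{TB}` is a contact form. -/
  binding_contact : OneForm.IsContactOn (𝓡 (2 * m + 1)) m (restrictBinding m α) univ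
  /-- `dα|_{TΣ_θ}` is symplectic on `Σ_θ \ B`, i.e. non-degenerate (being exact, it is closed). -/
  page_symplectic : ∀ θ : ℝ, ∀ b : B, ∀ r : ℝ, 0 < r → r ≤ 1 →
    ∀ x, (∀ y, pageForm m α θ b r x y = 0) → x = 0
  /-- `B`, oriented by `α|_{TB}`, is oriented as the boundary of `Σ_θ`, oriented by the top power
  of `dα|_{TΣ_θ}`: an outward vector `-∂_r` followed by a positive frame of `B` is positive. (The
  orientation of `Σ_θ` at `(b, 0)` is the one at the points `(b, r e^{iθ})`, `r > 0`.) -/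
  page_boundary : ∀ θ : ℝ, ∀ b : B, ∀ r : ℝ, 0 < r → r ≤ 1 →
    ∀ v, IsPositiveBindingFrame m α b v →
      0 < wedgePow (m + 1) (pageForm m α θ b r)
        (Fin.cons ((0, -1) : EuclideanSpace ℝ (Fin (2 * m + 1)) × ℝ)
          fun i ↦ ((v i, 0) : EuclideanSpace ℝ (Fin (2 * m + 1)) × ℝ))

/-- The 1-form `dθ = (x dy - y dx) / r²` on `ℂ \ {0}`; its value at `0` is set to be `0`, so that
`h(r) dθ` is the smooth extension over `0` whenever `h(r) = r²` near `0`. -/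
def angularForm (z : ℂ) (w : ℂ) : ℝ := (z.re * w.im - z.im * w.re) / ‖z‖ ^ 2

end Binding

end

/-! Put q = r² and η = x dy - y dx = r² dθ. The whole path lives in the class β = h(q) a + f(q) η
with a = (1 - κ(q)) α + κ(q) α_B (`interpolatedForm`). If κ = 1, if h decreases linearly in q and if
f is a constant K, then β is h α_B + K r² dθ, and the scaling z ↦ z/√K, which preserves pages, turns
K r² dθ into r² dθ. So it suffices to reach such data near B through adapted forms.

Switching κ on directly is dangerous. The cut-off on the scale r₀ has κ' of size 1/r₀², and although
α_B - α is O(r) on TB, it is only bounded in the plane directions. The cure is to twist first. On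
the first half of the path κ = 0, while h acquires slope -c and f grows to K near B; on the second
half the twist is kept and κ is switched on.

Two exact formulas control everything. Write N for the value of a ∧ (da)^m along B, with κ treated
as a constant. The volume of the page is h^m (h(1-κ) X - 2r h κ' D - 2r h' N), where X comes from dα
contracted with -∂_r, and D from α_B - α (`pageVolume_interpolatedForm`). The volume β ∧ (dβ)^(m+1)
is h^(m+2) V + 2(m+1) (q f)' h^(m+1) N plus f r (m+1) times the page volume of β itself
(`tubeVolume_interpolatedForm`), so that positivity on the pages makes the last term harmless.

Compactness of B gives frames with uniform bounds (`exists_uniformFrame`). In these N is bounded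
below, D = O(r), and X ≥ -O(r), since X at r = 0 is a limit of positive numbers. Where κ is active,
-h' = c and (q f)' = K, while the errors are O(r/r₀) on the pages and O(1/r₀) in the volume. Hence c
and K of order 1/r₀ with large factors are enough. Then c r₀² and K r₀² are still O(r₀), so h ≤ 2,
and f can be cut off inside r < ρ with q f falling too slowly to matter. These choices are made in
`exists_isTwistConstants`, and the positivity is `pageVolume_twistedForm_pos` and
`tubeVolume_twistedForm_pos`.

The wedge powers, defined as sums over permutations, are handled as top coefficients in an exterior
algebra, where the identities above become short computations. -/

noncomputable section

/-! ### Smoothness of 1-forms tested in one fixed chart. -/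

section
variable {E : Type*} [NormedAddCommGroup E] [NormedSpace ℝ E] {H : Type*} [TopologicalSpace H]
  (I : ModelWithCorners ℝ E H) {M : Type*} [TopologicalSpace M] [ChartedSpace H M]

/-- The coordinate expression at `p` of a cotangent vector, with respect to the preferred chart
at `p₀`. -/
def chartCovector (p₀ p : M) (a : TangentSpace I p →L[ℝ] ℝ) : E →L[ℝ] ℝ :=
  a.comp (mfderivWithin 𝓘(ℝ, E) I (extChartAt I p₀).symm (range I) (extChartAt I p₀ p))

/-- Over the chart at `p₀` the trivialization of the cotangent bundle is composition with the
derivative of the inverse chart. The base map `g` is arbitrary so that single forms (`g = id`) and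
families with a parameter (`g = Prod.snd`) are both covered. -/
theorem contMDiffWithinAt_oneForm_iff [IsManifold I ∞ M] {F N G : Type*} [NormedAddCommGroup F]
    [NormedSpace ℝ F] [TopologicalSpace G] (J : ModelWithCorners ℝ F G) [TopologicalSpace N]
    [ChartedSpace G N] (g : N → M) (A : (n : N) → (TangentSpace I (g n) →L[ℝ] ℝ)) (s : Set N)
    (x : N) (p₀ : M) (hx : g x ∈ (chartAt H p₀).source) :
    ContMDiffWithinAt J (I.prod 𝓘(ℝ, E →L[ℝ] ℝ)) ∞
      (fun p ↦ Bundle.TotalSpace.mk' (E →L[ℝ] ℝ)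
        (E := fun p : M ↦ (TangentSpace I p →L[ℝ] ℝ)) (g p) (A p)) s x ↔
    ContMDiffWithinAt J I ∞ g s x ∧
      ContMDiffWithinAt J 𝓘(ℝ, E →L[ℝ] ℝ) ∞ (fun n ↦ chartCovector I p₀ (g n) (A n)) s x := by
  have : ContMDiffVectorBundle ∞ E (TangentSpace I : M → Type _) I :=
    have : IsManifold I (∞ + 1) M := inferInstanceAs (IsManifold I ∞ M)
    TangentBundle.contMDiffVectorBundle
  rw [Bundle.Trivialization.contMDiffWithinAt_iff (e := trivializationAt (E →L[ℝ] ℝ)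
    (fun p : M ↦ (TangentSpace I p →L[ℝ] Bundle.Trivial M ℝ p)) p₀)]
  · refine and_congr_right fun h => ?_
    have key : ∀ n, g n ∈ (chartAt H p₀).source →
        ContinuousLinearMap.inCoordinates E (TangentSpace I) ℝ (Bundle.Trivial M ℝ) p₀ (g n) p₀
          (g n) (A n) = chartCovector I p₀ (g n) (A n) := by
      intro n hn
      rw [chartCovector, ← TangentBundle.symmL_trivializationAt hn]
      ext v
      simp [ContinuousLinearMap.inCoordinates]
    apply Filter.EventuallyEq.contMDiffWithinAt_iff
    · filter_upwards [h.continuousWithinAt.preimage_mem_nhdsWithin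
        ((chartAt H p₀).open_source.mem_nhds hx)] with n hn
      exact key n hn
    · exact key x hx
  · rw [hom_trivializationAt_source]
    simpa using hx
end

/-! ### Coordinates on B × ℂ. -/

section TubeCalculus

variable (m : ℕ) {B : Type*} [TopologicalSpace B]
  [ChartedSpace (EuclideanSpace ℝ (Fin (2 * m + 1))) B]

local notation "𝔼" => EuclideanSpace ℝ (Fin (2 * m + 1))

/-- The derivative of the inverse of the preferred chart of `B` at `b`. -/
def chartFrame (b : B) (y : 𝔼) : 𝔼 →L[ℝ] 𝔼 :=
  mfderivWithin 𝓘(ℝ, 𝔼) (𝓡 (2 * m + 1)) (extChartAt (𝓡 (2 * m + 1)) b).symm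
    (range (𝓡 (2 * m + 1))) y

theorem mfderivWithin_extChartAt_symm_prod [IsManifold (𝓡 (2 * m + 1)) 1 B] (b : B) (z : ℂ)
    (y : 𝔼) (w : ℂ) (hy : y ∈ (extChartAt (𝓡 (2 * m + 1)) b).target) :
    mfderivWithin 𝓘(ℝ, 𝔼 × ℂ) (bindingModel m) (extChartAt (bindingModel m) (b, z)).symm
      (range (bindingModel m)) (y, w) =
    (chartFrame m b y).prodMap (ContinuousLinearMap.id ℝ ℂ) := by
  have h1 : MDifferentiableAt 𝓘(ℝ, 𝔼) (𝓡 (2 * m + 1)) (extChartAt (𝓡 (2 * m + 1)) b).symm y := by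
    simpa [mdifferentiableWithinAt_univ] using mdifferentiableWithinAt_extChartAt_symm hy
  have h2 : MDifferentiableAt 𝓘(ℝ, ℂ) 𝓘(ℝ, ℂ) (id : ℂ → ℂ) w := mdifferentiableAt_id
  have := mfderiv_prodMap (p := (y, w)) h1 h2
  have e1 : range (bindingModel m) = univ := by simp [bindingModel]
  have e2 : range (𝓡 (2 * m + 1)) = univ := by simp
  rw [chartFrame, e1, e2, mfderivWithin_univ, mfderivWithin_univ]
  rw [mfderiv_id] at this
  rw [← modelWithCornersSelf_prod, chartedSpaceSelf_prod] at this
  exact this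

theorem inChart_apply [IsManifold (𝓡 (2 * m + 1)) 1 B] (α : OneForm (bindingModel m) (B × ℂ))
    (b : B) (z : ℂ) (y : 𝔼) (w : ℂ) (hy : y ∈ (extChartAt (𝓡 (2 * m + 1)) b).target) (v : 𝔼 × ℂ) :
    OneForm.inChart (bindingModel m) α (b, z) (y, w) v =
      α ((extChartAt (𝓡 (2 * m + 1)) b).symm y, w) (chartFrame m b y v.1, v.2) := by
  rw [OneForm.inChart, mfderivWithin_extChartAt_symm_prod m b z y w hy]
  rfl

theorem extChartAt_bindingModel (b : B) (z : ℂ) :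
    extChartAt (bindingModel m) (b, z) =
      (extChartAt (𝓡 (2 * m + 1)) b).prod (PartialEquiv.refl ℂ) := by
  rw [bindingModel, extChartAt_prod, extChartAt_model_space_eq_id]

theorem mem_extChartAt_target_iff (b : B) (z : ℂ) (x : 𝔼 × ℂ) :
    x ∈ (extChartAt (bindingModel m) (b, z)).target ↔
      x.1 ∈ (extChartAt (𝓡 (2 * m + 1)) b).target := by
  rw [extChartAt_bindingModel]
  simp [PartialEquiv.prod_target]

theorem extChartAt_symm_preimage_solidTube (b : B) (z : ℂ) (ε : ℝ) :
    (extChartAt (bindingModel m) (b, z)).symm ⁻¹' solidTube B ε ∩ range (bindingModel m) =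
      univ ×ˢ Metric.closedBall 0 ε := by
  have e1 : range (bindingModel m) = univ := by simp [bindingModel]
  rw [e1, inter_univ]
  rw [extChartAt_bindingModel]
  ext ⟨y, w⟩
  simp [solidTube]

theorem uniqueDiffOn_univ_prod_closedBall (F : Type*) [NormedAddCommGroup F] [NormedSpace ℝ F]
    {ε : ℝ} (hε : 0 < ε) : UniqueDiffOn ℝ ((univ : Set F) ×ˢ Metric.closedBall (0 : ℂ) ε) :=
  uniqueDiffOn_univ.prod (uniqueDiffOn_convex (convex_closedBall _ _) (by
    rw [interior_closedBall _ hε.ne']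
    exact ⟨0, by simpa using hε⟩))

/-- The plane is its own chart, so the preferred chart at `(b, z)` does not depend on `z`: all
points over `b` share the coordinate expression at `(b, 0)`. -/
theorem dWithin_eq (α : OneForm (bindingModel m) (B × ℂ)) (b : B) (z : ℂ) (u v : 𝔼 × ℂ) :
    OneForm.dWithin (bindingModel m) α (solidTube B 1) (b, z) u v =
      fderivWithin ℝ (OneForm.inChart (bindingModel m) α (b, 0)) (univ ×ˢ Metric.closedBall 0 1)
        (extChartAt (𝓡 (2 * m + 1)) b b, z) u v -
      fderivWithin ℝ (OneForm.inChart (bindingModel m) α (b, 0)) (univ ×ˢ Metric.closedBall 0 1)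
        (extChartAt (𝓡 (2 * m + 1)) b b, z) v u := by
  rw [← extChartAt_symm_preimage_solidTube m b z 1]
  rfl

/-- The tangent space at `b` is identified with the model space by the preferred chart at `b`
itself, so no transition map intervenes. -/
theorem chartFrame_self [IsManifold (𝓡 (2 * m + 1)) 1 B] (b : B) :
    chartFrame m b (extChartAt (𝓡 (2 * m + 1)) b b) = ContinuousLinearMap.id ℝ 𝔼 := by
  have h1 := TangentBundle.symmL_trivializationAt (I := 𝓡 (2 * m + 1)) (mem_chart_source 𝔼 b)
  have h2 := TangentBundle.symmL_trivializationAt_eq_core (I := 𝓡 (2 * m + 1))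
    (mem_chart_source 𝔼 b)
  ext1 v
  rw [chartFrame, ← h1, h2]
  exact (tangentBundleCore (𝓡 (2 * m + 1)) B).coordChange_self (achart 𝔼 b) b
    (mem_chart_source 𝔼 b) v

theorem contDiffOn_inChart [IsManifold (𝓡 (2 * m + 1)) ∞ B]
    {α : OneForm (bindingModel m) (B × ℂ)}
    (hα : OneForm.SmoothOn (bindingModel m) α (solidTube B 1)) (b : B) :
    ContDiffOn ℝ ∞ (OneForm.inChart (bindingModel m) α (b, 0))
      ((extChartAt (𝓡 (2 * m + 1)) b).target ×ˢ Metric.closedBall 0 1) := by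
  have h1 : ContMDiffOn 𝓘(ℝ, 𝔼 × ℂ) (bindingModel m) ∞ (extChartAt (bindingModel m) (b, (0 : ℂ))).symm
      ((extChartAt (𝓡 (2 * m + 1)) b).target ×ˢ Metric.closedBall 0 1) := by
    refine (contMDiffOn_extChartAt_symm (b, (0 : ℂ))).mono ?_
    rintro ⟨y, w⟩ ⟨hy, -⟩
    exact (mem_extChartAt_target_iff m b 0 _).2 hy
  rw [← contMDiffOn_iff_contDiffOn]
  rintro ⟨y, w⟩ ⟨hy, hw⟩
  have hp := hα ((extChartAt (bindingModel m) (b, (0 : ℂ))).symm (y, w)) ⟨trivial, hw⟩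
  have hsrc : (extChartAt (bindingModel m) (b, (0 : ℂ))).symm (y, w) ∈
      (chartAt (ModelProd 𝔼 ℂ) (b, (0 : ℂ))).source := by
    have := (extChartAt (bindingModel m) (b, (0 : ℂ))).map_target (x := (y, w))
      ((mem_extChartAt_target_iff m b 0 _).2 hy)
    simpa [extChartAt_source] using this
  have h2 := ((contMDiffWithinAt_oneForm_iff (bindingModel m) (bindingModel m) id α (solidTube B 1)
    _ (b, (0 : ℂ)) hsrc).1 hp).2
  have h3 := h2.comp (y, w) (h1 (y, w) ⟨hy, hw⟩) (t := solidTube B 1) (fun x hx => ⟨trivial, hx.2⟩)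
  refine h3.congr_of_mem (fun x hx => ?_) ⟨hy, hw⟩
  simp only [Function.comp_apply, chartCovector, OneForm.inChart, id]
  rw [(extChartAt (bindingModel m) (b, (0 : ℂ))).right_inv ((mem_extChartAt_target_iff m b 0 _).2 hx.1)]

end TubeCalculus

/-! ### Exterior derivatives of forms with rotationally symmetric coefficients. -/

section TubeDerivatives

/-- The exterior derivative of 1-forms on a normed space commutes with pullbacks. -/
theorem fderiv_pullback_skew {F : Type*} [NormedAddCommGroup F] [NormedSpace ℝ F]
    {a : F → F →L[ℝ] ℝ} {T : F → F} {x : F} (ha : DifferentiableAt ℝ a (T x))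
    (hT : ContDiffAt ℝ 2 T x) (u v : F) :
    fderiv ℝ (fun y ↦ (a (T y)).comp (fderiv ℝ T y)) x u v -
      fderiv ℝ (fun y ↦ (a (T y)).comp (fderiv ℝ T y)) x v u =
    fderiv ℝ a (T x) (fderiv ℝ T x u) (fderiv ℝ T x v) -
      fderiv ℝ a (T x) (fderiv ℝ T x v) (fderiv ℝ T x u) := by
  have h1 : HasFDerivAt (fun y ↦ a (T y)) ((fderiv ℝ a (T x)).comp (fderiv ℝ T x)) x :=
    ha.hasFDerivAt.comp x (hT.differentiableAt (by norm_num)).hasFDerivAt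
  have h2 : HasFDerivAt (fderiv ℝ T) (fderiv ℝ (fderiv ℝ T) x) x :=
    ((hT.fderiv_right (m := 1) (by norm_num)).differentiableAt (by norm_num)).hasFDerivAt
  have h3 : fderiv ℝ (fderiv ℝ T) x u v = fderiv ℝ (fderiv ℝ T) x v u :=
    (hT.isSymmSndFDerivAt (by simp)) u v
  rw [(h1.clm_comp h2).fderiv]
  simp [h3]

variable (m : ℕ) {B : Type*} [TopologicalSpace B]
  [ChartedSpace (EuclideanSpace ℝ (Fin (2 * m + 1))) B]

local notation "𝔼" => EuclideanSpace ℝ (Fin (2 * m + 1))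

theorem differentiableWithinAt_inChart [IsManifold (𝓡 (2 * m + 1)) ∞ B]
    {α : OneForm (bindingModel m) (B × ℂ)}
    (hα : OneForm.SmoothOn (bindingModel m) α (solidTube B 1)) (b : B) (y : 𝔼)
    (hy : y ∈ (extChartAt (𝓡 (2 * m + 1)) b).target) (z : ℂ) (hz : ‖z‖ ≤ 1) :
    DifferentiableWithinAt ℝ (OneForm.inChart (bindingModel m) α (b, 0))
      (univ ×ˢ Metric.closedBall 0 1) (y, z) := by
  have h := (contDiffOn_inChart m hα b).differentiableOn (by norm_num) (y, z)
    ⟨hy, by simpa using hz⟩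
  refine h.mono_of_mem_nhdsWithin ?_
  rw [nhdsWithin_prod_eq]
  refine Filter.prod_mem_prod ?_ self_mem_nhdsWithin
  rw [nhdsWithin_univ]
  exact extChartAt_target_mem_nhds' hy

/-- The pullback of `α|_{TB}` under the projection `B × ℂ → B`. -/
def bindingPullback (α : OneForm (bindingModel m) (B × ℂ)) : OneForm (bindingModel m) (B × ℂ) :=
  fun p ↦ (restrictBinding m α p.1).comp (ContinuousLinearMap.fst ℝ 𝔼 ℂ)

/-- The 1-form `x dy - y dx = r² dθ` on the plane. -/
def rotationForm : ℂ →L[ℝ] ℂ →L[ℝ] ℝ :=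
  Complex.reCLM.smulRight Complex.imCLM - Complex.imCLM.smulRight Complex.reCLM

theorem rotationForm_apply (z w : ℂ) : rotationForm z w = z.re * w.im - z.im * w.re := by
  simp [rotationForm]

/-- The value of the 1-form `α` at `p`, as a linear form on the model space. -/
def covectorAt (α : OneForm (bindingModel m) (B × ℂ)) (p : B × ℂ) : 𝔼 × ℂ →L[ℝ] ℝ := α p

/-- The 1-form `P₁(r²) α + P₂(r²) α_B + P₃(r²) (x dy - y dx)`. -/
def tubeForm (P₁ P₂ P₃ : ℝ → ℝ) (α : OneForm (bindingModel m) (B × ℂ)) :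
    OneForm (bindingModel m) (B × ℂ) := fun p ↦
  P₁ (‖p.2‖ ^ 2) • covectorAt m α p + P₂ (‖p.2‖ ^ 2) • covectorAt m (bindingPullback m α) p +
    P₃ (‖p.2‖ ^ 2) • (rotationForm p.2).comp (ContinuousLinearMap.snd ℝ 𝔼 ℂ)

theorem tubeForm_apply (P₁ P₂ P₃ : ℝ → ℝ) (α : OneForm (bindingModel m) (B × ℂ)) (b : B) (z : ℂ)
    (v : 𝔼 × ℂ) :
    tubeForm m P₁ P₂ P₃ α (b, z) v = P₁ (‖z‖ ^ 2) * α (b, z) v + P₂ (‖z‖ ^ 2) * α (b, 0) (v.1, 0) +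
      P₃ (‖z‖ ^ 2) * (z.re * v.2.im - z.im * v.2.re) := by
  rw [← rotationForm_apply]
  rfl

variable {m}
variable [IsManifold (𝓡 (2 * m + 1)) ∞ B]

theorem inChart_bindingPullback (α : OneForm (bindingModel m) (B × ℂ)) (b : B) (y : 𝔼) (w : ℂ)
    (hy : y ∈ (extChartAt (𝓡 (2 * m + 1)) b).target) :
    OneForm.inChart (bindingModel m) (bindingPullback m α) (b, 0) (y, w) =
      (OneForm.inChart (bindingModel m) α (b, 0) (y, 0)).comp
        ((ContinuousLinearMap.inl ℝ 𝔼 ℂ).comp (ContinuousLinearMap.fst ℝ 𝔼 ℂ)) := by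
  refine ContinuousLinearMap.ext fun v ↦ ?_
  have := inChart_apply m (bindingPullback m α) b 0 y w hy v
  rw [this]
  refine Eq.trans ?_ (inChart_apply m α b 0 y 0 hy (v.1, 0)).symm
  rfl

theorem inChart_restrictBinding (α : OneForm (bindingModel m) (B × ℂ)) (b : B) (y : 𝔼)
    (hy : y ∈ (extChartAt (𝓡 (2 * m + 1)) b).target) :
    OneForm.inChart (𝓡 (2 * m + 1)) (restrictBinding m α) b y =
      (OneForm.inChart (bindingModel m) α (b, 0) (y, 0)).comp (ContinuousLinearMap.inl ℝ 𝔼 ℂ) := by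
  refine ContinuousLinearMap.ext fun v ↦ ?_
  refine Eq.trans ?_ (inChart_apply m α b 0 y 0 hy (v, 0)).symm
  rfl

theorem inChart_tubeForm (P₁ P₂ P₃ : ℝ → ℝ) (α : OneForm (bindingModel m) (B × ℂ)) (b : B) (y : 𝔼)
    (w : ℂ) (hy : y ∈ (extChartAt (𝓡 (2 * m + 1)) b).target) :
    OneForm.inChart (bindingModel m) (tubeForm m P₁ P₂ P₃ α) (b, 0) (y, w) =
      P₁ (‖w‖ ^ 2) • OneForm.inChart (bindingModel m) α (b, 0) (y, w) +
      P₂ (‖w‖ ^ 2) • (OneForm.inChart (bindingModel m) α (b, 0) (y, 0)).comp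
        ((ContinuousLinearMap.inl ℝ 𝔼 ℂ).comp (ContinuousLinearMap.fst ℝ 𝔼 ℂ)) +
      P₃ (‖w‖ ^ 2) • (rotationForm w).comp (ContinuousLinearMap.snd ℝ 𝔼 ℂ) := by
  rw [← inChart_bindingPullback α b y w hy]
  refine ContinuousLinearMap.ext fun v ↦ ?_
  have h1 := inChart_apply m (tubeForm m P₁ P₂ P₃ α) b 0 y w hy v
  have h2 := inChart_apply m α b 0 y w hy v
  have h3 := inChart_apply m (bindingPullback m α) b 0 y w hy v
  rw [h1]
  simp only [add_apply, smul_apply]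
  erw [h2, h3]
  rfl

theorem inChart_self_apply (α : OneForm (bindingModel m) (B × ℂ)) (b : B) (z : ℂ) (v : 𝔼 × ℂ) :
    OneForm.inChart (bindingModel m) α (b, 0) (extChartAt (𝓡 (2 * m + 1)) b b, z) v =
      α (b, z) v := by
  have := inChart_apply m α b 0 (extChartAt (𝓡 (2 * m + 1)) b b) z (mem_extChartAt_target b) v
  rw [this, chartFrame_self, extChartAt_to_inv]
  rfl

/-- The inclusion of B × {0} is linear in the chart, so the chain rule shows that d commutes with
restriction to B. -/
theorem dWithin_restrictBinding {α : OneForm (bindingModel m) (B × ℂ)}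
    (hα : OneForm.SmoothOn (bindingModel m) α (solidTube B 1)) (b : B) (u v : 𝔼) :
    OneForm.dWithin (𝓡 (2 * m + 1)) (restrictBinding m α) univ b u v =
      OneForm.dWithin (bindingModel m) α (solidTube B 1) (b, 0) (u, 0) (v, 0) := by
  set y₀ := extChartAt (𝓡 (2 * m + 1)) b b
  set a := OneForm.inChart (bindingModel m) α (b, 0)
  have hy₀ : y₀ ∈ (extChartAt (𝓡 (2 * m + 1)) b).target := mem_extChartAt_target b
  have ha := (differentiableWithinAt_inChart m hα b y₀ hy₀ 0 (by simp)).hasFDerivWithinAt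
  set D := fderivWithin ℝ a (univ ×ˢ Metric.closedBall 0 1) (y₀, (0 : ℂ))
  have h1 : HasFDerivAt (fun y : 𝔼 ↦ (y, (0 : ℂ))) (ContinuousLinearMap.inl ℝ 𝔼 ℂ) y₀ :=
    (ContinuousLinearMap.inl ℝ 𝔼 ℂ).hasFDerivAt
  have h2 : HasFDerivAt (fun y : 𝔼 ↦ a (y, (0 : ℂ))) (D.comp (ContinuousLinearMap.inl ℝ 𝔼 ℂ)) y₀ := by
    rw [← hasFDerivWithinAt_univ] at h1 ⊢
    exact HasFDerivWithinAt.comp (g := a) (t := univ ×ˢ Metric.closedBall 0 1) y₀ ha h1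
      (fun y _ ↦ ⟨trivial, by simp⟩)
  have h3 := h2.clm_comp (hasFDerivAt_const (ContinuousLinearMap.inl ℝ 𝔼 ℂ) y₀)
  have h4 : OneForm.inChart (𝓡 (2 * m + 1)) (restrictBinding m α) b =ᶠ[𝓝 y₀]
      fun y ↦ (a (y, 0)).comp (ContinuousLinearMap.inl ℝ 𝔼 ℂ) := by
    filter_upwards [extChartAt_target_mem_nhds b] with y hy
    exact inChart_restrictBinding α b y hy
  have h5 := (h3.congr_of_eventuallyEq h4).fderiv
  rw [dWithin_eq]
  simp only [OneForm.dWithin]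
  have e2 : (extChartAt (𝓡 (2 * m + 1)) b).symm ⁻¹' univ ∩ range (𝓡 (2 * m + 1)) = univ := by simp
  rw [e2, fderivWithin_univ]
  erw [h5]
  simp
  rfl

/-- Leibniz rule with dq = 2(x dx + y dy). The last term is d(P₃ η) = 2(P₃ + q P₃') dx ∧ dy, because
dq ∧ η = 2q dx ∧ dy. -/
theorem dWithin_tubeForm {α : OneForm (bindingModel m) (B × ℂ)}
    (hα : OneForm.SmoothOn (bindingModel m) α (solidTube B 1)) {P₁ P₂ P₃ : ℝ → ℝ} (b : B) (z : ℂ)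
    (hz : ‖z‖ ≤ 1) (h₁ : DifferentiableAt ℝ P₁ (‖z‖ ^ 2)) (h₂ : DifferentiableAt ℝ P₂ (‖z‖ ^ 2))
    (h₃ : DifferentiableAt ℝ P₃ (‖z‖ ^ 2)) (u v : 𝔼 × ℂ) :
    OneForm.dWithin (bindingModel m) (tubeForm m P₁ P₂ P₃ α) (solidTube B 1) (b, z) u v =
      P₁ (‖z‖ ^ 2) * OneForm.dWithin (bindingModel m) α (solidTube B 1) (b, z) u v +
      P₂ (‖z‖ ^ 2) * OneForm.dWithin (bindingModel m) α (solidTube B 1) (b, 0) (u.1, 0) (v.1, 0) +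
      deriv P₁ (‖z‖ ^ 2) * (2 * (z.re * u.2.re + z.im * u.2.im) * α (b, z) v -
        2 * (z.re * v.2.re + z.im * v.2.im) * α (b, z) u) +
      deriv P₂ (‖z‖ ^ 2) * (2 * (z.re * u.2.re + z.im * u.2.im) * α (b, 0) (v.1, 0) -
        2 * (z.re * v.2.re + z.im * v.2.im) * α (b, 0) (u.1, 0)) +
      2 * (P₃ (‖z‖ ^ 2) + ‖z‖ ^ 2 * deriv P₃ (‖z‖ ^ 2)) *
        (u.2.re * v.2.im - u.2.im * v.2.re) := by
  set y₀ := extChartAt (𝓡 (2 * m + 1)) b b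
  set a := OneForm.inChart (bindingModel m) α (b, 0)
  set s : Set (𝔼 × ℂ) := univ ×ˢ Metric.closedBall 0 1
  have hy₀ : y₀ ∈ (extChartAt (𝓡 (2 * m + 1)) b).target := mem_extChartAt_target b
  have hs : UniqueDiffWithinAt ℝ s (y₀, z) :=
    uniqueDiffOn_univ_prod_closedBall 𝔼 one_pos _ ⟨trivial, by simpa using hz⟩
  have ha := (differentiableWithinAt_inChart m hα b y₀ hy₀ z hz).hasFDerivWithinAt
  have ha0 := (differentiableWithinAt_inChart m hα b y₀ hy₀ 0 (by simp)).hasFDerivWithinAt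
  rw [dWithin_eq, dWithin_eq, dWithin_eq]
  set D := fderivWithin ℝ a s (y₀, z)
  set D₀ := fderivWithin ℝ a s (y₀, (0 : ℂ))
  let ι : 𝔼 × ℂ →L[ℝ] 𝔼 × ℂ := (ContinuousLinearMap.inl ℝ 𝔼 ℂ).comp (ContinuousLinearMap.fst ℝ 𝔼 ℂ)
  have hpb : HasFDerivWithinAt (fun x : 𝔼 × ℂ ↦ a (x.1, 0)) (D₀.comp ι) s (y₀, z) :=
    HasFDerivWithinAt.comp (g := a) (f := fun x : 𝔼 × ℂ ↦ (x.1, (0 : ℂ))) (y₀, z) ha0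
      ι.hasFDerivWithinAt (fun y _ ↦ ⟨trivial, by simp⟩)
  have hpb' := hpb.clm_comp (hasFDerivWithinAt_const ι (y₀, z) s)
  have hq : HasFDerivWithinAt (fun x : 𝔼 × ℂ ↦ ‖x.2‖ ^ 2)
      ((2 • innerSL ℝ z).comp (ContinuousLinearMap.snd ℝ 𝔼 ℂ)) s (y₀, z) :=
    (HasFDerivAt.comp (g := fun w : ℂ ↦ ‖w‖ ^ 2) (f := fun x : 𝔼 × ℂ ↦ x.2) (y₀, z)
      (hasStrictFDerivAt_norm_sq z).hasFDerivAt
      (ContinuousLinearMap.snd ℝ 𝔼 ℂ).hasFDerivAt).hasFDerivWithinAt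
  have hP : ∀ P : ℝ → ℝ, DifferentiableAt ℝ P (‖z‖ ^ 2) →
      HasFDerivWithinAt (fun x : 𝔼 × ℂ ↦ P (‖x.2‖ ^ 2)) (deriv P (‖z‖ ^ 2) •
        ((2 • innerSL ℝ z).comp (ContinuousLinearMap.snd ℝ 𝔼 ℂ))) s (y₀, z) :=
    fun P hP ↦ hP.hasDerivAt.comp_hasFDerivWithinAt (y₀, z) hq
  have hη : HasFDerivWithinAt (fun x : 𝔼 × ℂ ↦ (rotationForm x.2).comp (ContinuousLinearMap.snd ℝ 𝔼 ℂ))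
      (((ContinuousLinearMap.compL ℝ (𝔼 × ℂ) ℂ ℝ).flip (ContinuousLinearMap.snd ℝ 𝔼 ℂ)).comp
        (rotationForm.comp (ContinuousLinearMap.snd ℝ 𝔼 ℂ))) s (y₀, z) :=
    ContinuousLinearMap.hasFDerivWithinAt (((ContinuousLinearMap.compL ℝ (𝔼 × ℂ) ℂ ℝ).flip
      (ContinuousLinearMap.snd ℝ 𝔼 ℂ)).comp (rotationForm.comp (ContinuousLinearMap.snd ℝ 𝔼 ℂ)))
  have hall := (((hP P₁ h₁).smul ha).add ((hP P₂ h₂).smul hpb')).add ((hP P₃ h₃).smul hη)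
  have h4 : ∀ᶠ x in 𝓝[s] (y₀, z), OneForm.inChart (bindingModel m) (tubeForm m P₁ P₂ P₃ α) (b, 0) x =
      P₁ (‖x.2‖ ^ 2) • a x + P₂ (‖x.2‖ ^ 2) • (a (x.1, 0)).comp ι +
      P₃ (‖x.2‖ ^ 2) • (rotationForm x.2).comp (ContinuousLinearMap.snd ℝ 𝔼 ℂ) := by
    have : ∀ᶠ x : 𝔼 × ℂ in 𝓝[s] (y₀, z), x.1 ∈ (extChartAt (𝓡 (2 * m + 1)) b).target :=
      nhdsWithin_le_nhds (continuous_fst.continuousAt.preimage_mem_nhds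
        (extChartAt_target_mem_nhds (I := 𝓡 (2 * m + 1)) b))
    filter_upwards [this] with x hx
    exact inChart_tubeForm P₁ P₂ P₃ α b x.1 x.2 hx
  have h5 := (hall.congr_of_eventuallyEq h4
    (h4.self_of_nhdsWithin ⟨trivial, by simpa using hz⟩)).fderivWithin hs
  have ea : ∀ v, a (y₀, z) v = α (b, z) v := inChart_self_apply α b z
  have ea0 : ∀ v, a (y₀, 0) v = α (b, 0) v := inChart_self_apply α b 0
  have eq : ‖z‖ ^ 2 = z.re * z.re + z.im * z.im := by rw [Complex.sq_norm, Complex.normSq_apply]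
  rw [h5]
  have hin : ∀ w : ℂ, inner ℝ z w = z.re * w.re + z.im * w.im := fun w ↦ by
    rw [Complex.inner]; simp [Complex.mul_re]; ring
  simp [ι, ea0, hin, rotationForm_apply]
  have ea' : ∀ v, OneForm.inChart (bindingModel m) α (b, 0) (y₀, z) v = α (b, z) v := ea
  rw [eq, ea', ea']
  ring

/-- `dWithin` at `b` uses the chart chosen for `b`, which may jump as `b` moves. Along a frame
transported by the fixed chart at `b₀` the values are those of one smooth local expression, hence
vary smoothly with `b`. -/
theorem dWithin_chartFrame {α : OneForm (bindingModel m) (B × ℂ)}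
    (hα : OneForm.SmoothOn (bindingModel m) α (solidTube B 1)) (b₀ b : B)
    (hb : b ∈ (chartAt 𝔼 b₀).source) (z : ℂ) (hz : ‖z‖ < 1) (u v : 𝔼 × ℂ) :
    OneForm.dWithin (bindingModel m) α (solidTube B 1) (b, z)
      (chartFrame m b₀ (extChartAt (𝓡 (2 * m + 1)) b₀ b) u.1, u.2)
      (chartFrame m b₀ (extChartAt (𝓡 (2 * m + 1)) b₀ b) v.1, v.2) =
    fderiv ℝ (OneForm.inChart (bindingModel m) α (b₀, 0)) (extChartAt (𝓡 (2 * m + 1)) b₀ b, z) u v -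
    fderiv ℝ (OneForm.inChart (bindingModel m) α (b₀, 0))
      (extChartAt (𝓡 (2 * m + 1)) b₀ b, z) v u := by
  set e₀ := extChartAt (𝓡 (2 * m + 1)) b₀
  set e := extChartAt (𝓡 (2 * m + 1)) b
  set a := OneForm.inChart (bindingModel m) α (b, 0)
  set a₀ := OneForm.inChart (bindingModel m) α (b₀, 0)
  have hb' : b ∈ e₀.source := by simpa [e₀] using hb
  have hy₀ : e₀ b ∈ e₀.target := e₀.map_source hb'
  let τ : 𝔼 → 𝔼 := e ∘ e₀.symm
  have hτ0 : τ (e₀ b) = e b := by simp [τ, e₀.left_inv hb']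
  have hτ : ContDiffAt ℝ ∞ τ (e₀ b) := by
    have := contDiffWithinAt_ext_coord_change (I := 𝓡 (2 * m + 1)) (n := ∞) b b₀ (y := e₀ b) (by
      rw [PartialEquiv.trans_source]
      refine ⟨hy₀, ?_⟩
      change e₀.symm (e₀ b) ∈ e.source
      rw [e₀.left_inv hb']
      exact mem_extChartAt_source b)
    have e2 : range (𝓡 (2 * m + 1)) = univ := by simp
    rw [e2, contDiffWithinAt_univ] at this
    exact this
  have hframe : ∀ᶠ y in 𝓝 (e₀ b), y ∈ e₀.target ∧ τ y ∈ e.target ∧ e.symm (τ y) = e₀.symm y ∧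
      chartFrame m b₀ y = (chartFrame m b (τ y)).comp (fderiv ℝ τ y) := by
    have h1 : ∀ᶠ y in 𝓝 (e₀ b), y ∈ e₀.target := extChartAt_target_mem_nhds' hy₀
    have hcont : ContinuousAt e₀.symm (e₀ b) := continuousAt_extChartAt_symm' hb'
    have h2 : ∀ᶠ y in 𝓝 (e₀ b), e₀.symm y ∈ e.source :=
      hcont.preimage_mem_nhds (by
        rw [e₀.left_inv hb']
        exact extChartAt_source_mem_nhds b)
    have h3 : ∀ᶠ y in 𝓝 (e₀ b), ContDiffAt ℝ 1 τ y :=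
      (hτ.of_le (by norm_num)).eventually (by simp)
    filter_upwards [h1, h2.eventually_nhds, h3] with y i1 i2 i3
    have i2' := i2.self_of_nhds
    have i4 : τ y ∈ e.target := e.map_source i2'
    refine ⟨i1, i4, e.left_inv i2', ?_⟩
    have j1 : MDifferentiableAt 𝓘(ℝ, 𝔼) (𝓡 (2 * m + 1)) e.symm (τ y) := by
      have := mdifferentiableWithinAt_extChartAt_symm i4
      rw [show range (𝓡 (2 * m + 1)) = univ by simp, mdifferentiableWithinAt_univ] at this
      exact this
    have j2 : MDifferentiableAt 𝓘(ℝ, 𝔼) 𝓘(ℝ, 𝔼) τ y :=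
      (i3.differentiableAt (by norm_num)).mdifferentiableAt
    have j3 : e₀.symm =ᶠ[𝓝 y] e.symm ∘ τ := by
      filter_upwards [i2] with y' hy'
      exact (e.left_inv hy').symm
    have e2 : range (𝓡 (2 * m + 1)) = univ := by simp
    have j4 := j3.mfderiv_eq (I := 𝓘(ℝ, 𝔼)) (I' := 𝓡 (2 * m + 1))
    have j5 := mfderiv_comp y j1 j2
    rw [mfderiv_eq_fderiv] at j5
    simp only [chartFrame]
    rw [e2, mfderivWithin_univ, mfderivWithin_univ]
    exact j4.trans j5
  let T : 𝔼 × ℂ → 𝔼 × ℂ := Prod.map τ id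
  have hT : ContDiffAt ℝ 2 T (e₀ b, z) :=
    ContDiffAt.prodMap (x := e₀ b) (y := z) (hτ.of_le (by norm_cast)) contDiffAt_id
  have hTd : ∀ᶠ y in 𝓝 (e₀ b), ∀ w : ℂ, fderiv ℝ T (y, w) =
      (fderiv ℝ τ y).prodMap (ContinuousLinearMap.id ℝ ℂ) := by
    have h3 : ∀ᶠ y in 𝓝 (e₀ b), ContDiffAt ℝ 1 τ y :=
      (hτ.of_le (by norm_num)).eventually (by simp)
    filter_upwards [h3] with y hy w
    exact (HasFDerivAt.prodMap (p := (y, w)) (hy.differentiableAt (by norm_num)).hasFDerivAt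
      (hasFDerivAt_id w)).fderiv
  have hball : univ ×ˢ Metric.closedBall (0 : ℂ) 1 ∈ 𝓝 (e b, z) :=
    prod_mem_nhds Filter.univ_mem (Metric.closedBall_mem_nhds_of_mem (by simpa using hz))
  have ha : DifferentiableAt ℝ a (T (e₀ b, z)) := by
    have := differentiableWithinAt_inChart m hα b (e b) (mem_extChartAt_target b) z hz.le
    simp only [T, Prod.map, hτ0, id]
    exact this.differentiableAt hball
  -- With `T` the change of charts, the expression in the chart at `b₀` is the pullback of the one
  -- in the chart at `b`, so `fderiv_pullback_skew` applies.
  have hpull : a₀ =ᶠ[𝓝 (e₀ b, z)] fun x ↦ (a (T x)).comp (fderiv ℝ T x) := by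
    rw [nhds_prod_eq]
    filter_upwards [(hframe.and hTd).prod_inl (𝓝 z)] with ⟨y, w⟩ ⟨⟨h1, h2, h3, h4⟩, h5⟩
    refine ContinuousLinearMap.ext fun v ↦ ?_
    have i1 := inChart_apply m α b₀ 0 y w h1 v
    have i2 := inChart_apply m α b 0 (τ y) w h2 (fderiv ℝ τ y v.1, v.2)
    simp only at h5
    simp only [ContinuousLinearMap.comp_apply, h5]
    refine i1.trans (Eq.trans ?_ i2.symm)
    simp only at h4
    rw [h4]
    erw [h3]
    rfl
  have key := fderiv_pullback_skew ha hT u v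
  have hself := hframe.self_of_nhds.2.2.2
  have hLτ : chartFrame m b₀ (e₀ b) = fderiv ℝ τ (e₀ b) := by
    rw [hself, hτ0, chartFrame_self]
    rfl
  rw [hpull.fderiv_eq, key, hTd.self_of_nhds z, dWithin_eq,
    fderivWithin_of_mem_nhds hball, hLτ]
  simp [T, hτ0, e, a]
  rfl
end TubeDerivatives

/-! ### Wedge powers as top coefficients in an exterior algebra. -/

section WedgeAlgebra

theorem prod_ofFn_two_mul {R : Type*} [Monoid R] {k : ℕ} (f : Fin (2 * k) → R) :
    (List.ofFn f).prod =
      (List.ofFn fun i : Fin k ↦ f ⟨2 * i.val, by omega⟩ * f ⟨2 * i.val + 1, by omega⟩).prod := by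
  rw [List.ofFn_mul', List.prod_flatten, List.map_ofFn]
  congr 1
  simp [Function.comp_def]

open ExteriorAlgebra in
/-- The coefficient of `e₀ ∧ ⋯ ∧ e_{N-1}` of an element of the exterior algebra of `ℝᴺ`. -/
def topCoeff (N : ℕ) : ExteriorAlgebra ℝ (Fin N → ℝ) →ₗ[ℝ] ℝ :=
  liftAlternating (Pi.single N (Matrix.detRowAlternating (n := Fin N) (R := ℝ)))

theorem topCoeff_ιMulti {N : ℕ} (x : Fin N → Fin N → ℝ) :
    topCoeff N (ExteriorAlgebra.ιMulti ℝ N x) = Matrix.det (Matrix.of x) := by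
  rw [topCoeff, ExteriorAlgebra.liftAlternating_apply_ιMulti, Pi.single_eq_same]
  rfl

theorem topCoeff_ιMulti_of_ne {N n : ℕ} (h : n ≠ N) (x : Fin n → Fin N → ℝ) :
    topCoeff N (ExteriorAlgebra.ιMulti ℝ n x) = 0 := by
  rw [topCoeff, ExteriorAlgebra.liftAlternating_apply_ιMulti, Pi.single_eq_of_ne h]
  rfl

/-- The standard generators of the exterior algebra of `ℝᴺ`. -/
def extGen {N : ℕ} (i : Fin N) : ExteriorAlgebra ℝ (Fin N → ℝ) :=
  ExteriorAlgebra.ι ℝ (Pi.single i 1)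

/-- The 2-form with matrix `w`, as an element of the exterior algebra. -/
def extTwoForm {N : ℕ} (w : Fin N → Fin N → ℝ) : ExteriorAlgebra ℝ (Fin N → ℝ) :=
  ∑ p : Fin N × Fin N, (1 / 2 * w p.1 p.2) • (extGen p.1 * extGen p.2)

/-- The index in position `j` of the concatenation of `k` pairs of indices. -/
def pairIndex {N k : ℕ} (r : Fin k → Fin N × Fin N) (j : Fin (2 * k)) : Fin N :=
  if j.val % 2 = 0 then (r ⟨j.val / 2, by omega⟩).1 else (r ⟨j.val / 2, by omega⟩).2

theorem pairIndex_even {N k : ℕ} (r : Fin k → Fin N × Fin N) (i : Fin k) :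
    pairIndex r ⟨2 * i.val, by omega⟩ = (r i).1 := by
  simp [pairIndex]

theorem pairIndex_odd {N k : ℕ} (r : Fin k → Fin N × Fin N) (i : Fin k) :
    pairIndex r ⟨2 * i.val + 1, by omega⟩ = (r i).2 := by
  have : (2 * i.val + 1) / 2 = i.val := by omega
  simp [pairIndex, this, Nat.add_mod]

theorem extTwoForm_pow {N : ℕ} (w : Fin N → Fin N → ℝ) (k : ℕ) :
    extTwoForm w ^ k = ∑ r : Fin k → Fin N × Fin N,
      (1 / 2 ^ k * ∏ i, w (r i).1 (r i).2) •
        ExteriorAlgebra.ιMulti ℝ (2 * k) (fun j ↦ Pi.single (pairIndex r j) (1 : ℝ)) := by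
  have h : extTwoForm w ^ k =
      MultilinearMap.mkPiAlgebraFin ℝ k (ExteriorAlgebra ℝ (Fin N → ℝ)) fun _ ↦ extTwoForm w := by
    simp [MultilinearMap.mkPiAlgebraFin_apply]
  rw [h]
  simp only [extTwoForm]
  rw [MultilinearMap.map_sum]
  refine Finset.sum_congr rfl fun r _ ↦ ?_
  rw [MultilinearMap.map_smul_univ, Finset.prod_mul_distrib, MultilinearMap.mkPiAlgebraFin_apply,
    ExteriorAlgebra.ιMulti_apply, prod_ofFn_two_mul]
  simp [pairIndex_even, pairIndex_odd, extGen]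

theorem det_of_eq_sum {N : ℕ} (x : Fin N → Fin N → ℝ) :
    Matrix.det (Matrix.of x) =
      ∑ σ : Equiv.Perm (Fin N), ((Equiv.Perm.sign σ : ℤ) : ℝ) * ∏ j, x j (σ j) := by
  rw [← Matrix.det_transpose, Matrix.det_apply']
  rfl

/-- The product over `j` is a product of Kronecker deltas, which leaves the single `r` that lists
the values of `s` in consecutive pairs. -/
theorem sum_pairs {N k : ℕ} (w : Fin N → Fin N → ℝ) (s : Fin (2 * k) → Fin N) :
    ∑ r : Fin k → Fin N × Fin N, (∏ i, w (r i).1 (r i).2) *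
      ∏ j, (Pi.single (pairIndex r j) (1 : ℝ) : Fin N → ℝ) (s j) =
    ∏ i : Fin k, w (s ⟨2 * i.val, by omega⟩) (s ⟨2 * i.val + 1, by omega⟩) := by
  have h : ∀ r : Fin k → Fin N × Fin N,
      ∏ j, (Pi.single (pairIndex r j) (1 : ℝ) : Fin N → ℝ) (s j) =
        ∏ i : Fin k, if r i = (s ⟨2 * i.val, by omega⟩, s ⟨2 * i.val + 1, by omega⟩)
          then (1 : ℝ) else 0 := by
    intro r
    rw [← List.prod_ofFn, prod_ofFn_two_mul, List.prod_ofFn]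
    refine Finset.prod_congr rfl fun i _ ↦ ?_
    rw [pairIndex_even, pairIndex_odd]
    simp only [Pi.single_apply, Prod.ext_iff]
    split_ifs <;> simp_all
  simp_rw [h, ← Finset.prod_mul_distrib]
  have := (Fintype.piFinset_univ (α := Fin k) (β := fun _ ↦ Fin N × Fin N))
  rw [← this, ← Finset.prod_univ_sum (fun _ ↦ Finset.univ) (fun (i : Fin k) (p : Fin N × Fin N) ↦ w p.1 p.2 * if p =
    (s ⟨2 * i.val, by omega⟩, s ⟨2 * i.val + 1, by omega⟩) then (1 : ℝ) else 0)]
  simp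

variable {V : Type*}

/-- Expanding the power of the 2-form gives monomials whose top coefficients are determinants; their
Leibniz formulas reassemble into the sum over permutations, with the same factor 1/2^k. The exterior
algebra is the one generated by the covectors dual to the frame `v`. -/
theorem wedgePow_eq_topCoeff (k : ℕ) (w : V → V → ℝ) (v : Fin (2 * k) → V) :
    wedgePow k w v = topCoeff (2 * k) (extTwoForm (fun i j ↦ w (v i) (v j)) ^ k) := by
  rw [extTwoForm_pow, map_sum]
  simp only [map_smul, topCoeff_ιMulti, det_of_eq_sum, smul_eq_mul, Finset.mul_sum]
  rw [Finset.sum_comm, wedgePow, Finset.mul_sum]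
  refine Finset.sum_congr rfl fun σ _ ↦ ?_
  rw [← sum_pairs (fun i j ↦ w (v i) (v j)) σ, Finset.mul_sum, Finset.mul_sum]
  refine Finset.sum_congr rfl fun r _ ↦ ?_
  ring

theorem wedgeOnePow_eq_topCoeff (k : ℕ) (a : V → ℝ) (w : V → V → ℝ) (v : Fin (2 * k + 1) → V) :
    wedgeOnePow k a w v = topCoeff (2 * k + 1)
      (ExteriorAlgebra.ι ℝ (fun i ↦ a (v i)) * extTwoForm (fun i j ↦ w (v i) (v j)) ^ k) := by
  rw [extTwoForm_pow, Finset.mul_sum, map_sum]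
  have h : ∀ r : Fin k → Fin (2 * k + 1) × Fin (2 * k + 1),
      ExteriorAlgebra.ι ℝ (fun i ↦ a (v i)) * ExteriorAlgebra.ιMulti ℝ (2 * k)
        (fun j ↦ Pi.single (pairIndex r j) (1 : ℝ)) = ExteriorAlgebra.ιMulti ℝ (2 * k + 1)
          (Fin.cons (fun i ↦ a (v i)) fun j ↦ Pi.single (pairIndex r j) (1 : ℝ)) := by
    intro r
    rw [ExteriorAlgebra.ιMulti_succ_apply]
    rfl
  simp only [mul_smul_comm, h, map_smul, topCoeff_ιMulti, det_of_eq_sum, smul_eq_mul,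
    Finset.mul_sum]
  rw [Finset.sum_comm, wedgeOnePow, Finset.mul_sum]
  refine Finset.sum_congr rfl fun σ _ ↦ ?_
  have := sum_pairs (fun i j ↦ w (v i) (v j)) (fun j : Fin (2 * k) ↦ σ j.succ)
  simp only [Fin.succ_mk] at this
  rw [← this, Finset.mul_sum, Finset.mul_sum, Finset.mul_sum]
  refine Finset.sum_congr rfl fun r _ ↦ ?_
  rw [Fin.prod_univ_succ]
  simp only [Fin.cons_zero, Fin.cons_succ]
  ring

end WedgeAlgebra

/-! ### Computation rules in the exterior algebra. -/

section WedgeIdentities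

open ExteriorAlgebra

/-- Moving a product of two generators past a third one costs two signs, which cancel. -/
theorem commute_ι_mul_ι {M : Type*} [AddCommGroup M] [Module ℝ M] (x y : M)
    (Z : ExteriorAlgebra ℝ M) : Commute (ι ℝ x * ι ℝ y) Z := by
  have swap : ∀ a b : M, ι ℝ a * ι ℝ b = -(ι ℝ b * ι ℝ a) := fun a b ↦
    eq_neg_of_add_eq_zero_left (ι_add_mul_swap a b)
  induction Z using ExteriorAlgebra.induction with
  | algebraMap r => exact (Algebra.commutes r _).symm
  | ι z =>
    rw [Commute, SemiconjBy, mul_assoc, swap y z, mul_neg, ← mul_assoc, swap x z, neg_mul, neg_neg,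
      mul_assoc]
  | mul a b ha hb => exact ha.mul_right hb
  | add a b ha hb => exact ha.add_right hb

theorem commute_extTwoForm {N : ℕ} (w : Fin N → Fin N → ℝ) (Z : ExteriorAlgebra ℝ (Fin N → ℝ)) :
    Commute (extTwoForm w) Z :=
  Commute.sum_left _ _ _ fun _ _ ↦ (commute_ι_mul_ι _ _ Z).smul_left _

theorem ι_eq_sum {N : ℕ} (x : Fin N → ℝ) : ι ℝ x = ∑ i, x i • extGen i := by
  conv_lhs => rw [pi_eq_sum_univ' x]
  rw [map_sum]
  refine Finset.sum_congr rfl fun i _ ↦ ?_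
  rw [map_smul, extGen]

theorem ι_mul_ι_eq_extTwoForm {N : ℕ} (ξ ζ : Fin N → ℝ) :
    extTwoForm (fun i j ↦ ξ i * ζ j - ξ j * ζ i) = ι ℝ ξ * ι ℝ ζ := by
  have h1 : ∀ ξ ζ : Fin N → ℝ, ι ℝ ξ * ι ℝ ζ = ∑ p : Fin N × Fin N,
      (ξ p.1 * ζ p.2) • (extGen p.1 * extGen p.2) := by
    intro ξ ζ
    rw [ι_eq_sum ξ, ι_eq_sum ζ, Finset.sum_mul_sum, Fintype.sum_prod_type]
    simp [smul_smul, mul_comm]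
  have h2 : ι ℝ ξ * ι ℝ ζ = (1 / 2 : ℝ) • (ι ℝ ξ * ι ℝ ζ - ι ℝ ζ * ι ℝ ξ) := by
    rw [eq_neg_of_add_eq_zero_left (ι_add_mul_swap ζ ξ), sub_neg_eq_add, ← two_smul ℝ, smul_smul]
    norm_num
  rw [h2, h1, h1, ← Finset.sum_sub_distrib, Finset.smul_sum]
  refine Finset.sum_congr rfl fun p _ ↦ ?_
  rw [← sub_smul, smul_smul]
  congr 1
  ring

theorem extTwoForm_add {N : ℕ} (w w' : Fin N → Fin N → ℝ) :
    extTwoForm (fun i j ↦ w i j + w' i j) = extTwoForm w + extTwoForm w' := by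
  simp only [extTwoForm, mul_add, add_smul, Finset.sum_add_distrib]

theorem extTwoForm_smul {N : ℕ} (c : ℝ) (w : Fin N → Fin N → ℝ) :
    extTwoForm (fun i j ↦ c * w i j) = c • extTwoForm w := by
  simp only [extTwoForm, Finset.smul_sum, smul_smul]
  refine Finset.sum_congr rfl fun p _ ↦ ?_
  congr 1
  ring

theorem add_pow_of_sq_eq_zero {R : Type*} [Ring R] {W s : R} (hs : s * s = 0) (hW : Commute W s)
    (n : ℕ) : (W + s) ^ (n + 1) = W ^ (n + 1) + (n + 1 : ℕ) • (s * W ^ n) := by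
  induction n with
  | zero => simp
  | succ n ih =>
    rw [pow_succ, ih, add_mul, mul_add, mul_add, smul_mul_assoc, smul_mul_assoc, mul_assoc s,
      ← pow_succ, mul_assoc s, (hW.pow_left n).eq, ← mul_assoc s s, hs, zero_mul, smul_zero,
      add_zero, (hW.pow_left (n + 1)).eq, succ_nsmul _ (n + 1),
      ← pow_succ]
    abel

theorem ι_mul_ι_mul_self {M : Type*} [AddCommGroup M] [Module ℝ M] (x y : M) :
    ι ℝ x * ι ℝ y * (ι ℝ x * ι ℝ y) = 0 := by
  rw [mul_assoc, ← mul_assoc (ι ℝ y), eq_neg_of_add_eq_zero_left (ι_add_mul_swap y x), neg_mul,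
    mul_neg, mul_assoc, ι_sq_zero, mul_zero, mul_zero, neg_zero]

/-- In degree N a linear map acts by its determinant; in the other degrees both sides vanish. -/
theorem topCoeff_map {N : ℕ} (A : Matrix (Fin N) (Fin N) ℝ) (X : ExteriorAlgebra ℝ (Fin N → ℝ)) :
    topCoeff N (map A.mulVecLin X) = A.det * topCoeff N X := by
  have : (topCoeff N).comp (map A.mulVecLin).toLinearMap = A.det • topCoeff N := by
    ext n x
    simp only [LinearMap.compAlternatingMap_apply, LinearMap.comp_apply, AlgHom.toLinearMap_apply,
      map_apply_ιMulti, LinearMap.smul_apply, smul_eq_mul]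
    by_cases hn : n = N
    · subst hn
      rw [topCoeff_ιMulti, topCoeff_ιMulti, mul_comm, ← Matrix.det_transpose A, ← Matrix.det_mul]
      congr 1
      ext i j
      simp [Matrix.mul_apply, Matrix.mulVec, dotProduct, mul_comm]
    · rw [topCoeff_ιMulti_of_ne hn, topCoeff_ιMulti_of_ne hn, mul_zero]
  exact LinearMap.congr_fun this X

theorem map_extTwoForm {N : ℕ} (A : Matrix (Fin N) (Fin N) ℝ) (w : Fin N → Fin N → ℝ) :
    map A.mulVecLin (extTwoForm w) = extTwoForm fun i j ↦ ∑ k, ∑ l, A i k * A j l * w k l := by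
  have h : ∀ k, map A.mulVecLin (extGen k) = ∑ i, A i k • extGen i := by
    intro k
    rw [extGen, map_apply_ι, ι_eq_sum]
    simp
  simp only [extTwoForm, map_sum, map_smul, map_mul, h, Finset.sum_mul_sum, Finset.smul_sum]
  rw [Finset.sum_comm' (t' := Finset.univ) (s' := fun _ ↦ Finset.univ) (by simp),
    Fintype.sum_prod_type]
  refine Finset.sum_congr rfl fun i _ ↦ ?_
  rw [Finset.sum_comm]
  refine Finset.sum_congr rfl fun j _ ↦ ?_
  rw [Fintype.sum_prod_type, Finset.mul_sum, Finset.sum_smul]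
  refine Finset.sum_congr rfl fun k _ ↦ ?_
  rw [Finset.mul_sum, Finset.sum_smul]
  refine Finset.sum_congr rfl fun l _ ↦ ?_
  rw [smul_mul_smul_comm, smul_smul]
  congr 1
  ring

/-- Discarding the first coordinate. -/
def dropFirst (N : ℕ) : (Fin (N + 1) → ℝ) →ₗ[ℝ] (Fin N → ℝ) := LinearMap.funLeft ℝ ℝ Fin.succ

/-- Laplace expansion along the first row. It plays the role of contraction with the first vector of
the frame: e⁰ is split off, and then e⁰ = 0 is imposed on the remaining factors. -/
theorem topCoeff_extGen_zero_mul {N : ℕ} (X : ExteriorAlgebra ℝ (Fin (N + 1) → ℝ)) :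
    topCoeff (N + 1) (extGen 0 * X) = topCoeff N (map (dropFirst N) X) := by
  have : (topCoeff (N + 1)).comp (LinearMap.mulLeft ℝ (extGen 0)) =
      (topCoeff N).comp (map (dropFirst N)).toLinearMap := by
    ext n x
    simp only [LinearMap.compAlternatingMap_apply, LinearMap.comp_apply, AlgHom.toLinearMap_apply,
      map_apply_ιMulti, LinearMap.mulLeft_apply]
    have hcons : extGen 0 * ιMulti ℝ n x = ιMulti ℝ (n + 1) (Fin.cons (Pi.single 0 (1 : ℝ)) x) := by
      rw [ιMulti_succ_apply]
      rfl
    rw [hcons]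
    by_cases hn : n = N
    · subst hn
      rw [topCoeff_ιMulti, topCoeff_ιMulti, Matrix.det_succ_row_zero, Fin.sum_univ_succ]
      simp [Matrix.submatrix, dropFirst, LinearMap.funLeft, Function.comp_def]
    · rw [topCoeff_ιMulti_of_ne hn, topCoeff_ιMulti_of_ne (by omega)]
  exact LinearMap.congr_fun this X

theorem map_dropFirst_extTwoForm {N : ℕ} (w : Fin (N + 1) → Fin (N + 1) → ℝ) :
    map (dropFirst N) (extTwoForm w) = extTwoForm fun i j ↦ w i.succ j.succ := by
  have h0 : map (dropFirst N) (extGen 0) = 0 := by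
    have : dropFirst N (Pi.single 0 (1 : ℝ)) = 0 := by
      ext j
      simp [dropFirst, LinearMap.funLeft]
    rw [extGen, map_apply_ι, this, map_zero]
  have hs : ∀ i : Fin N, map (dropFirst N) (extGen i.succ) = extGen i := by
    intro i
    have : dropFirst N (Pi.single i.succ (1 : ℝ)) = Pi.single i 1 := by
      ext j
      simp [dropFirst, LinearMap.funLeft, Pi.single_apply]
    rw [extGen, map_apply_ι, this, extGen]
  simp only [extTwoForm, Fintype.sum_prod_type, Fin.sum_univ_succ]
  simp [h0, hs]

end WedgeIdentities

/-! ### Wedge identities for forms evaluated on frames. -/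

section WedgeFormulas

open ExteriorAlgebra

variable {V : Type*}

theorem wedgeOnePow_congr {k : ℕ} {V' : Type*} {a : V → ℝ} {w : V → V → ℝ} {v : Fin (2 * k + 1) → V}
    {a' : V' → ℝ} {w' : V' → V' → ℝ} {v' : Fin (2 * k + 1) → V'} (ha : ∀ i, a (v i) = a' (v' i))
    (hw : ∀ i j, w (v i) (v j) = w' (v' i) (v' j)) :
    wedgeOnePow k a w v = wedgeOnePow k a' w' v' := by
  simp only [wedgeOnePow, ha, hw]

theorem wedgePow_congr {k : ℕ} {V' : Type*} {w : V → V → ℝ} {v : Fin (2 * k) → V}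
    {w' : V' → V' → ℝ} {v' : Fin (2 * k) → V'}
    (hw : ∀ i j, w (v i) (v j) = w' (v' i) (v' j)) :
    wedgePow k w v = wedgePow k w' v' := by
  simp only [wedgePow, hw]

theorem wedgeOnePow_linear_left (k : ℕ) (s t : ℝ) (a b : V → ℝ) (w : V → V → ℝ)
    (v : Fin (2 * k + 1) → V) :
    wedgeOnePow k (fun x ↦ s * a x + t * b x) w v =
      s * wedgeOnePow k a w v + t * wedgeOnePow k b w v := by
  simp only [wedgeOnePow_eq_topCoeff]
  have : (fun i ↦ s * a (v i) + t * b (v i)) = s • (fun i ↦ a (v i)) + t • fun i ↦ b (v i) := rfl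
  rw [this, map_add, map_smul, map_smul, add_mul, smul_mul_assoc, smul_mul_assoc, map_add, map_smul,
    map_smul, smul_eq_mul, smul_eq_mul]

theorem wedgeOnePow_smul_right (k : ℕ) (c : ℝ) (a : V → ℝ) (w : V → V → ℝ)
    (v : Fin (2 * k + 1) → V) :
    wedgeOnePow k a (fun x y ↦ c * w x y) v = c ^ k * wedgeOnePow k a w v := by
  simp only [wedgeOnePow_eq_topCoeff]
  rw [extTwoForm_smul, smul_pow, mul_smul_comm, map_smul, smul_eq_mul]

theorem extTwoForm_add_wedge {N : ℕ} (w : Fin N → Fin N → ℝ) (ξ ζ : Fin N → ℝ) :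
    extTwoForm (fun i j ↦ w i j + (ξ i * ζ j - ξ j * ζ i)) = extTwoForm w + ι ℝ ξ * ι ℝ ζ := by
  rw [extTwoForm_add w fun i j ↦ ξ i * ζ j - ξ j * ζ i, ι_mul_ι_eq_extTwoForm]

theorem extTwoForm_add_wedge_pow {N : ℕ} (w : Fin N → Fin N → ℝ) (ξ ζ : Fin N → ℝ) (k : ℕ) :
    extTwoForm (fun i j ↦ w i j + (ξ i * ζ j - ξ j * ζ i)) ^ (k + 1) =
      extTwoForm w ^ (k + 1) + (k + 1 : ℕ) • (ι ℝ ξ * ι ℝ ζ * extTwoForm w ^ k) := by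
  rw [extTwoForm_add_wedge, add_pow_of_sq_eq_zero (ι_mul_ι_mul_self ξ ζ) (commute_extTwoForm _ _)]

/-- Every new term contains `a` twice. This removes dh ∧ a from the contact volume of h a. -/
theorem wedgeOnePow_add_wedge_self (k : ℕ) (a ξ : V → ℝ) (w : V → V → ℝ)
    (v : Fin (2 * k + 1) → V) :
    wedgeOnePow k a (fun x y ↦ w x y + (ξ x * a y - ξ y * a x)) v = wedgeOnePow k a w v := by
  cases k with
  | zero => rw [wedgeOnePow, wedgeOnePow]; simp
  | succ k =>
    simp only [wedgeOnePow_eq_topCoeff]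
    rw [extTwoForm_add_wedge_pow _ (fun i ↦ ξ (v i)) (fun i ↦ a (v i)),
      mul_add (ι ℝ fun i ↦ a (v i)), map_add, mul_smul_comm, ← mul_assoc, (commute_ι_mul_ι _ _ _).symm.eq, mul_assoc (ι ℝ _), ι_sq_zero,
      mul_zero, zero_mul, smul_zero, map_zero, add_zero]

/-- ξ ∧ ζ has square zero, so the binomial expansion stops after the term linear in t. A large
factor t therefore enters the estimates only to first order. -/
theorem wedgeOnePow_affine (k : ℕ) (a ξ ζ : V → ℝ) (w : V → V → ℝ)
    (v : Fin (2 * k + 1) → V) (t : ℝ) :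
    wedgeOnePow k a (fun x y ↦ w x y + t * (ξ x * ζ y - ξ y * ζ x)) v = wedgeOnePow k a w v +
      t * (wedgeOnePow k a (fun x y ↦ w x y + (ξ x * ζ y - ξ y * ζ x)) v - wedgeOnePow k a w v) := by
  cases k with
  | zero => simp [wedgeOnePow]
  | succ k =>
    have h : ∀ t : ℝ, (fun x y ↦ w x y + t * (ξ x * ζ y - ξ y * ζ x)) =
      fun x y ↦ w x y + ((fun x ↦ t * ξ x) x * ζ y - (fun x ↦ t * ξ x) y * ζ x) := by
      intro t
      ext x y
      ring
    rw [h]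
    simp only [wedgeOnePow_eq_topCoeff]
    rw [extTwoForm_add_wedge_pow _ (fun i ↦ ξ (v i)) (fun i ↦ ζ (v i)),
      extTwoForm_add_wedge_pow _ (fun i ↦ t * ξ (v i)) (fun i ↦ ζ (v i))]
    have : (fun i ↦ t * ξ (v i)) = t • fun i ↦ ξ (v i) := rfl
    rw [this, map_smul, smul_mul_assoc, smul_mul_assoc, mul_add (ι ℝ fun i ↦ a (v i)),
      mul_add (ι ℝ fun i ↦ a (v i)), map_add, map_add, smul_comm _ t, mul_smul_comm, map_smul, smul_eq_mul]
    ring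

/-- The projection that kills the first coordinate fixes the 2-form and has determinant zero. -/
theorem topCoeff_extTwoForm_pow_eq_zero {N : ℕ} (w : Fin (N + 1) → Fin (N + 1) → ℝ)
    (h₁ : ∀ j, w 0 j = 0) (h₂ : ∀ j, w j 0 = 0) (k : ℕ) :
    topCoeff (N + 1) (extTwoForm w ^ k) = 0 := by
  let A : Matrix (Fin (N + 1)) (Fin (N + 1)) ℝ := Matrix.diagonal (Fin.cons 0 fun _ ↦ 1)
  have hA : extTwoForm w = map A.mulVecLin (extTwoForm w) := by
    rw [map_extTwoForm]
    congr 1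
    ext i j
    simp only [A, Matrix.diagonal_apply, ite_mul, zero_mul, mul_ite, mul_zero,
      Finset.sum_ite_eq, Finset.mem_univ, if_true]
    cases i using Fin.cases <;> cases j using Fin.cases <;> simp [h₁, h₂]
  rw [hA, ← map_pow, topCoeff_map]
  simp [A, Matrix.det_diagonal, Fin.prod_univ_succ]

/-- Write w = w' + e⁰ ∧ w(u, ·) with w' free of e⁰. Then w' has no top power, and the term linear in
e⁰ ∧ w(u, ·) appears k + 1 times. -/
theorem wedgePow_cons (k : ℕ) (w : V → V → ℝ) (hw : ∀ x y, w x y = -w y x) (u : V)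
    (v : Fin (2 * k + 1) → V) :
    wedgePow (k + 1) w (Fin.cons u v : Fin (2 * k + 1 + 1) → V) =
      (k + 1) * wedgeOnePow k (w u) w v := by
  rw [wedgePow_eq_topCoeff, wedgeOnePow_eq_topCoeff]
  change topCoeff (2 * k + 1 + 1) (extTwoForm (N := 2 * k + 1 + 1) (fun i j ↦
    w ((Fin.cons u v : Fin (2 * k + 1 + 1) → V) i) ((Fin.cons u v : Fin (2 * k + 1 + 1) → V) j)) ^
      (k + 1)) = _
  set F : Fin (2 * k + 1 + 1) → V := Fin.cons u v
  let ξ : Fin (2 * k + 1 + 1) → ℝ := Pi.single 0 1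
  let ζ : Fin (2 * k + 1 + 1) → ℝ := fun j ↦ w u (F j)
  let w' : Fin (2 * k + 1 + 1) → Fin (2 * k + 1 + 1) → ℝ := fun i j ↦
    w (F i) (F j) - (ξ i * ζ j - ξ j * ζ i)
  have h0 : ∀ x, w x x = 0 := fun x ↦ by linarith [hw x x]
  have hdec : (fun i j ↦ w (F i) (F j)) = fun i j ↦ w' i j + (ξ i * ζ j - ξ j * ζ i) := by
    ext i j
    simp [w']
  have h1 : ∀ j, w' 0 j = 0 := by
    intro j
    cases j using Fin.cases <;> simp [w', ξ, ζ, F, h0]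
  have h2 : ∀ j, w' j 0 = 0 := by
    intro j
    cases j using Fin.cases
    · simp [w', ξ, ζ, F, h0]
    · simp only [w', ξ, ζ, F, Fin.cons_succ, Fin.cons_zero, Pi.single_apply, h0]
      simp [hw (v _) u]
  rw [hdec, extTwoForm_add_wedge_pow, map_add, topCoeff_extTwoForm_pow_eq_zero w' h1 h2, zero_add,
    map_nsmul, mul_assoc]
  have h3 := topCoeff_extGen_zero_mul (ι ℝ ζ * extTwoForm w' ^ k)
  rw [extGen] at h3
  rw [h3, map_mul, map_pow, map_dropFirst_extTwoForm, map_apply_ι]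
  have h4 : (fun i j : Fin (2 * k + 1) ↦ w' i.succ j.succ) = fun i j ↦ w (v i) (v j) := by
    ext i j
    simp [w', ξ, F]
  have h5 : dropFirst (2 * k + 1) ζ = fun i ↦ w u (v i) := by
    ext i
    simp [dropFirst, LinearMap.funLeft, ζ, F]
  rw [h4, h5]
  simp

/-- With p = dx and q = dy, the summand p ∧ q can be used only once. It absorbs e₀ and e₁ and leaves
a ∧ w^k on the remaining vectors. -/
theorem wedgeOnePow_cons_cons (k : ℕ) (a p q : V → ℝ) (w : V → V → ℝ) (e₀ e₁ : V)
    (v : Fin (2 * k + 1) → V) (hp0 : p e₀ = 1) (hp1 : p e₁ = 0) (hp : ∀ i, p (v i) = 0)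
    (hq1 : q e₁ = 1) (hq : ∀ i, q (v i) = 0) (g : ℝ) :
    wedgeOnePow (k + 1) a (fun x y ↦ w x y + g * (p x * q y - p y * q x))
      (Fin.cons e₀ (Fin.cons e₁ v : Fin (2 * k + 1 + 1) → V) : Fin (2 * k + 1 + 1 + 1) → V) =
    wedgeOnePow (k + 1) a w
      (Fin.cons e₀ (Fin.cons e₁ v : Fin (2 * k + 1 + 1) → V) : Fin (2 * k + 1 + 1 + 1) → V) +
      (k + 1) * g * wedgeOnePow k a w v := by
  let F : Fin (2 * k + 1 + 1 + 1) → V :=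
    Fin.cons e₀ (Fin.cons e₁ v : Fin (2 * k + 1 + 1) → V)
  have hpF : (fun i ↦ p (F i)) = Pi.single 0 1 := by
    ext i
    cases i using Fin.cases with
    | zero => simp [F, hp0]
    | succ i => cases i using Fin.cases <;> simp [F, hp1, hp]
  have hqF : dropFirst (2 * k + 1 + 1) (fun i ↦ q (F i)) = Pi.single 0 1 := by
    ext i
    cases i using Fin.cases with
    | zero => simp [F, hq1, dropFirst, LinearMap.funLeft]
    | succ i => simp [F, hq, dropFirst, LinearMap.funLeft]
  have haF : dropFirst (2 * k + 1) (dropFirst (2 * k + 1 + 1) fun i ↦ a (F i)) =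
      fun i ↦ a (v i) := by
    ext i
    simp [F, dropFirst, LinearMap.funLeft]
  have h : (fun x y ↦ w x y + g * (p x * q y - p y * q x)) =
      fun x y ↦ w x y + ((fun x ↦ g * p x) x * q y - (fun x ↦ g * p x) y * q x) := by
    ext x y
    ring
  rw [h, wedgeOnePow_eq_topCoeff, wedgeOnePow_eq_topCoeff, wedgeOnePow_eq_topCoeff]
  change topCoeff (2 * k + 1 + 1 + 1) (ι ℝ (fun i ↦ a (F i)) * extTwoForm (N := 2 * k + 1 + 1 + 1)
      (fun i j ↦ w (F i) (F j) + ((g * p (F i)) * q (F j) - (g * p (F j)) * q (F i))) ^ (k + 1)) =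
    topCoeff (2 * k + 1 + 1 + 1) (ι ℝ (fun i ↦ a (F i)) * extTwoForm (N := 2 * k + 1 + 1 + 1)
      (fun i j ↦ w (F i) (F j)) ^ (k + 1)) + _
  rw [extTwoForm_add_wedge_pow _ (fun i ↦ g * p (F i)) (fun i ↦ q (F i)),
    mul_add (ι ℝ fun i ↦ a (F i)), map_add]
  congr 1
  have hg : (fun i ↦ g * p (F i)) = g • Pi.single 0 1 := by
    rw [← hpF]
    rfl
  have h3 := topCoeff_extGen_zero_mul (ι ℝ (fun i ↦ q (F i)) *
    (ι ℝ (fun i ↦ a (F i)) * extTwoForm (N := 2 * k + 1 + 1 + 1) (fun i j ↦ w (F i) (F j)) ^ k))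
  have h4 := topCoeff_extGen_zero_mul (ι ℝ (dropFirst (2 * k + 1 + 1) fun i ↦ a (F i)) *
    extTwoForm (N := 2 * k + 1 + 1) (fun i j ↦ w (F i.succ) (F j.succ)) ^ k)
  rw [map_mul (map (dropFirst _)), map_mul (map (dropFirst _)), map_pow, map_dropFirst_extTwoForm,
    map_apply_ι, map_apply_ι, hqF] at h3
  rw [map_mul (map (dropFirst _)), map_pow, map_dropFirst_extTwoForm, map_apply_ι, haF] at h4
  rw [extGen] at h3 h4
  rw [h4] at h3
  rw [mul_smul_comm, map_nsmul, hg, map_smul, smul_mul_assoc, smul_mul_assoc, mul_smul_comm,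
    map_smul, ← mul_assoc, (commute_ι_mul_ι _ _ _).symm.eq, mul_assoc, mul_assoc, h3]
  simp [F]
  ring

theorem wedgeOnePow_frame_change (k : ℕ) (a : V → ℝ) (w : V → V → ℝ)
    (u v : Fin (2 * k + 1) → V) (A : Matrix (Fin (2 * k + 1)) (Fin (2 * k + 1)) ℝ)
    (ha : ∀ i, a (v i) = ∑ j, A i j * a (u j))
    (hw : ∀ i j, w (v i) (v j) = ∑ l, ∑ n, A i l * A j n * w (u l) (u n)) :
    wedgeOnePow k a w v = A.det * wedgeOnePow k a w u := by
  rw [wedgeOnePow_eq_topCoeff, wedgeOnePow_eq_topCoeff, ← topCoeff_map,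
    map_mul (map A.mulVecLin), map_pow, map_apply_ι, map_extTwoForm]
  simp only [hw]
  congr 3
  ext i
  simp [Matrix.mulVec, dotProduct, ha]

theorem wedgePow_frame_change (k : ℕ) (w : V → V → ℝ)
    (u v : Fin (2 * k) → V) (A : Matrix (Fin (2 * k)) (Fin (2 * k)) ℝ)
    (hw : ∀ i j, w (v i) (v j) = ∑ l, ∑ n, A i l * A j n * w (u l) (u n)) :
    wedgePow k w v = A.det * wedgePow k w u := by
  rw [wedgePow_eq_topCoeff, wedgePow_eq_topCoeff, ← topCoeff_map, map_pow (map A.mulVecLin),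
    map_extTwoForm]
  simp only [hw]

theorem wedgeOnePow_dual_cons (k : ℕ) (p : V → ℝ) (w : V → V → ℝ) (e : V)
    (v : Fin (2 * k + 1 + 1) → V) (hp0 : p e = 1) (hp : ∀ i, p (v i) = 0) :
    wedgeOnePow (k + 1) p w (Fin.cons e v : Fin (2 * k + 1 + 1 + 1) → V) = wedgePow (k + 1) w v := by
  let F : Fin (2 * k + 1 + 1 + 1) → V := Fin.cons e v
  rw [wedgeOnePow_eq_topCoeff, wedgePow_eq_topCoeff]
  change topCoeff (2 * k + 1 + 1 + 1) (ι ℝ (fun i ↦ p (F i)) * extTwoForm (N := 2 * k + 1 + 1 + 1)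
    (fun i j ↦ w (F i) (F j)) ^ (k + 1)) = topCoeff (2 * k + 1 + 1) _
  have hpF : (fun i ↦ p (F i)) = Pi.single 0 1 := by
    ext i
    cases i using Fin.cases <;> simp [F, hp0, hp]
  have h := topCoeff_extGen_zero_mul (extTwoForm (N := 2 * k + 1 + 1 + 1)
    (fun i j ↦ w (F i) (F j)) ^ (k + 1))
  rw [map_pow, map_dropFirst_extTwoForm, extGen] at h
  rw [hpF, h]
  rfl

/-- The factor p absorbs e₀, which leaves the top power of w on (e₁, v), that is, a contraction with
e₁ by `wedgePow_cons`; for q the roles of e₀ and e₁ are exchanged, at the cost of a sign. Thus η ∧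
w^(k+1) is a contraction of w with the radial vector x e₀ + y e₁, and this brings the page volume
into the contact volume. -/
theorem wedgeOnePow_rotation (k : ℕ) (p q : V → ℝ) (w : V → V → ℝ)
    (hw : ∀ x y, w x y = -w y x) (e₀ e₁ : V)
    (v : Fin (2 * k + 1) → V) (hp0 : p e₀ = 1) (hp1 : p e₁ = 0) (hp : ∀ i, p (v i) = 0)
    (hq0 : q e₀ = 0) (hq1 : q e₁ = 1) (hq : ∀ i, q (v i) = 0) (x y : ℝ) :
    wedgeOnePow (k + 1) (fun u ↦ x * q u - y * p u) w
      (Fin.cons e₀ (Fin.cons e₁ v : Fin (2 * k + 1 + 1) → V) : Fin (2 * k + 1 + 1 + 1) → V) =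
    -((k + 1) * wedgeOnePow k (fun u ↦ x * w e₀ u + y * w e₁ u) w v) := by
  have h1 : (fun u ↦ x * q u - y * p u) = fun u ↦ x * q u + (-y) * p u := by
    ext u
    ring
  rw [h1, wedgeOnePow_linear_left, wedgeOnePow_linear_left]
  have hc : ∀ (P : V → ℝ) (e : V), P e = 0 → (∀ i, P (v i) = 0) →
      ∀ i, P ((Fin.cons e v : Fin (2 * k + 1 + 1) → V) i) = 0 := by
    intro P e h0 h i
    cases i using Fin.cases <;> simp [h0, h]
  have hp' := wedgeOnePow_dual_cons k p w e₀ (Fin.cons e₁ v) hp0 (hc p e₁ hp1 hp)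
  have hq' := wedgeOnePow_dual_cons k q w e₁ (Fin.cons e₀ v) hq1 (hc q e₀ hq0 hq)
  rw [wedgePow_cons k w hw] at hp' hq'
  let σ : Equiv.Perm (Fin (2 * k + 1 + 1 + 1)) := Equiv.swap 0 1
  let F : Fin (2 * k + 1 + 1 + 1) → V :=
    Fin.cons e₀ (Fin.cons e₁ v : Fin (2 * k + 1 + 1) → V)
  let F' : Fin (2 * k + 1 + 1 + 1) → V :=
    Fin.cons e₁ (Fin.cons e₀ v : Fin (2 * k + 1 + 1) → V)
  have hF : ∀ i, F' i = F (σ i) := by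
    intro i
    cases i using Fin.cases with
    | zero =>
      change e₁ = F (Equiv.swap 0 1 0)
      rw [Equiv.swap_apply_left]
      rfl
    | succ i =>
      cases i using Fin.cases with
      | zero => simp [F, F', σ]
      | succ i =>
        have : σ i.succ.succ = i.succ.succ :=
          Equiv.swap_apply_of_ne_of_ne (Fin.succ_ne_zero _) (by
            rw [← Fin.succ_zero_eq_one]
            exact fun h ↦ Fin.succ_ne_zero _ (Fin.succ_injective _ h))
        rw [this]
        simp [F, F']
  -- The exchange of the first two vectors is a change of frame by a permutation matrix, of
  -- determinant -1.
  have hswap := wedgeOnePow_frame_change (k + 1) q w F F' (σ.toPEquiv.toMatrix)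
    (fun i ↦ by rw [hF]; simp [PEquiv.toMatrix_apply])
    (fun i j ↦ by rw [hF, hF]; simp [PEquiv.toMatrix_apply])
  rw [Matrix.det_permutation] at hswap
  have hsign : ((Equiv.Perm.sign σ : ℤ) : ℝ) = -1 := by
    rw [Equiv.Perm.sign_swap (by simp)]
    simp
  have e1 : wedgeOnePow (k + 1) q w F = -wedgeOnePow (k + 1) q w F' := by
    rw [hswap, hsign]
    ring
  change x * wedgeOnePow (k + 1) q w F + _ = _
  rw [e1]
  change x * -wedgeOnePow (k + 1) q w (Fin.cons e₁ (Fin.cons e₀ v : Fin (2 * k + 1 + 1) → V) :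
    Fin (2 * k + 1 + 1 + 1) → V) + _ = _
  rw [hq', hp']
  ring

end WedgeFormulas

/-! ### Cut-off profiles for the coefficients, as functions of q = r². -/

section Profiles

/-- A smooth function which is `1` on `(-∞, 1]` and `0` on `[2, ∞)`. -/
def stepDown (x : ℝ) : ℝ := Real.smoothTransition (2 - x)

theorem contDiff_stepDown : ContDiff ℝ ∞ stepDown :=
  Real.smoothTransition.contDiff.comp (contDiff_const.sub contDiff_id)

theorem differentiable_stepDown : Differentiable ℝ stepDown :=
  contDiff_stepDown.differentiable (by norm_num)

theorem stepDown_nonneg (x : ℝ) : 0 ≤ stepDown x := Real.smoothTransition.nonneg _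

theorem stepDown_le_one (x : ℝ) : stepDown x ≤ 1 := Real.smoothTransition.le_one _

theorem stepDown_eq_one {x : ℝ} (hx : x ≤ 1) : stepDown x = 1 :=
  Real.smoothTransition.one_of_one_le (by linarith)

theorem stepDown_eq_zero {x : ℝ} (hx : 2 ≤ x) : stepDown x = 0 :=
  Real.smoothTransition.zero_of_nonpos (by linarith)

theorem deriv_stepDown_nonpos (x : ℝ) : deriv stepDown x ≤ 0 := by
  have : Antitone stepDown := fun x y h ↦ Real.smoothTransition.monotone (by linarith)
  exact this.deriv_nonpos

/-- The value 1 is a global maximum, which settles the endpoint x = 1 as well. -/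
theorem deriv_stepDown_of_le {x : ℝ} (hx : x ≤ 1) : deriv stepDown x = 0 :=
  IsLocalMax.deriv_eq_zero (Filter.Eventually.of_forall fun y ↦ by
    rw [stepDown_eq_one hx]
    exact stepDown_le_one y)

theorem deriv_stepDown_of_ge {x : ℝ} (hx : 2 ≤ x) : deriv stepDown x = 0 :=
  IsLocalMin.deriv_eq_zero (Filter.Eventually.of_forall fun y ↦ by
    rw [stepDown_eq_zero hx]
    exact stepDown_nonneg y)

theorem exists_deriv_stepDown_bound : ∃ C : ℝ, 0 < C ∧ ∀ x, |deriv stepDown x| ≤ C := by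
  have hcont : Continuous (deriv stepDown) := contDiff_stepDown.continuous_deriv (by norm_num)
  obtain ⟨C, hC⟩ := (isCompact_Icc (a := (1 : ℝ)) (b := 2)).exists_bound_of_continuousOn
    hcont.continuousOn
  refine ⟨|C| + 1, by positivity, fun x ↦ ?_⟩
  rcases le_total x 1 with h | h
  · rw [deriv_stepDown_of_le h, abs_zero]
    positivity
  · rcases le_total x 2 with h' | h'
    · exact (hC x ⟨h, h'⟩).trans (by linarith [le_abs_self C])
    · rw [deriv_stepDown_of_ge h', abs_zero]
      positivity

theorem hasDerivAt_stepDown_div (a x : ℝ) :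
    HasDerivAt (fun x ↦ stepDown (a * x)) (a * deriv stepDown (a * x)) x := by
  have := (differentiable_stepDown (a * x)).hasDerivAt.comp x ((hasDerivAt_id x).const_mul a)
  simpa [mul_comm, Function.comp_def] using this

/-- A decreasing function with slope `-1` on `(-∞, q₀]` that vanishes on `[2 q₀, ∞)`. -/
def dropProfile (q₀ q : ℝ) : ℝ := (2 * q₀ - q) * stepDown (q₀⁻¹ * q)

theorem contDiff_dropProfile (q₀ : ℝ) : ContDiff ℝ ∞ (dropProfile q₀) :=
  (contDiff_const.sub contDiff_id).mul (contDiff_stepDown.comp (contDiff_const.mul contDiff_id))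

theorem deriv_dropProfile (q₀ q : ℝ) : deriv (dropProfile q₀) q =
    -stepDown (q₀⁻¹ * q) + (2 * q₀ - q) * (q₀⁻¹ * deriv stepDown (q₀⁻¹ * q)) := by
  have := ((hasDerivAt_id q).const_sub (2 * q₀)).mul (hasDerivAt_stepDown_div q₀⁻¹ q)
  have h := this.deriv
  simp only [id, neg_mul, one_mul] at h
  exact h

theorem dropProfile_of_le {q₀ q : ℝ} (h0 : 0 < q₀) (h : q ≤ q₀) : dropProfile q₀ q = 2 * q₀ - q := by
  rw [dropProfile, stepDown_eq_one, mul_one]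
  rw [inv_mul_le_iff₀ h0]
  linarith

theorem deriv_dropProfile_of_le {q₀ q : ℝ} (h0 : 0 < q₀) (h : q ≤ q₀) :
    deriv (dropProfile q₀) q = -1 := by
  have : q₀⁻¹ * q ≤ 1 := by
    rw [inv_mul_le_iff₀ h0]
    linarith
  rw [deriv_dropProfile, stepDown_eq_one this, deriv_stepDown_of_le this]
  ring

theorem dropProfile_of_ge {q₀ q : ℝ} (h0 : 0 < q₀) (h : 2 * q₀ ≤ q) : dropProfile q₀ q = 0 := by
  rw [dropProfile, stepDown_eq_zero, mul_zero]
  rw [le_inv_mul_iff₀ h0]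
  linarith

theorem deriv_dropProfile_of_ge {q₀ q : ℝ} (h0 : 0 < q₀) (h : 2 * q₀ ≤ q) :
    deriv (dropProfile q₀) q = 0 := by
  have : 2 ≤ q₀⁻¹ * q := by
    rw [le_inv_mul_iff₀ h0]
    linarith
  rw [deriv_dropProfile, stepDown_eq_zero this, deriv_stepDown_of_ge this]
  ring

theorem deriv_dropProfile_nonpos {q₀ : ℝ} (h0 : 0 < q₀) (q : ℝ) : deriv (dropProfile q₀) q ≤ 0 := by
  rcases le_total (2 * q₀) q with h | h
  · rw [deriv_dropProfile_of_ge h0 h]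
  · rw [deriv_dropProfile]
    have h1 := mul_nonpos_of_nonneg_of_nonpos (sub_nonneg.2 h)
      (mul_nonpos_of_nonneg_of_nonpos (inv_pos.2 h0).le (deriv_stepDown_nonpos (q₀⁻¹ * q)))
    linarith [stepDown_nonneg (q₀⁻¹ * q)]

theorem dropProfile_nonneg {q₀ : ℝ} (h0 : 0 < q₀) (q : ℝ) : 0 ≤ dropProfile q₀ q := by
  rcases le_total (2 * q₀) q with h | h
  · rw [dropProfile_of_ge h0 h]
  · exact mul_nonneg (sub_nonneg.2 h) (stepDown_nonneg _)

theorem dropProfile_le {q₀ q : ℝ} (h0 : 0 < q₀) (hq : 0 ≤ q) : dropProfile q₀ q ≤ 2 * q₀ := by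
  rcases le_total (2 * q₀) q with h | h
  · rw [dropProfile_of_ge h0 h]
    linarith
  · calc (2 * q₀ - q) * stepDown (q₀⁻¹ * q) ≤ (2 * q₀ - q) * 1 :=
        mul_le_mul_of_nonneg_left (stepDown_le_one _) (sub_nonneg.2 h)
      _ ≤ 2 * q₀ := by linarith

/-- A positive function which is `2 q₀` for `q ≤ q₀` and `q` for `q ≥ 2 q₀`. -/
def floorProfile (q₀ q : ℝ) : ℝ :=
  2 * q₀ * stepDown (q₀⁻¹ * q) + q * (1 - stepDown (q₀⁻¹ * q))

theorem contDiff_floorProfile (q₀ : ℝ) : ContDiff ℝ ∞ (floorProfile q₀) := by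
  have : ContDiff ℝ ∞ fun q ↦ stepDown (q₀⁻¹ * q) :=
    contDiff_stepDown.comp (contDiff_const.mul contDiff_id)
  exact (contDiff_const.mul this).add (contDiff_id.mul (contDiff_const.sub this))

theorem floorProfile_pos_and_ge {q₀ : ℝ} (h0 : 0 < q₀) (q : ℝ) :
    0 < floorProfile q₀ q ∧ q ≤ floorProfile q₀ q := by
  rcases le_total (2 * q₀) q with h | h
  · have : 2 ≤ q₀⁻¹ * q := by
      rw [le_inv_mul_iff₀ h0]
      linarith
    rw [floorProfile, stepDown_eq_zero this]
    constructor <;> linarith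
  · have h1 := mul_nonneg (sub_nonneg.2 h) (stepDown_nonneg (q₀⁻¹ * q))
    have h2 : q ≤ floorProfile q₀ q := by
      rw [floorProfile]
      linarith
    refine ⟨?_, h2⟩
    rcases lt_or_ge 0 q with hq | hq
    · exact hq.trans_le h2
    · have : q₀⁻¹ * q ≤ 1 := (mul_nonpos_of_nonneg_of_nonpos (inv_pos.2 h0).le hq).trans zero_le_one
      rw [floorProfile, stepDown_eq_one this]
      linarith

/-- For M = `floorProfile q₀` this says that q/M is nondecreasing. With σ = stepDown(q/q₀) and σ'
the derivative of `stepDown` there, the expression equals 2q₀σ - (q/q₀)σ'(2q₀ - q), and σ' vanishes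
for q ≥ 2q₀. -/
theorem sub_mul_deriv_floorProfile_nonneg {q₀ q : ℝ} (h0 : 0 < q₀) (hq : 0 ≤ q) :
    0 ≤ floorProfile q₀ q - q * deriv (floorProfile q₀) q := by
  have hS := hasDerivAt_stepDown_div q₀⁻¹ q
  have h1 : HasDerivAt (floorProfile q₀) (2 * q₀ * (q₀⁻¹ * deriv stepDown (q₀⁻¹ * q)) +
      (1 * (1 - stepDown (q₀⁻¹ * q)) + q * (-(q₀⁻¹ * deriv stepDown (q₀⁻¹ * q))))) q :=
    (hS.const_mul (2 * q₀)).add ((hasDerivAt_id q).mul (hS.const_sub 1))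
  rw [h1.deriv, floorProfile]
  have h2 : 0 ≤ (q₀⁻¹ * q) * (-deriv stepDown (q₀⁻¹ * q) * (2 * q₀ - q)) := by
    refine mul_nonneg (by positivity) ?_
    rcases le_total (2 * q₀) q with h | h
    · have : 2 ≤ q₀⁻¹ * q := by
        rw [le_inv_mul_iff₀ h0]
        linarith
      rw [deriv_stepDown_of_ge this]
      simp
    · exact mul_nonneg (neg_nonneg.2 (deriv_stepDown_nonpos _)) (sub_nonneg.2 h)
  have h3 := mul_nonneg h0.le (stepDown_nonneg (q₀⁻¹ * q))
  nlinarith [h2, h3]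

/-- A function which is `1` near `0` and `0` for `q ≥ Q`, such that the derivative of
`q * twistProfile q₀ Q q` is bounded below by `-O(q₀ / Q)`. -/
def twistProfile (q₀ Q q : ℝ) : ℝ := 2 * q₀ * stepDown (2 * Q⁻¹ * q) / floorProfile q₀ q

theorem contDiff_twistProfile {q₀ : ℝ} (h0 : 0 < q₀) (Q : ℝ) : ContDiff ℝ ∞ (twistProfile q₀ Q) :=
  (contDiff_const.mul (contDiff_stepDown.comp (contDiff_const.mul contDiff_id))).div
    (contDiff_floorProfile q₀) fun q ↦ (floorProfile_pos_and_ge h0 q).1.ne'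

theorem twistProfile_nonneg {q₀ : ℝ} (h0 : 0 < q₀) (Q q : ℝ) : 0 ≤ twistProfile q₀ Q q :=
  div_nonneg (mul_nonneg (by linarith) (stepDown_nonneg _)) (floorProfile_pos_and_ge h0 q).1.le

theorem twistProfile_of_le {q₀ Q q : ℝ} (h0 : 0 < q₀) (hQ : 2 * q₀ ≤ Q) (h : q ≤ q₀) :
    twistProfile q₀ Q q = 1 := by
  have h1 : q₀⁻¹ * q ≤ 1 := by
    rw [inv_mul_le_iff₀ h0]
    linarith
  have h2 : 2 * Q⁻¹ * q ≤ 1 := by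
    rw [mul_comm 2, mul_assoc, inv_mul_le_iff₀ (by linarith)]
    linarith
  rw [twistProfile, floorProfile, stepDown_eq_one h1, stepDown_eq_one h2, sub_self, mul_zero,
    add_zero, div_self]
  linarith

theorem twistProfile_of_ge {q₀ Q q : ℝ} (hQ : 0 < Q) (h : Q ≤ q) : twistProfile q₀ Q q = 0 := by
  have h2 : 2 ≤ 2 * Q⁻¹ * q := by
    rw [mul_comm 2, mul_assoc, le_inv_mul_iff₀ hQ]
    linarith
  rw [twistProfile, stepDown_eq_zero h2]
  simp

theorem hasDerivAt_twistProfile {q₀ : ℝ} (h0 : 0 < q₀) (Q q : ℝ) :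
    HasDerivAt (twistProfile q₀ Q) ((2 * q₀ * (2 * Q⁻¹ * deriv stepDown (2 * Q⁻¹ * q)) *
      floorProfile q₀ q - 2 * q₀ * stepDown (2 * Q⁻¹ * q) * deriv (floorProfile q₀) q) /
      floorProfile q₀ q ^ 2) q :=
  ((hasDerivAt_stepDown_div (2 * Q⁻¹) q).const_mul (2 * q₀)).div
    ((contDiff_floorProfile q₀).differentiable (by norm_num) q).hasDerivAt
    (floorProfile_pos_and_ge h0 q).1.ne'

theorem deriv_twistProfile_of_ge {q₀ Q q : ℝ} (h0 : 0 < q₀) (hQ : 0 < Q) (h : Q ≤ q) :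
    deriv (twistProfile q₀ Q) q = 0 :=
  IsLocalMin.deriv_eq_zero (Filter.Eventually.of_forall fun y ↦ by
    rw [twistProfile_of_ge hQ h]
    exact twistProfile_nonneg h0 Q y)

theorem deriv_twistProfile_of_le {q₀ Q q : ℝ} (h0 : 0 < q₀) (hQ : 2 * q₀ ≤ Q) (h : q < q₀) :
    deriv (twistProfile q₀ Q) q = 0 := by
  have : twistProfile q₀ Q =ᶠ[𝓝 q] fun _ ↦ 1 := by
    filter_upwards [Iio_mem_nhds h] with y hy
    exact twistProfile_of_le h0 hQ (le_of_lt hy)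
  rw [this.deriv_eq, deriv_const]

/-- The right side is the derivative of q · `twistProfile` = 2q₀ · stepDown(2q/Q) · (q/M). Since q/M
is nondecreasing and at most 1, only the outer cut-off can lower the product, with slope at most 2q₀
· 2C/Q. -/
theorem twistProfile_add_mul_deriv_ge {q₀ Q q C : ℝ} (h0 : 0 < q₀) (hQ : 0 < Q) (hq : 0 ≤ q)
    (hC : ∀ x, |deriv stepDown x| ≤ C) :
    -(4 * q₀ * C / Q) ≤ twistProfile q₀ Q q + q * deriv (twistProfile q₀ Q) q := by
  obtain ⟨hM, hqM⟩ := floorProfile_pos_and_ge h0 q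
  have h1 := sub_mul_deriv_floorProfile_nonneg h0 hq
  have hS := stepDown_nonneg (2 * Q⁻¹ * q)
  have hS' := (abs_le.1 (hC (2 * Q⁻¹ * q))).1
  have hS'' := deriv_stepDown_nonpos (2 * Q⁻¹ * q)
  rw [(hasDerivAt_twistProfile h0 Q q).deriv, twistProfile]
  set M := floorProfile q₀ q
  set M' := deriv (floorProfile q₀) q
  set σ := stepDown (2 * Q⁻¹ * q)
  set σ' := deriv stepDown (2 * Q⁻¹ * q)
  have e : 2 * q₀ * σ / M + q * ((2 * q₀ * (2 * Q⁻¹ * σ') * M - 2 * q₀ * σ * M') / M ^ 2) =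
      2 * q₀ * σ * (M - q * M') / M ^ 2 + 4 * q₀ / Q * (σ' * (q / M)) := by
    field_simp
    ring
  rw [e]
  have h2 : 0 ≤ 2 * q₀ * σ * (M - q * M') / M ^ 2 := by positivity
  have h3 : q / M ≤ 1 := (div_le_one hM).2 hqM
  have h4 : -C ≤ σ' * (q / M) := by
    have : 0 ≤ q / M := by positivity
    nlinarith
  have h5 : 4 * q₀ / Q * -C ≤ 4 * q₀ / Q * (σ' * (q / M)) :=
    mul_le_mul_of_nonneg_left h4 (by positivity)
  have h6 : -(4 * q₀ * C / Q) = 4 * q₀ / Q * -C := by ring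
  linarith

end Profiles

/-! ### Change of frame, nondegeneracy, and Lipschitz bounds. -/

section Frames

theorem wedgeOnePow_update_eq_mul {V : Type*} [AddCommGroup V] [Module ℝ V] {k : ℕ} {a : V → ℝ}
    {w : V → V → ℝ} (ha : IsLinearMap ℝ a) (hw₁ : ∀ y, IsLinearMap ℝ fun x ↦ w x y)
    (hw₂ : ∀ x, IsLinearMap ℝ (w x)) {u v : Fin (2 * k + 1) → V}
    (A : Matrix (Fin (2 * k + 1)) (Fin (2 * k + 1)) ℝ) (hv : ∀ i, v i = ∑ j, A i j • u j) :
    wedgeOnePow k a w v = A.det * wedgeOnePow k a w u := by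
  have h : ∀ {φ : V → ℝ}, IsLinearMap ℝ φ → ∀ i, φ (v i) = ∑ j, A i j * φ (u j) := by
    intro φ hφ i
    rw [hv]
    have := map_sum hφ.mk' (fun j ↦ A i j • u j) Finset.univ
    simp only [IsLinearMap.mk'_apply, hφ.map_smul, smul_eq_mul] at this
    exact this
  refine wedgeOnePow_frame_change k a w u v A (h ha) fun i j ↦ ?_
  rw [h (hw₁ (v j)) i]
  refine Finset.sum_congr rfl fun l _ ↦ ?_
  rw [h (hw₂ (u l)) j, Finset.mul_sum]
  refine Finset.sum_congr rfl fun n _ ↦ ?_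
  ring

theorem wedgePow_update_eq_mul {V : Type*} [AddCommGroup V] [Module ℝ V] {k : ℕ}
    {w : V → V → ℝ} (hw₁ : ∀ y, IsLinearMap ℝ fun x ↦ w x y)
    (hw₂ : ∀ x, IsLinearMap ℝ (w x)) {u v : Fin (2 * k) → V}
    (A : Matrix (Fin (2 * k)) (Fin (2 * k)) ℝ) (hv : ∀ i, v i = ∑ j, A i j • u j) :
    wedgePow k w v = A.det * wedgePow k w u := by
  have h : ∀ {φ : V → ℝ}, IsLinearMap ℝ φ → ∀ i, φ (v i) = ∑ j, A i j * φ (u j) := by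
    intro φ hφ i
    rw [hv]
    have := map_sum hφ.mk' (fun j ↦ A i j • u j) Finset.univ
    simp only [IsLinearMap.mk'_apply, hφ.map_smul, smul_eq_mul] at this
    exact this
  refine wedgePow_frame_change k w u v A fun i j ↦ ?_
  rw [h (hw₁ (v j)) i]
  refine Finset.sum_congr rfl fun l _ ↦ ?_
  rw [h (hw₂ (u l)) j, Finset.mul_sum]
  refine Finset.sum_congr rfl fun n _ ↦ ?_
  ring

theorem det_updateRow_one {N : ℕ} (j : Fin N) (g : Fin N → ℝ) :
    (Matrix.updateRow (1 : Matrix (Fin N) (Fin N) ℝ) j g).det = g j := by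
  have : g = ∑ i, g i • (1 : Matrix (Fin N) (Fin N) ℝ) i := by
    ext l
    simp [Matrix.one_apply]
  rw [this, Matrix.det_updateRow_sum]
  simp [Matrix.one_apply]

theorem sum_updateRow_one_smul {V : Type*} [AddCommGroup V] [Module ℝ V] {N : ℕ} (j : Fin N)
    (g : Fin N → ℝ) (u : Fin N → V) (i : Fin N) :
    ∑ l, Matrix.updateRow (1 : Matrix (Fin N) (Fin N) ℝ) j g i l • u l =
      Function.update u j (∑ l, g l • u l) i := by
  by_cases h : i = j
  · subst h
    simp
  · simp [Matrix.updateRow_ne h, Function.update_of_ne h, Matrix.one_apply]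

/-- Replacing v_j by a linear relation ∑ g_i v_i = 0 multiplies the value by g_j, whereas a frame
containing the zero vector has value 0. -/
theorem linearIndependent_of_wedgeOnePow_ne_zero {V : Type*} [AddCommGroup V] [Module ℝ V] {k : ℕ}
    {a : V → ℝ} {w : V → V → ℝ} (ha : IsLinearMap ℝ a) (hw₁ : ∀ y, IsLinearMap ℝ fun x ↦ w x y)
    (hw₂ : ∀ x, IsLinearMap ℝ (w x)) {v : Fin (2 * k + 1) → V} (hv : wedgeOnePow k a w v ≠ 0) :
    LinearIndependent ℝ v := by
  by_contra hdep
  obtain ⟨g, hg, j, hj⟩ := Fintype.not_linearIndependent_iff.1 hdep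
  have h1 := wedgeOnePow_update_eq_mul ha hw₁ hw₂ (Matrix.updateRow 1 j g)
    (u := v) (v := Function.update v j 0) fun i ↦ by rw [sum_updateRow_one_smul, hg]
  -- A frame whose j-th vector is 0 is unchanged by the matrix whose j-th row is 0; that determinant
  -- is 0, so the value vanishes.
  have h2 := wedgeOnePow_update_eq_mul ha hw₁ hw₂ (Matrix.updateRow 1 j 0)
    (u := Function.update v j 0) (v := Function.update v j 0) fun i ↦ by
      rw [sum_updateRow_one_smul]
      simp
  rw [det_updateRow_one] at h1 h2
  rw [h2, Pi.zero_apply, zero_mul] at h1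
  exact (mul_ne_zero hj hv) h1.symm

/-- A vector in the kernel of w may be replaced by 0 inside the frame. Putting ∑ c_i v_i in place of
v_j thus gives 0, but also c_j times a nonzero number. -/
theorem eq_zero_of_wedgePow_ne_zero {V : Type*} [AddCommGroup V] [Module ℝ V] {k : ℕ}
    {w : V → V → ℝ} (hw₁ : ∀ y, IsLinearMap ℝ fun x ↦ w x y)
    (hw₂ : ∀ x, IsLinearMap ℝ (w x)) (hw : ∀ x y, w x y = -w y x) {v : Fin (2 * k) → V}
    (hv : wedgePow k w v ≠ 0) (c : Fin (2 * k) → ℝ)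
    (hx : ∀ y, w (∑ i, c i • v i) y = 0) : c = 0 := by
  by_contra hc
  obtain ⟨j, hj⟩ := Function.ne_iff.1 hc
  have h1 := wedgePow_update_eq_mul hw₁ hw₂ (Matrix.updateRow 1 j c)
    (u := v) (v := Function.update v j (∑ i, c i • v i)) fun i ↦ by rw [sum_updateRow_one_smul]
  rw [det_updateRow_one] at h1
  refine mul_ne_zero hj hv (h1.symm.trans ?_)
  have h2 : wedgePow k w (Function.update v j (∑ i, c i • v i)) =
      wedgePow k w (Function.update v j 0) := by
    have hx' : ∀ y, w y (∑ i, c i • v i) = 0 := fun y ↦ by rw [hw, hx, neg_zero]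
    refine wedgePow_congr fun i l ↦ ?_
    by_cases hi : i = j
    · subst hi
      simp [hx, (hw₁ _).map_zero]
    · by_cases hl : l = j
      · subst hl
        simp [hx', (hw₂ _).map_zero]
      · simp [Function.update_of_ne hi, Function.update_of_ne hl]
  have h3 := wedgePow_update_eq_mul hw₁ hw₂ (Matrix.updateRow 1 j 0)
    (u := Function.update v j 0) (v := Function.update v j 0) fun i ↦ by
      rw [sum_updateRow_one_smul]
      simp
  rw [det_updateRow_one, Pi.zero_apply, zero_mul] at h3
  rw [h2, h3]

theorem contDiff_wedgeOnePow (k : ℕ) : ContDiff ℝ 1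
    fun x : (Fin (2 * k + 1) → ℝ) × (Fin (2 * k + 1) → Fin (2 * k + 1) → ℝ) ↦
      wedgeOnePow k x.1 x.2 id := by
  unfold wedgeOnePow
  refine contDiff_const.mul (ContDiff.sum fun σ _ ↦ contDiff_const.mul (ContDiff.mul ?_
    (contDiff_prod fun i _ ↦ ?_)))
  · exact (contDiff_apply ℝ ℝ (id (σ 0))).comp contDiff_fst
  · exact (contDiff_apply_apply ℝ ℝ _ _).comp contDiff_snd

/-- On bounded sets, the value of `a ∧ w ∧ ⋯ ∧ w` is bounded and depends in a Lipschitz manner on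
the coefficients of `a` and `w`. -/
theorem exists_wedgeOnePow_lipschitz (k : ℕ) (C : ℝ) : ∃ L : ℝ, 0 < L ∧
    (∀ (a a' : Fin (2 * k + 1) → ℝ) (w w' : Fin (2 * k + 1) → Fin (2 * k + 1) → ℝ) (δ : ℝ), 0 ≤ δ →
      (∀ i, |a i| ≤ C) → (∀ i, |a' i| ≤ C) → (∀ i j, |w i j| ≤ C) → (∀ i j, |w' i j| ≤ C) →
      (∀ i, |a i - a' i| ≤ δ) → (∀ i j, |w i j - w' i j| ≤ δ) →
      |wedgeOnePow k a w id - wedgeOnePow k a' w' id| ≤ L * δ) ∧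
    (∀ (a : Fin (2 * k + 1) → ℝ) (w : Fin (2 * k + 1) → Fin (2 * k + 1) → ℝ),
      (∀ i, |a i| ≤ C) → (∀ i j, |w i j| ≤ C) → |wedgeOnePow k a w id| ≤ L) := by
  set s := Metric.closedBall
    (0 : (Fin (2 * k + 1) → ℝ) × (Fin (2 * k + 1) → Fin (2 * k + 1) → ℝ)) |C|
  have hs : IsCompact s := isCompact_closedBall _ _
  have mem : ∀ (a : Fin (2 * k + 1) → ℝ) (w : Fin (2 * k + 1) → Fin (2 * k + 1) → ℝ),
      (∀ i, |a i| ≤ C) → (∀ i j, |w i j| ≤ C) → (a, w) ∈ s := by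
    intro a w ha hw
    rw [mem_closedBall_zero_iff, Prod.norm_mk]
    refine max_le ((pi_norm_le_iff_of_nonneg (abs_nonneg C)).2 fun i ↦ (ha i).trans (le_abs_self C))
      ((pi_norm_le_iff_of_nonneg (abs_nonneg C)).2 fun i ↦
        (pi_norm_le_iff_of_nonneg (abs_nonneg C)).2 fun j ↦ (hw i j).trans (le_abs_self C))
  obtain ⟨K, hK⟩ := ((contDiff_wedgeOnePow k).locallyLipschitz.locallyLipschitzOn
    (s := s)).exists_lipschitzOnWith_of_compact hs
  obtain ⟨D, hD⟩ := hs.exists_bound_of_continuousOn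
    (contDiff_wedgeOnePow k).continuous.continuousOn
  refine ⟨max (K + 1) D, lt_max_of_lt_left (by positivity), ?_, ?_⟩
  · intro a a' w w' δ hδ ha ha' hw hw' h1 h2
    have h3 := hK.dist_le_mul _ (mem a w ha hw) _ (mem a' w' ha' hw')
    rw [Real.dist_eq] at h3
    refine h3.trans (mul_le_mul ((le_max_left _ _).trans' (by linarith)) ?_ dist_nonneg
      (le_max_of_le_left (by positivity)))
    rw [Prod.dist_eq]
    refine max_le ((dist_pi_le_iff hδ).2 h1) ((dist_pi_le_iff hδ).2 fun i ↦
      (dist_pi_le_iff hδ).2 (h2 i))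
  · intro a w ha hw
    exact (hD _ (mem a w ha hw)).trans (le_max_right _ _)

end Frames

/-! ### Frames of TB with bounds that are uniform over B. -/

section UniformFrames

variable (m : ℕ) {B : Type*} [TopologicalSpace B]
  [ChartedSpace (EuclideanSpace ℝ (Fin (2 * m + 1))) B]

local notation "𝔼" => EuclideanSpace ℝ (Fin (2 * m + 1))

/-- The frame `(∂_x, ∂_y, v₀, …)` of `B × ℂ`. -/
def tubeFrame (v : Fin (2 * m + 1) → 𝔼) : Fin (2 * (m + 1) + 1) → 𝔼 × ℂ :=
  Fin.cons ((0, 1) : 𝔼 × ℂ) (Fin.cons ((0, Complex.I) : 𝔼 × ℂ) fun i ↦ ((v i, 0) : 𝔼 × ℂ))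

theorem tubeFrame_comp (T : 𝔼 →L[ℝ] 𝔼) (v : Fin (2 * m + 1) → 𝔼) (i : Fin (2 * (m + 1) + 1)) :
    tubeFrame m (fun i ↦ T (v i)) i = (T (tubeFrame m v i).1, (tubeFrame m v i).2) := by
  refine Fin.cases ?_ (Fin.cases ?_ fun i ↦ ?_) i <;> simp [tubeFrame]

/-- The value `(dα)_p (u, v)` of the exterior derivative of a 1-form on `B × D²`. -/
def dTube (α : OneForm (bindingModel m) (B × ℂ)) (p : B × ℂ) (u v : 𝔼 × ℂ) : ℝ :=
  OneForm.dWithin (bindingModel m) α (solidTube B 1) p u v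

theorem dTube_skew (α : OneForm (bindingModel m) (B × ℂ)) (p : B × ℂ) (u v : 𝔼 × ℂ) :
    dTube m α p u v = -dTube m α p v u := by
  simp [dTube, OneForm.dWithin]

theorem isLinearMap_dTube_left (α : OneForm (bindingModel m) (B × ℂ)) (p : B × ℂ) (v : 𝔼 × ℂ) :
    IsLinearMap ℝ fun u : 𝔼 × ℂ ↦ dTube m α p u v := by
  obtain ⟨b, z⟩ := p
  constructor <;> intros <;> simp only [dTube, dWithin_eq, map_add, map_smul,
    add_apply, smul_apply, smul_eq_mul] <;> ring

theorem isLinearMap_dTube_right (α : OneForm (bindingModel m) (B × ℂ)) (p : B × ℂ) (u : 𝔼 × ℂ) :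
    IsLinearMap ℝ (dTube m α p u) := by
  obtain ⟨b, z⟩ := p
  constructor <;> intros <;> simp only [dTube, dWithin_eq, map_add, map_smul,
    add_apply, smul_apply, smul_eq_mul] <;> ring

/-- The value of `α_B ∧ (dα_B)^m` on a frame of `T_b B`. -/
def bindingVolume (α : OneForm (bindingModel m) (B × ℂ)) (b : B) (v : Fin (2 * m + 1) → 𝔼) : ℝ :=
  wedgeOnePow m (fun u : 𝔼 ↦ covectorAt m α (b, 0) (u, 0))
    (fun u w : 𝔼 ↦ dTube m α (b, 0) (u, 0) (w, 0)) v

/-- The value of `α ∧ (dα)^(m+1)` on a frame of `B × ℂ`. -/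
def tubeVolume (α : OneForm (bindingModel m) (B × ℂ)) (p : B × ℂ)
    (F : Fin (2 * (m + 1) + 1) → 𝔼 × ℂ) : ℝ :=
  wedgeOnePow (m + 1) (covectorAt m α p) (dTube m α p) F

variable {m}

theorem bindingVolume_eq_mul (α : OneForm (bindingModel m) (B × ℂ)) (b : B)
    {u v : Fin (2 * m + 1) → 𝔼} (A : Matrix (Fin (2 * m + 1)) (Fin (2 * m + 1)) ℝ)
    (hv : ∀ i, v i = ∑ j, A i j • u j) :
    bindingVolume m α b v = A.det * bindingVolume m α b u :=
  wedgeOnePow_update_eq_mul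
    ((covectorAt m α (b, 0)).comp (ContinuousLinearMap.inl ℝ 𝔼 ℂ)).toLinearMap.isLinear
    (fun y ↦ ((isLinearMap_dTube_left m α (b, 0) (y, 0)).mk' _ ∘ₗ LinearMap.inl ℝ 𝔼 ℂ).isLinear)
    (fun y ↦ ((isLinearMap_dTube_right m α (b, 0) (y, 0)).mk' _ ∘ₗ LinearMap.inl ℝ 𝔼 ℂ).isLinear)
    A hv

theorem tubeVolume_eq_mul (α : OneForm (bindingModel m) (B × ℂ)) (p : B × ℂ)
    {u v : Fin (2 * (m + 1) + 1) → 𝔼 × ℂ}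
    (A : Matrix (Fin (2 * (m + 1) + 1)) (Fin (2 * (m + 1) + 1)) ℝ)
    (hv : ∀ i, v i = ∑ j, A i j • u j) :
    tubeVolume m α p v = A.det * tubeVolume m α p u :=
  wedgeOnePow_update_eq_mul (covectorAt m α p).toLinearMap.isLinear
    (isLinearMap_dTube_left m α p) (isLinearMap_dTube_right m α p) A hv

theorem linearIndependent_of_bindingVolume_ne_zero {α : OneForm (bindingModel m) (B × ℂ)} {b : B}
    {v : Fin (2 * m + 1) → 𝔼} (hv : bindingVolume m α b v ≠ 0) : LinearIndependent ℝ v :=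
  linearIndependent_of_wedgeOnePow_ne_zero
    ((covectorAt m α (b, 0)).comp (ContinuousLinearMap.inl ℝ 𝔼 ℂ)).toLinearMap.isLinear
    (fun y ↦ ((isLinearMap_dTube_left m α (b, 0) (y, 0)).mk' _ ∘ₗ LinearMap.inl ℝ 𝔼 ℂ).isLinear)
    (fun y ↦ ((isLinearMap_dTube_right m α (b, 0) (y, 0)).mk' _ ∘ₗ LinearMap.inl ℝ 𝔼 ℂ).isLinear)
    hv

variable [IsManifold (𝓡 (2 * m + 1)) ∞ B]

theorem contactVolume_restrictBinding {α : OneForm (bindingModel m) (B × ℂ)}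
    (hα : OneForm.SmoothOn (bindingModel m) α (solidTube B 1)) (b : B) (v : Fin (2 * m + 1) → 𝔼) :
    OneForm.contactVolume (𝓡 (2 * m + 1)) m (restrictBinding m α) univ b v =
      bindingVolume m α b v :=
  wedgeOnePow_congr (fun _ ↦ rfl) fun _ _ ↦ dWithin_restrictBinding hα _ _ _

theorem isPositiveBindingFrame_iff {α : OneForm (bindingModel m) (B × ℂ)}
    (hα : OneForm.SmoothOn (bindingModel m) α (solidTube B 1)) (b : B) (v : Fin (2 * m + 1) → 𝔼) :
    IsPositiveBindingFrame m α b v ↔ 0 < bindingVolume m α b v := by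
  rw [IsPositiveBindingFrame, contactVolume_restrictBinding hα]

theorem exists_bindingVolume_pos {α : OneForm (bindingModel m) (B × ℂ)}
    (hα : IsAdaptedContactForm m α) (b : B) : ∃ v, 0 < bindingVolume m α b v := by
  obtain ⟨v, hv⟩ : ∃ v : Fin (2 * m + 1) → 𝔼, bindingVolume m α b v ≠ 0 := by
    obtain ⟨v, hv⟩ := hα.binding_contact.volume_ne_zero b (mem_univ b)
    exact ⟨v, (contactVolume_restrictBinding hα.contact.smooth b v) ▸ hv⟩
  rcases lt_or_gt_of_ne hv with h | h
  -- The dimension 2m + 1 is odd, so negating every vector reverses the orientation, even when m =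
  -- 0.
  · refine ⟨fun i ↦ -v i, ?_⟩
    rw [bindingVolume_eq_mul α b (u := v) (-1) fun i ↦ by simp [Matrix.one_apply]]
    rw [Matrix.det_neg, Matrix.det_one, Fintype.card_fin, (odd_two_mul_add_one m).neg_one_pow]
    linarith
  · exact ⟨v, h⟩

variable (m)

/-- The frame `v` of `T_b B` is adapted to `α`, with constants `C` and `ρ`. -/
structure IsUniformFrame (α : OneForm (bindingModel m) (B × ℂ)) (C ρ : ℝ) (b : B)
    (v : Fin (2 * m + 1) → 𝔼) : Prop where
  binding_volume : 1 / C ≤ bindingVolume m α b v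
  volume : ∀ z : ℂ, ‖z‖ ≤ ρ → 1 / C ≤ tubeVolume m α (b, z) (tubeFrame m v)
  abs_form_le : ∀ z : ℂ, ‖z‖ ≤ ρ → ∀ i, |covectorAt m α (b, z) (tubeFrame m v i)| ≤ C
  abs_form_sub_le : ∀ z : ℂ, ‖z‖ ≤ ρ → ∀ i,
    |covectorAt m α (b, z) (tubeFrame m v i) - covectorAt m α (b, 0) (tubeFrame m v i)| ≤ C * ‖z‖
  abs_d_le : ∀ z : ℂ, ‖z‖ ≤ ρ → ∀ i j, |dTube m α (b, z) (tubeFrame m v i) (tubeFrame m v j)| ≤ C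
  abs_d_sub_le : ∀ z : ℂ, ‖z‖ ≤ ρ → ∀ i j,
    |dTube m α (b, z) (tubeFrame m v i) (tubeFrame m v j) -
      dTube m α (b, 0) (tubeFrame m v i) (tubeFrame m v j)| ≤ C * ‖z‖

variable {m}

omit [IsManifold (𝓡 (2 * m + 1)) ∞ B] in
theorem IsUniformFrame.mono {α : OneForm (bindingModel m) (B × ℂ)} {C C' ρ ρ' : ℝ} {b : B}
    {v : Fin (2 * m + 1) → 𝔼} (h : IsUniformFrame m α C ρ b v) (hC : 0 < C) (hCC : C ≤ C')
    (hρ : ρ' ≤ ρ) : IsUniformFrame m α C' ρ' b v where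
  binding_volume := (one_div_le_one_div_of_le hC hCC).trans h.binding_volume
  volume z hz := (one_div_le_one_div_of_le hC hCC).trans (h.volume z (hz.trans hρ))
  abs_form_le z hz i := (h.abs_form_le z (hz.trans hρ) i).trans hCC
  abs_form_sub_le z hz i := (h.abs_form_sub_le z (hz.trans hρ) i).trans (by gcongr)
  abs_d_le z hz i j := (h.abs_d_le z (hz.trans hρ) i j).trans hCC
  abs_d_sub_le z hz i j := (h.abs_d_sub_le z (hz.trans hρ) i j).trans (by gcongr)

/-- The coefficients in the frame `F` of a 1-form on a vector space, and of its differential. -/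
def coefficientsIn {V : Type*} [NormedAddCommGroup V] [NormedSpace ℝ V] {N : ℕ} (G : V → V →L[ℝ] ℝ)
    (F : Fin N → V) (x : V) : (Fin N → ℝ) × (Fin N → Fin N → ℝ) :=
  (fun i ↦ G x (F i), fun i j ↦ fderiv ℝ G x (F i) (F j) - fderiv ℝ G x (F j) (F i))

omit [IsManifold (𝓡 (2 * m + 1)) ∞ B] in
theorem contDiffAt_coefficientsIn {V : Type*} [NormedAddCommGroup V] [NormedSpace ℝ V] {N : ℕ}
    {G : V → V →L[ℝ] ℝ} (F : Fin N → V) {x : V} (hG : ContDiffAt ℝ 2 G x) :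
    ContDiffAt ℝ 1 (coefficientsIn G F) x := by
  have hG' : ContDiffAt ℝ 1 (fderiv ℝ G) x := hG.fderiv_right (by norm_num)
  refine ContDiffAt.prodMk (contDiffAt_pi.2 fun i ↦ (hG.of_le (by norm_num)).clm_apply
    contDiffAt_const) (contDiffAt_pi.2 fun i ↦ contDiffAt_pi.2 fun j ↦ ?_)
  exact ((hG'.clm_apply contDiffAt_const).clm_apply contDiffAt_const).sub
    ((hG'.clm_apply contDiffAt_const).clm_apply contDiffAt_const)

theorem form_chartFrame (α : OneForm (bindingModel m) (B × ℂ)) (v : Fin (2 * m + 1) → 𝔼)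
    (b₀ b : B) (hb : b ∈ (chartAt 𝔼 b₀).source) (z : ℂ) (i : Fin (2 * (m + 1) + 1)) :
    covectorAt m α (b, z) (tubeFrame m
      (fun i ↦ chartFrame m b₀ (extChartAt (𝓡 (2 * m + 1)) b₀ b) (v i)) i) =
    (coefficientsIn (OneForm.inChart (bindingModel m) α (b₀, 0)) (tubeFrame m v)
      (extChartAt (𝓡 (2 * m + 1)) b₀ b, z)).1 i := by
  have hb' : b ∈ (extChartAt (𝓡 (2 * m + 1)) b₀).source := by rwa [extChartAt_source]
  have := inChart_apply m α b₀ 0 (extChartAt (𝓡 (2 * m + 1)) b₀ b) z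
    ((extChartAt (𝓡 (2 * m + 1)) b₀).map_source hb') (tubeFrame m v i)
  rw [tubeFrame_comp]
  rw [(extChartAt (𝓡 (2 * m + 1)) b₀).left_inv hb'] at this
  exact this.symm

theorem d_chartFrame {α : OneForm (bindingModel m) (B × ℂ)}
    (hα : OneForm.SmoothOn (bindingModel m) α (solidTube B 1)) (v : Fin (2 * m + 1) → 𝔼)
    (b₀ b : B) (hb : b ∈ (chartAt 𝔼 b₀).source) (z : ℂ) (hz : ‖z‖ < 1)
    (i j : Fin (2 * (m + 1) + 1)) :
    dTube m α (b, z)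
      (tubeFrame m (fun i ↦ chartFrame m b₀ (extChartAt (𝓡 (2 * m + 1)) b₀ b) (v i)) i)
      (tubeFrame m (fun i ↦ chartFrame m b₀ (extChartAt (𝓡 (2 * m + 1)) b₀ b) (v i)) j) =
    (coefficientsIn (OneForm.inChart (bindingModel m) α (b₀, 0)) (tubeFrame m v)
      (extChartAt (𝓡 (2 * m + 1)) b₀ b, z)).2 i j := by
  rw [tubeFrame_comp, tubeFrame_comp]
  exact dWithin_chartFrame hα b₀ b hb z hz _ _

theorem contDiffAt_inChart {α : OneForm (bindingModel m) (B × ℂ)}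
    (hα : OneForm.SmoothOn (bindingModel m) α (solidTube B 1)) (b : B) (z : ℂ) (hz : ‖z‖ < 1) :
    ContDiffAt ℝ ∞ (OneForm.inChart (bindingModel m) α (b, 0))
      (extChartAt (𝓡 (2 * m + 1)) b b, z) :=
  (contDiffOn_inChart m hα b).contDiffAt (prod_mem_nhds (extChartAt_target_mem_nhds b)
    (Metric.closedBall_mem_nhds_of_mem (by simpa using hz)))

/-- A positive frame at `b₀` is transported by the chart. The coefficients of α and dα in it form a
C¹ map near (b₀, 0): continuity keeps the coefficients bounded and the volumes away from zero, and
C¹ gives the Lipschitz bounds in z. -/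
theorem exists_nhds_uniformFrame {α : OneForm (bindingModel m) (B × ℂ)}
    (hα : IsAdaptedContactForm m α) (b₀ : B) : ∃ t ∈ 𝓝 b₀, ∃ C ρ : ℝ, 0 < C ∧ 0 < ρ ∧ ρ < 1 ∧
      ∀ b ∈ t, ∃ v, IsUniformFrame m α C ρ b v := by
  obtain ⟨v₀, hv₀⟩ := exists_bindingVolume_pos hα b₀
  have hs := hα.contact.smooth
  have hg := contDiffAt_coefficientsIn (tubeFrame m v₀)
    ((contDiffAt_inChart hs b₀ 0 (by simp)).of_le (by norm_cast))
  have hG1 := form_chartFrame α v₀ b₀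
  have hG2 := d_chartFrame hs v₀ b₀
  have hself : (fun i ↦ chartFrame m b₀ (extChartAt (𝓡 (2 * m + 1)) b₀ b₀) (v₀ i)) = v₀ := by
    rw [chartFrame_self]
    rfl
  have hmap := (continuousAt_extChartAt (I := 𝓡 (2 * m + 1)) b₀)
  generalize coefficientsIn (OneForm.inChart (bindingModel m) α (b₀, 0)) (tubeFrame m v₀) = g
    at hg hG1 hG2
  generalize extChartAt (𝓡 (2 * m + 1)) b₀ = e at *
  set x₀ : 𝔼 × ℂ := (e b₀, 0)
  let φ : 𝔼 × ℂ → ℝ := fun x ↦ wedgeOnePow (m + 1) (g x).1 (g x).2 id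
  let ψ : 𝔼 × ℂ → ℝ := fun x ↦ wedgeOnePow m (fun i : Fin (2 * m + 1) ↦ (g x).1 i.succ.succ)
    (fun i j : Fin (2 * m + 1) ↦ (g x).2 i.succ.succ j.succ.succ) id
  have hφ : ContinuousAt φ x₀ :=
    ((contDiff_wedgeOnePow (m + 1)).continuous.continuousAt).comp hg.continuousAt
  have hψ : ContinuousAt ψ x₀ := by
    have : Continuous fun y : (Fin (2 * (m + 1) + 1) → ℝ) ×
      (Fin (2 * (m + 1) + 1) → Fin (2 * (m + 1) + 1) → ℝ) ↦
      ((fun i : Fin (2 * m + 1) ↦ y.1 i.succ.succ),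
       (fun i j : Fin (2 * m + 1) ↦ y.2 i.succ.succ j.succ.succ)) := by fun_prop
    exact ((contDiff_wedgeOnePow m).continuous.comp this).continuousAt.comp hg.continuousAt
  have volφ : ∀ b ∈ (chartAt 𝔼 b₀).source, ∀ z : ℂ, ‖z‖ < 1 →
      tubeVolume m α (b, z) (tubeFrame m (fun i ↦ chartFrame m b₀ (e b) (v₀ i))) = φ (e b, z) :=
    fun b hb z hz ↦ wedgeOnePow_congr (hG1 b hb z) (hG2 b hb z hz)
  have volψ : ∀ b ∈ (chartAt 𝔼 b₀).source,
      bindingVolume m α b (fun i ↦ chartFrame m b₀ (e b) (v₀ i)) = ψ (e b, 0) := fun b hb ↦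
    wedgeOnePow_congr (fun i ↦ hG1 b hb 0 i.succ.succ)
      fun i j ↦ hG2 b hb 0 (by simp) i.succ.succ j.succ.succ
  have hφ0 : 0 < φ x₀ := by
    rw [← volφ b₀ (mem_chart_source _ b₀) 0 (by simp), hself]
    exact hα.positive (b₀, 0) (by simp [solidTube]) v₀
      ((isPositiveBindingFrame_iff hs b₀ v₀).2 hv₀)
  have hψ0 : 0 < ψ x₀ := by
    rw [← volψ b₀ (mem_chart_source _ b₀), hself]
    exact hv₀
  obtain ⟨K, N, hN, hK⟩ := hg.exists_lipschitzOnWith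
  have hev : ∀ᶠ x in 𝓝 x₀, x ∈ N ∧ ‖g x‖ < ‖g x₀‖ + 1 ∧ φ x₀ / 2 < φ x ∧ ψ x₀ / 2 < ψ x :=
    (Filter.eventually_of_mem hN fun _ h ↦ h).and
      ((hg.continuousAt.norm.eventually_lt_const (lt_add_one _)).and
      ((hφ.eventually_const_lt (half_lt_self hφ0)).and
        (hψ.eventually_const_lt (half_lt_self hψ0))))
  rw [nhds_prod_eq] at hev
  obtain ⟨N₁, hN₁, N₂, hN₂, hN₁₂⟩ := Filter.eventually_prod_iff.1 hev
  obtain ⟨ρ, hρ, hρN⟩ := Metric.eventually_nhds_iff.1 hN₂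
  -- A sum, so that C dominates at once the Lipschitz constant, the bound on the coefficients and
  -- the inverses of half the two volumes at b₀.
  set C : ℝ := K + (‖g x₀‖ + 1) + 2 / φ x₀ + 2 / ψ x₀
  have hp1 : 0 < 2 / φ x₀ := by positivity
  have hp2 : 0 < 2 / ψ x₀ := by positivity
  have hp3 : 0 ≤ (K : ℝ) := K.2
  have hp4 : 0 ≤ ‖g x₀‖ := norm_nonneg _
  have hC : 0 < C := by positivity
  refine ⟨{b | b ∈ (chartAt 𝔼 b₀).source ∧ N₁ (e b)}, Filter.inter_mem (chart_source_mem_nhds _ _)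
    (hmap.eventually hN₁), C, min (ρ / 2) (1 / 2), hC, by positivity,
    (min_le_right _ _).trans_lt (by norm_num), ?_⟩
  rintro b ⟨hb, hb1⟩
  have hmain : ∀ z : ℂ, ‖z‖ ≤ min (ρ / 2) (1 / 2) → ‖z‖ < 1 ∧ (e b, z) ∈ N ∧
      ‖g (e b, z)‖ ≤ C ∧ 1 / C ≤ φ (e b, z) ∧ 1 / C ≤ ψ (e b, z) := by
    intro z hz
    have hz1 := hz.trans (min_le_left _ _)
    have hz2 := hz.trans (min_le_right _ _)
    obtain ⟨h1, h2, h3, h4⟩ := hN₁₂ hb1 (hρN (y := z) (by rw [dist_zero_right]; linarith))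
    refine ⟨by linarith, h1, h2.le.trans ?_, h3.le.trans' ?_, h4.le.trans' ?_⟩
    · linarith
    · rw [one_div_le hC (by positivity), one_div_div]
      linarith
    · rw [one_div_le hC (by positivity), one_div_div]
      linarith
  have hsub : ∀ z : ℂ, ‖z‖ ≤ min (ρ / 2) (1 / 2) → ‖g (e b, z) - g (e b, 0)‖ ≤ C * ‖z‖ := by
    intro z hz
    have h := hK.dist_le_mul _ (hmain z hz).2.1 _ (hmain 0 (by simp; positivity)).2.1
    rw [dist_eq_norm, Prod.dist_eq, dist_self, dist_zero_right,
      max_eq_right (norm_nonneg _)] at h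
    exact h.trans (mul_le_mul_of_nonneg_right (by linarith) (norm_nonneg _))
  refine ⟨fun i ↦ chartFrame m b₀ (e b) (v₀ i), ⟨?_, ?_, ?_, ?_, ?_, ?_⟩⟩
  · rw [volψ b hb]
    exact (hmain 0 (by simp; positivity)).2.2.2.2
  · intro z hz
    rw [volφ b hb z (hmain z hz).1]
    exact (hmain z hz).2.2.2.1
  · intro z hz i
    rw [hG1 b hb z]
    exact ((norm_le_pi_norm _ i).trans (norm_fst_le _)).trans (hmain z hz).2.2.1
  · intro z hz i
    rw [hG1 b hb z, hG1 b hb 0]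
    exact ((norm_le_pi_norm _ i).trans (norm_fst_le (g (e b, z) - g (e b, 0)))).trans (hsub z hz)
  · intro z hz i j
    rw [hG2 b hb z (hmain z hz).1]
    exact (((norm_le_pi_norm ((g (e b, z)).2 i) j).trans (norm_le_pi_norm _ i)).trans
      (norm_snd_le _)).trans
      (hmain z hz).2.2.1
  · intro z hz i j
    rw [hG2 b hb z (hmain z hz).1, hG2 b hb 0 (by simp)]
    exact (((norm_le_pi_norm ((g (e b, z) - g (e b, 0)).2 i) j).trans (norm_le_pi_norm _ i)).trans
      (norm_snd_le (g (e b, z) - g (e b, 0)))).trans (hsub z hz)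

/-- The conditions survive enlarging C and shrinking ρ, so the local constants can be merged over a
finite cover of B. -/
theorem exists_uniformFrame [CompactSpace B] {α : OneForm (bindingModel m) (B × ℂ)}
    (hα : IsAdaptedContactForm m α) : ∃ C ρ : ℝ, 0 < C ∧ 0 < ρ ∧ ρ < 1 ∧
      ∀ b : B, ∃ v, IsUniformFrame m α C ρ b v := by
  have := isCompact_univ.induction_on (X := B)
    (p := fun t ↦ ∃ C ρ : ℝ, 0 < C ∧ 0 < ρ ∧ ρ < 1 ∧ ∀ b ∈ t, ∃ v, IsUniformFrame m α C ρ b v)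
    ⟨1, 1 / 2, by norm_num, by norm_num, by norm_num, by simp⟩
    (fun s t hst ⟨C, ρ, hC, hρ, hρ1, h⟩ ↦ ⟨C, ρ, hC, hρ, hρ1, fun b hb ↦ h b (hst hb)⟩)
    (fun s t ⟨C, ρ, hC, hρ, hρ1, h⟩ ⟨C', ρ', hC', hρ', hρ1', h'⟩ ↦
      ⟨max C C', min ρ ρ', lt_max_of_lt_left hC, lt_min hρ hρ', min_lt_of_left_lt hρ1, by
        rintro b (hb | hb)
        · obtain ⟨v, hv⟩ := h b hb
          exact ⟨v, hv.mono hC (le_max_left _ _) (min_le_left _ _)⟩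
        · obtain ⟨v, hv⟩ := h' b hb
          exact ⟨v, hv.mono hC' (le_max_right _ _) (min_le_right _ _)⟩⟩)
    (fun b _ ↦ by
      obtain ⟨t, ht, h⟩ := exists_nhds_uniformFrame hα b
      exact ⟨t, mem_nhdsWithin_of_mem_nhds ht, h⟩)
  obtain ⟨C, ρ, hC, hρ, hρ1, h⟩ := this
  exact ⟨C, ρ, hC, hρ, hρ1, fun b ↦ h b (mem_univ b)⟩

end UniformFrames

/-! ### Exact formulas for the contact volume and the page volume. -/

section PointwiseEstimates

/-- Here p = dx, q = dy, d = d(r²), and `D` is the differential of h a + f η. Against h a the term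
h' d ∧ a drops out, and g dx ∧ dy is used at most once; against η the term dx ∧ dy drops out, which
leaves the contraction of `D` with the radial vector. -/
theorem wedgeOnePow_tube_expansion {V : Type*} (k : ℕ) (a p q d ζ : V → ℝ) (w D : V → V → ℝ)
    (hw : ∀ x y, w x y = -w y x) (e₀ e₁ : V)
    (v : Fin (2 * k + 1) → V) (hp0 : p e₀ = 1) (hp1 : p e₁ = 0) (hp : ∀ i, p (v i) = 0)
    (hq0 : q e₀ = 0) (hq1 : q e₁ = 1) (hq : ∀ i, q (v i) = 0) (hd : ∀ i, d (v i) = 0)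
    (x y h h' κ' f g : ℝ)
    (hD : ∀ u v, D u v = h * (w u v + κ' * (d u * ζ v - d v * ζ u)) +
      h' * (d u * a v - d v * a u) + g * (p u * q v - p v * q u)) :
    wedgeOnePow (k + 1) (fun u ↦ h * a u + f * (x * q u - y * p u)) D
      (Fin.cons e₀ (Fin.cons e₁ v : Fin (2 * k + 1 + 1) → V) : Fin (2 * k + 1 + 1 + 1) → V) =
    h ^ (k + 2) * wedgeOnePow (k + 1) a (fun u v ↦ w u v + κ' * (d u * ζ v - d v * ζ u))
      (Fin.cons e₀ (Fin.cons e₁ v : Fin (2 * k + 1 + 1) → V) : Fin (2 * k + 1 + 1 + 1) → V) +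
    (k + 1) * g * (h ^ (k + 1) * wedgeOnePow k a w v) -
    f * ((k + 1) * wedgeOnePow k (fun u ↦ x * D e₀ u + y * D e₁ u) D v) := by
  let Ω : V → V → ℝ := fun u v ↦ h * (w u v + κ' * (d u * ζ v - d v * ζ u)) +
      h' * (d u * a v - d v * a u)
  have hΩ : ∀ x y, Ω x y = -Ω y x := fun x y ↦ by
    simp only [Ω, hw x y]
    ring
  have hDΩ : D = fun u v ↦ Ω u v + g * (p u * q v - p v * q u) := by
    ext u v
    exact hD u v
  have h1 : ∀ (j : ℕ) (F : Fin (2 * j + 1) → V), wedgeOnePow j a Ω F =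
      h ^ j * wedgeOnePow j a (fun u v ↦ w u v + κ' * (d u * ζ v - d v * ζ u)) F := by
    intro j F
    have := wedgeOnePow_add_wedge_self j a (fun u ↦ h' * d u)
      (fun u v ↦ h * (w u v + κ' * (d u * ζ v - d v * ζ u))) F
    rw [← wedgeOnePow_smul_right, ← this]
    congr 1
    ext u v
    simp only [Ω]
    ring
  have h2 : wedgeOnePow k a (fun u v ↦ w u v + κ' * (d u * ζ v - d v * ζ u)) v =
      wedgeOnePow k a w v := wedgeOnePow_congr (fun _ ↦ rfl) fun i j ↦ by simp [hd]
  have h3 : wedgeOnePow k (fun u ↦ h * a u + f * (x * q u - y * p u)) Ω v =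
      h ^ (k + 1) * wedgeOnePow k a w v := by
    have : wedgeOnePow k (fun u ↦ h * a u + f * (x * q u - y * p u)) Ω v =
        wedgeOnePow k (fun u ↦ h * a u + 0 * a u) Ω v :=
      wedgeOnePow_congr (fun i ↦ by simp [hp, hq]) fun _ _ ↦ rfl
    rw [this, wedgeOnePow_linear_left, h1, h2]
    ring
  have h4 : wedgeOnePow k (fun u ↦ x * D e₀ u + y * D e₁ u) D v =
      wedgeOnePow k (fun u ↦ x * Ω e₀ u + y * Ω e₁ u) Ω v := by
    rw [hDΩ]
    exact wedgeOnePow_congr (fun i ↦ by simp [hp, hq]) fun i j ↦ by simp [hp, hq]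
  rw [h4, hDΩ, wedgeOnePow_cons_cons k _ p q Ω e₀ e₁ v hp0 hp1 hp hq1 hq, h3,
    wedgeOnePow_linear_left, wedgeOnePow_rotation k p q Ω hΩ e₀ e₁ v hp0 hp1 hp hq0 hq1 hq, h1]
  ring

variable (m : ℕ) {B : Type*} [TopologicalSpace B]
  [ChartedSpace (EuclideanSpace ℝ (Fin (2 * m + 1))) B]

local notation "𝔼" => EuclideanSpace ℝ (Fin (2 * m + 1))

/-- The value at `(b, z)` of the 1-form `(1 - κ) α + κ α_B`, for constant `κ`. -/
def mixForm (α : OneForm (bindingModel m) (B × ℂ)) (b : B) (z : ℂ) (κ : ℝ) (u : 𝔼 × ℂ) : ℝ :=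
  (1 - κ) * covectorAt m α (b, z) u + κ * covectorAt m α (b, 0) (u.1, 0)

/-- The value at `(b, z)` of the 2-form `(1 - κ) dα + κ dα_B`, for constant `κ`. -/
def mixD (α : OneForm (bindingModel m) (B × ℂ)) (b : B) (z : ℂ) (κ : ℝ) (u v : 𝔼 × ℂ) : ℝ :=
  (1 - κ) * dTube m α (b, z) u v + κ * dTube m α (b, 0) (u.1, 0) (v.1, 0)

/-- The value at `(b, z)` of the 1-form `α_B - α`. -/
def formGap (α : OneForm (bindingModel m) (B × ℂ)) (b : B) (z : ℂ) (u : 𝔼 × ℂ) : ℝ :=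
  covectorAt m α (b, 0) (u.1, 0) - covectorAt m α (b, z) u

/-- The value of the top power of `dα` on the frame `(-e, v₀, …)` of the page through `(b, z)` and
`(b, z + e)`, up to a positive constant. -/
def pageVolume (α : OneForm (bindingModel m) (B × ℂ)) (b : B) (z e : ℂ)
    (v : Fin (2 * m + 1) → 𝔼) : ℝ :=
  wedgeOnePow m (fun u ↦ -dTube m α (b, z) (0, e) u) (dTube m α (b, z)) fun i ↦ (v i, 0)

/-- The 1-form `h(r²) ((1 - κ(r²)) α + κ(r²) α_B) + f(r²) (x dy - y dx)`. -/
def interpolatedForm (h κ f : ℝ → ℝ) (α : OneForm (bindingModel m) (B × ℂ)) :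
    OneForm (bindingModel m) (B × ℂ) :=
  tubeForm m (fun q ↦ h q * (1 - κ q)) (fun q ↦ h q * κ q) f α

variable {m}

theorem covectorAt_interpolatedForm (h κ f : ℝ → ℝ) (α : OneForm (bindingModel m) (B × ℂ)) (b : B)
    (z : ℂ) (u : 𝔼 × ℂ) : covectorAt m (interpolatedForm m h κ f α) (b, z) u =
      h (‖z‖ ^ 2) * mixForm m α b z (κ (‖z‖ ^ 2)) u +
        f (‖z‖ ^ 2) * (z.re * u.2.im - z.im * u.2.re) := by
  have h1 : covectorAt m (interpolatedForm m h κ f α) (b, z) u =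
      (h (‖z‖ ^ 2) * (1 - κ (‖z‖ ^ 2))) * covectorAt m α (b, z) u +
      (h (‖z‖ ^ 2) * κ (‖z‖ ^ 2)) * covectorAt m α (b, 0) (u.1, 0) +
      f (‖z‖ ^ 2) * (z.re * u.2.im - z.im * u.2.re) :=
    tubeForm_apply m (fun q ↦ h q * (1 - κ q)) (fun q ↦ h q * κ q) f α b z u
  rw [h1, mixForm]
  ring

variable [IsManifold (𝓡 (2 * m + 1)) ∞ B]

theorem dTube_interpolatedForm {α : OneForm (bindingModel m) (B × ℂ)}
    (hα : OneForm.SmoothOn (bindingModel m) α (solidTube B 1)) {h κ f : ℝ → ℝ} (b : B) (z : ℂ)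
    (hz : ‖z‖ ≤ 1) {h' κ' f' : ℝ} (hh : HasDerivAt h h' (‖z‖ ^ 2)) (hκ : HasDerivAt κ κ' (‖z‖ ^ 2))
    (hf : HasDerivAt f f' (‖z‖ ^ 2)) (u v : 𝔼 × ℂ) :
    dTube m (interpolatedForm m h κ f α) (b, z) u v =
      h (‖z‖ ^ 2) * (mixD m α b z (κ (‖z‖ ^ 2)) u v +
        κ' * ((2 * (z.re * u.2.re + z.im * u.2.im)) * formGap m α b z v -
          (2 * (z.re * v.2.re + z.im * v.2.im)) * formGap m α b z u)) +
      h' * ((2 * (z.re * u.2.re + z.im * u.2.im)) * mixForm m α b z (κ (‖z‖ ^ 2)) v -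
        (2 * (z.re * v.2.re + z.im * v.2.im)) * mixForm m α b z (κ (‖z‖ ^ 2)) u) +
      (2 * (f (‖z‖ ^ 2) + ‖z‖ ^ 2 * f')) * (u.2.re * v.2.im - v.2.re * u.2.im) := by
  have d1 : HasDerivAt (fun q ↦ h q * (1 - κ q)) (h' * (1 - κ (‖z‖ ^ 2)) + h (‖z‖ ^ 2) * (0 - κ'))
    (‖z‖ ^ 2) := hh.mul ((hasDerivAt_const _ _).sub hκ)
  have d2 : HasDerivAt (fun q ↦ h q * κ q) (h' * κ (‖z‖ ^ 2) + h (‖z‖ ^ 2) * κ')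
    (‖z‖ ^ 2) := hh.mul hκ
  have key := dWithin_tubeForm hα b z hz d1.differentiableAt d2.differentiableAt
    hf.differentiableAt u v
  rw [d1.deriv, d2.deriv, hf.deriv] at key
  have key' : dTube m (interpolatedForm m h κ f α) (b, z) u v =
      (h (‖z‖ ^ 2) * (1 - κ (‖z‖ ^ 2))) * dTube m α (b, z) u v +
      (h (‖z‖ ^ 2) * κ (‖z‖ ^ 2)) * dTube m α (b, 0) (u.1, 0) (v.1, 0) +
      (h' * (1 - κ (‖z‖ ^ 2)) + h (‖z‖ ^ 2) * (0 - κ')) *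
        (2 * (z.re * u.2.re + z.im * u.2.im) * covectorAt m α (b, z) v -
        2 * (z.re * v.2.re + z.im * v.2.im) * covectorAt m α (b, z) u) +
      (h' * κ (‖z‖ ^ 2) + h (‖z‖ ^ 2) * κ') *
        (2 * (z.re * u.2.re + z.im * u.2.im) * covectorAt m α (b, 0) (v.1, 0) -
        2 * (z.re * v.2.re + z.im * v.2.im) * covectorAt m α (b, 0) (u.1, 0)) +
      2 * (f (‖z‖ ^ 2) + ‖z‖ ^ 2 * f') * (u.2.re * v.2.im - u.2.im * v.2.re) := key
  rw [key']
  simp only [mixD, mixForm, formGap]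
  ring

/-- At z = r e the radial vector is r times the unit vector e, so the contribution of η is f r times
the page volume of the modified form itself. -/
theorem tubeVolume_interpolatedForm {α : OneForm (bindingModel m) (B × ℂ)}
    (hα : OneForm.SmoothOn (bindingModel m) α (solidTube B 1)) {h κ f : ℝ → ℝ} (b : B) {r : ℝ}
    {e : ℂ} (he : ‖e‖ = 1) (hr : 0 ≤ r) (hr1 : r ≤ 1) {h' κ' f' : ℝ} (hh : HasDerivAt h h' (r ^ 2))
    (hκ : HasDerivAt κ κ' (r ^ 2)) (hf : HasDerivAt f f' (r ^ 2)) (v : Fin (2 * m + 1) → 𝔼) :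
    tubeVolume m (interpolatedForm m h κ f α) (b, r * e) (tubeFrame m v) =
      h (r ^ 2) ^ (m + 2) * wedgeOnePow (m + 1) (mixForm m α b (r * e) (κ (r ^ 2)))
        (fun u v ↦ mixD m α b (r * e) (κ (r ^ 2)) u v +
          κ' * ((2 * r * (e.re * u.2.re + e.im * u.2.im)) * formGap m α b (r * e) v -
          (2 * r * (e.re * v.2.re + e.im * v.2.im)) * formGap m α b (r * e) u)) (tubeFrame m v) +
      (m + 1) * (2 * (f (r ^ 2) + r ^ 2 * f')) * (h (r ^ 2) ^ (m + 1) *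
        wedgeOnePow m (mixForm m α b (r * e) (κ (r ^ 2))) (mixD m α b (r * e) (κ (r ^ 2)))
          fun i ↦ (v i, 0)) +
      f (r ^ 2) * r * ((m + 1) * pageVolume m (interpolatedForm m h κ f α) b (r * e) e v) := by
  have hn : ‖(r : ℂ) * e‖ = r := by
    rw [norm_mul, he, mul_one, Complex.norm_real, Real.norm_of_nonneg hr]
  set z : ℂ := r * e with hz
  have h1 := fun u v ↦ dTube_interpolatedForm (h := h) (κ := κ) (f := f) (h' := h') (κ' := κ')
    (f' := f') hα b z (by rwa [hn]) (by rwa [hn]) (by rwa [hn]) (by rwa [hn]) u v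
  have h2 := fun u ↦ covectorAt_interpolatedForm h κ f α b z u
  rw [hn] at h1 h2
  have hre : z.re = r * e.re := by simp [hz]
  have him : z.im = r * e.im := by simp [hz]
  have hskew : ∀ x y, mixD m α b z (κ (r ^ 2)) x y = -mixD m α b z (κ (r ^ 2)) y x := by
    intro x y
    rw [mixD, mixD, dTube_skew m α _ x y, dTube_skew m α _ (x.1, 0)]
    ring
  have key := wedgeOnePow_tube_expansion m (mixForm m α b z (κ (r ^ 2))) (fun u : 𝔼 × ℂ ↦ u.2.re)
    (fun u : 𝔼 × ℂ ↦ u.2.im) (fun u : 𝔼 × ℂ ↦ 2 * r * (e.re * u.2.re + e.im * u.2.im))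
    (formGap m α b z) (mixD m α b z (κ (r ^ 2))) (dTube m (interpolatedForm m h κ f α) (b, z))
    hskew (0, 1) (0, Complex.I) (fun i ↦ (v i, 0)) (by simp) (by simp) (by simp) (by simp) (by simp)
    (by simp) (by simp) z.re z.im (h (r ^ 2)) h' κ' (f (r ^ 2)) (2 * (f (r ^ 2) + r ^ 2 * f'))
    (fun u v ↦ by rw [h1, hre, him]; ring)
  have h3 : wedgeOnePow m (fun u ↦ z.re * dTube m (interpolatedForm m h κ f α) (b, z) (0, 1) u +
      z.im * dTube m (interpolatedForm m h κ f α) (b, z) (0, Complex.I) u)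
      (dTube m (interpolatedForm m h κ f α) (b, z)) (fun i ↦ (v i, 0)) =
      -r * pageVolume m (interpolatedForm m h κ f α) b z e v := by
    have := wedgeOnePow_linear_left m (-r) 0
      (fun u ↦ -dTube m (interpolatedForm m h κ f α) (b, z) (0, e) u) (fun _ ↦ 0)
      (dTube m (interpolatedForm m h κ f α) (b, z)) (fun i ↦ (v i, 0))
    simp only [zero_mul, add_zero] at this
    rw [pageVolume, ← this]
    congr 1
    ext u
    have hl := isLinearMap_dTube_left m (interpolatedForm m h κ f α) (b, z) u
    have : ((0, e) : 𝔼 × ℂ) = e.re • (0, 1) + e.im • (0, Complex.I) := by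
      simp [Prod.ext_iff, Complex.re_add_im]
    rw [this, hl.map_add, hl.map_smul, hl.map_smul, hre, him, smul_eq_mul, smul_eq_mul]
    ring
  have h4 : tubeVolume m (interpolatedForm m h κ f α) (b, z) (tubeFrame m v) =
      wedgeOnePow (m + 1) (fun u : 𝔼 × ℂ ↦ h (r ^ 2) * mixForm m α b z (κ (r ^ 2)) u +
        f (r ^ 2) * (z.re * u.2.im - z.im * u.2.re))
        (dTube m (interpolatedForm m h κ f α) (b, z)) (tubeFrame m v) :=
    wedgeOnePow_congr (fun i ↦ h2 _) fun _ _ ↦ rfl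
  rw [h4]
  rw [h3] at key
  refine key.trans ?_
  change _ * wedgeOnePow (m + 1) _ _ (tubeFrame m v) + _ - _ = _
  ring

/-- The form dx ∧ dy vanishes on a page and dα_B has no radial component, so the contraction with
-∂_r consists of (1-κ) times that of dα and of the two terms with κ' and h'. The part of dβ along B
is simply h times `mixD`. -/
theorem pageVolume_interpolatedForm {α : OneForm (bindingModel m) (B × ℂ)}
    (hα : OneForm.SmoothOn (bindingModel m) α (solidTube B 1)) {h κ f : ℝ → ℝ} (b : B) {r : ℝ}
    {e : ℂ} (he : ‖e‖ = 1) (hr : 0 ≤ r) (hr1 : r ≤ 1) {h' κ' f' : ℝ} (hh : HasDerivAt h h' (r ^ 2))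
    (hκ : HasDerivAt κ κ' (r ^ 2)) (hf : HasDerivAt f f' (r ^ 2)) (v : Fin (2 * m + 1) → 𝔼) :
    pageVolume m (interpolatedForm m h κ f α) b (r * e) e v = h (r ^ 2) ^ m *
      (h (r ^ 2) * (1 - κ (r ^ 2)) * wedgeOnePow m (fun u ↦ -dTube m α (b, r * e) (0, e) u)
          (mixD m α b (r * e) (κ (r ^ 2))) (fun i ↦ (v i, 0)) -
        2 * r * h (r ^ 2) * κ' * wedgeOnePow m (formGap m α b (r * e))
          (mixD m α b (r * e) (κ (r ^ 2))) (fun i ↦ (v i, 0)) -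
        2 * r * h' * wedgeOnePow m (mixForm m α b (r * e) (κ (r ^ 2)))
          (mixD m α b (r * e) (κ (r ^ 2))) (fun i ↦ (v i, 0))) := by
  have hn : ‖(r : ℂ) * e‖ = r := by
    rw [norm_mul, he, mul_one, Complex.norm_real, Real.norm_of_nonneg hr]
  have hee : e.re * e.re + e.im * e.im = 1 := by
    have := Complex.sq_norm e
    rw [he, Complex.normSq_apply] at this
    linarith
  set z : ℂ := r * e with hz
  have h1 := fun u v ↦ dTube_interpolatedForm (h := h) (κ := κ) (f := f) (h' := h') (κ' := κ')
    (f' := f') hα b z (by rwa [hn]) (by rwa [hn]) (by rwa [hn]) (by rwa [hn]) u v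
  rw [hn] at h1
  have hre : z.re = r * e.re := by simp [hz]
  have him : z.im = r * e.im := by simp [hz]
  rw [pageVolume]
  trans wedgeOnePow m (fun u ↦ (h (r ^ 2) * (1 - κ (r ^ 2))) * (fun u ↦ -dTube m α (b, z) (0, e) u) u +
      1 * (fun u ↦ (-(2 * r * h (r ^ 2) * κ')) * formGap m α b z u +
      (-(2 * r * h')) * mixForm m α b z (κ (r ^ 2)) u) u)
      (fun x y ↦ h (r ^ 2) * mixD m α b z (κ (r ^ 2)) x y) (fun i ↦ ((v i, 0) : 𝔼 × ℂ))
  · refine wedgeOnePow_congr (fun i ↦ ?_) fun i j ↦ ?_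
    · rw [h1, hre, him]
      have h0 : mixD m α b z (κ (r ^ 2)) (0, e) (v i, 0) =
          (1 - κ (r ^ 2)) * dTube m α (b, z) (0, e) (v i, 0) := by
        have := (isLinearMap_dTube_left m α (b, 0) (v i, 0)).map_zero
        rw [mixD]
        change _ + _ * dTube m α (b, 0) (0 : 𝔼 × ℂ) (v i, 0) = _
        rw [this, mul_zero, add_zero]
      rw [h0]
      have h5 : 2 * (r * e.re * e.re + r * e.im * e.im) = 2 * r := by linear_combination 2 * r * hee
      simp only [h5, Complex.zero_re, Complex.zero_im]
      ring
    · rw [h1]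
      simp
  · rw [wedgeOnePow_smul_right, wedgeOnePow_linear_left, wedgeOnePow_linear_left]
    ring

end PointwiseEstimates

/-! ### Estimates in a uniform frame. -/

section UniformEstimates

/-- `L` bounds the values and the variation of `a ∧ w ∧ ⋯ ∧ w`, for `a` and `w` with coefficients
bounded by `C`. -/
def IsWedgeLipschitz (k : ℕ) (C L : ℝ) : Prop :=
  (∀ (a a' : Fin (2 * k + 1) → ℝ) (w w' : Fin (2 * k + 1) → Fin (2 * k + 1) → ℝ) (δ : ℝ), 0 ≤ δ →
      (∀ i, |a i| ≤ C) → (∀ i, |a' i| ≤ C) → (∀ i j, |w i j| ≤ C) → (∀ i j, |w' i j| ≤ C) →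
      (∀ i, |a i - a' i| ≤ δ) → (∀ i j, |w i j - w' i j| ≤ δ) →
      |wedgeOnePow k a w id - wedgeOnePow k a' w' id| ≤ L * δ) ∧
    (∀ (a : Fin (2 * k + 1) → ℝ) (w : Fin (2 * k + 1) → Fin (2 * k + 1) → ℝ),
      (∀ i, |a i| ≤ C) → (∀ i j, |w i j| ≤ C) → |wedgeOnePow k a w id| ≤ L)

theorem exists_isWedgeLipschitz (k : ℕ) (C : ℝ) : ∃ L, 0 < L ∧ IsWedgeLipschitz k C L :=
  exists_wedgeOnePow_lipschitz k C

theorem IsWedgeLipschitz.mono {k : ℕ} {C L L' : ℝ} (h : IsWedgeLipschitz k C L) (hL : L ≤ L') :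
    IsWedgeLipschitz k C L' :=
  ⟨fun a a' w w' δ hδ h1 h2 h3 h4 h5 h6 ↦ (h.1 a a' w w' δ hδ h1 h2 h3 h4 h5 h6).trans
    (mul_le_mul_of_nonneg_right hL hδ), fun a w h1 h2 ↦ (h.2 a w h1 h2).trans hL⟩

theorem IsWedgeLipschitz.abs_sub_le {V : Type*} {k : ℕ} {C L δ : ℝ} (h : IsWedgeLipschitz k C L)
    {a a' : V → ℝ} {w w' : V → V → ℝ} {v : Fin (2 * k + 1) → V} (hδ : 0 ≤ δ)
    (h1 : ∀ i, |a (v i)| ≤ C) (h2 : ∀ i, |a' (v i)| ≤ C) (h3 : ∀ i j, |w (v i) (v j)| ≤ C)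
    (h4 : ∀ i j, |w' (v i) (v j)| ≤ C) (h5 : ∀ i, |a (v i) - a' (v i)| ≤ δ)
    (h6 : ∀ i j, |w (v i) (v j) - w' (v i) (v j)| ≤ δ) :
    |wedgeOnePow k a w v - wedgeOnePow k a' w' v| ≤ L * δ :=
  h.1 (fun i ↦ a (v i)) (fun i ↦ a' (v i)) (fun i j ↦ w (v i) (v j)) (fun i j ↦ w' (v i) (v j)) δ
    hδ h1 h2 h3 h4 h5 h6

theorem IsWedgeLipschitz.abs_le {V : Type*} {k : ℕ} {C L : ℝ} (h : IsWedgeLipschitz k C L)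
    {a : V → ℝ} {w : V → V → ℝ} {v : Fin (2 * k + 1) → V}
    (h1 : ∀ i, |a (v i)| ≤ C) (h3 : ∀ i j, |w (v i) (v j)| ≤ C) :
    |wedgeOnePow k a w v| ≤ L :=
  h.2 (fun i ↦ a (v i)) (fun i j ↦ w (v i) (v j)) h1 h3

theorem abs_convexCombination_le {x y κ C : ℝ} (h0 : 0 ≤ κ) (h1 : κ ≤ 1) (hx : |x| ≤ C)
    (hy : |y| ≤ C) : |(1 - κ) * x + κ * y| ≤ C := by
  rw [abs_le] at *
  constructor <;> nlinarith

theorem abs_convexCombination_sub_le {x y κ C : ℝ} (h0 : 0 ≤ κ) (h1 : κ ≤ 1) (h : |x - y| ≤ C) :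
    |(1 - κ) * x + κ * y - y| ≤ C := by
  have : (1 - κ) * x + κ * y - y = (1 - κ) * (x - y) := by ring
  rw [this, abs_mul, abs_of_nonneg (sub_nonneg.2 h1)]
  exact (mul_le_of_le_one_left (abs_nonneg _) (by linarith)).trans h

variable {m : ℕ} {B : Type*} [TopologicalSpace B]
  [ChartedSpace (EuclideanSpace ℝ (Fin (2 * m + 1))) B]

local notation "𝔼" => EuclideanSpace ℝ (Fin (2 * m + 1))

theorem mixD_zero (α : OneForm (bindingModel m) (B × ℂ)) (b : B) (z : ℂ) :
    mixD m α b z 0 = dTube m α (b, z) := by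
  ext u v
  simp [mixD]

theorem mixForm_zero (α : OneForm (bindingModel m) (B × ℂ)) (b : B) (z : ℂ) :
    mixForm m α b z 0 = covectorAt m α (b, z) := by
  ext u
  simp [mixForm]

/-- The orientation of the pages, expressed through `pageVolume`. -/
theorem wedgePow_pageForm (α : OneForm (bindingModel m) (B × ℂ)) (θ : ℝ) (b : B) (r : ℝ)
    (v : Fin (2 * m + 1) → 𝔼) :
    wedgePow (m + 1) (pageForm m α θ b r)
      (Fin.cons ((0, -1) : 𝔼 × ℝ) fun i ↦ ((v i, 0) : 𝔼 × ℝ)) =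
    (m + 1) * pageVolume m α b (r * Complex.exp (θ * Complex.I)) (Complex.exp (θ * Complex.I)) v := by
  have h1 := wedgePow_cons m (pageForm m α θ b r) (fun x y ↦ dTube_skew m α _ _ _)
    ((0, -1) : 𝔼 × ℝ) (fun i ↦ ((v i, 0) : 𝔼 × ℝ))
  refine h1.trans ?_
  congr 1
  refine wedgeOnePow_congr (fun i ↦ ?_) fun i j ↦ ?_
  · have hl := (isLinearMap_dTube_left m α (b, r * Complex.exp (θ * Complex.I)) (v i, 0)).map_neg
      (0, Complex.exp (θ * Complex.I))
    refine Eq.trans ?_ hl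
    simp [pageForm, dTube]
  · simp [pageForm, dTube]

section Frame

variable {α : OneForm (bindingModel m) (B × ℂ)} {C ρ L : ℝ} {b : B}
  {v : Fin (2 * m + 1) → EuclideanSpace ℝ (Fin (2 * m + 1))} (hv : IsUniformFrame m α C ρ b v) (hC : 0 < C) (hρ : 0 ≤ ρ)

include hv hC hρ

theorem IsUniformFrame.abs_form_fst_le (i : Fin (2 * (m + 1) + 1)) :
    |covectorAt m α (b, 0) ((tubeFrame m v i).1, 0)| ≤ C := by
  refine Fin.cases ?_ (Fin.cases ?_ fun i ↦ ?_) i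
  · change |covectorAt m α (b, 0) (0 : 𝔼 × ℂ)| ≤ C
    simpa using hC.le
  · change |covectorAt m α (b, 0) (0 : 𝔼 × ℂ)| ≤ C
    simpa using hC.le
  · exact hv.abs_form_le 0 (by simpa using hρ) i.succ.succ

theorem IsUniformFrame.abs_d_fst_le (i j : Fin (2 * (m + 1) + 1)) :
    |dTube m α (b, 0) ((tubeFrame m v i).1, 0) ((tubeFrame m v j).1, 0)| ≤ C := by
  have h1 : ∀ u, |dTube m α (b, 0) (0 : 𝔼 × ℂ) u| ≤ C := fun u ↦ by
    rw [(isLinearMap_dTube_left m α (b, 0) u).map_zero]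
    simpa using hC.le
  have h2 : ∀ u, |dTube m α (b, 0) u (0 : 𝔼 × ℂ)| ≤ C := fun u ↦ by
    rw [(isLinearMap_dTube_right m α (b, 0) u).map_zero]
    simpa using hC.le
  refine Fin.cases (h1 _) (Fin.cases (h1 _) fun i ↦ ?_) i
  refine Fin.cases (h2 _) (Fin.cases (h2 _) fun j ↦ ?_) j
  exact hv.abs_d_le 0 (by simpa using hρ) i.succ.succ j.succ.succ

variable {z : ℂ} (hz : ‖z‖ ≤ ρ)

include hz

theorem IsUniformFrame.abs_mixForm_le {κ : ℝ} (h0 : 0 ≤ κ) (h1 : κ ≤ 1)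
    (i : Fin (2 * (m + 1) + 1)) : |mixForm m α b z κ (tubeFrame m v i)| ≤ C :=
  abs_convexCombination_le h0 h1 (hv.abs_form_le z hz i) (hv.abs_form_fst_le hC hρ i)

theorem IsUniformFrame.abs_mixD_le {κ : ℝ} (h0 : 0 ≤ κ) (h1 : κ ≤ 1)
    (i j : Fin (2 * (m + 1) + 1)) : |mixD m α b z κ (tubeFrame m v i) (tubeFrame m v j)| ≤ C :=
  abs_convexCombination_le h0 h1 (hv.abs_d_le z hz i j) (hv.abs_d_fst_le hC hρ i j)

theorem IsUniformFrame.abs_formGap_le (i : Fin (2 * (m + 1) + 1)) :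
    |formGap m α b z (tubeFrame m v i)| ≤ 2 * C := by
  have := (abs_sub (covectorAt m α (b, 0) ((tubeFrame m v i).1, 0))
    (covectorAt m α (b, z) (tubeFrame m v i)))
  exact this.trans (by linarith [hv.abs_form_le z hz i, hv.abs_form_fst_le hC hρ i])

theorem IsUniformFrame.abs_mixForm_sub_le {κ : ℝ} (h0 : 0 ≤ κ) (h1 : κ ≤ 1)
    (i : Fin (2 * m + 1)) :
    |mixForm m α b z κ (v i, 0) - covectorAt m α (b, 0) (v i, 0)| ≤ C * ‖z‖ :=
  abs_convexCombination_sub_le h0 h1 (hv.abs_form_sub_le z hz i.succ.succ)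

theorem IsUniformFrame.abs_mixD_sub_le {κ : ℝ} (h0 : 0 ≤ κ) (h1 : κ ≤ 1)
    (i j : Fin (2 * m + 1)) :
    |mixD m α b z κ (v i, 0) (v j, 0) - dTube m α (b, 0) (v i, 0) (v j, 0)| ≤ C * ‖z‖ :=
  abs_convexCombination_sub_le h0 h1 (hv.abs_d_sub_le z hz i.succ.succ j.succ.succ)

theorem IsUniformFrame.abs_d_radial_le {e : ℂ} (he : ‖e‖ ≤ 1) (i : Fin (2 * m + 1)) :
    |-dTube m α (b, z) (0, e) (v i, 0)| ≤ 2 * C := by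
  have hl := isLinearMap_dTube_left m α (b, z) (v i, 0)
  have he' : ((0, e) : 𝔼 × ℂ) = e.re • (0, 1) + e.im • (0, Complex.I) := by
    simp [Complex.re_add_im]
  have h1 : |e.re * dTube m α (b, z) (0, 1) (v i, 0)| ≤ 1 * C := by
    rw [abs_mul]
    exact mul_le_mul ((Complex.abs_re_le_norm e).trans he) (hv.abs_d_le z hz 0 i.succ.succ)
      (abs_nonneg _) zero_le_one
  have h2 : |e.im * dTube m α (b, z) (0, Complex.I) (v i, 0)| ≤ 1 * C := by
    rw [abs_mul]
    exact mul_le_mul ((Complex.abs_im_le_norm e).trans he)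
      (hv.abs_d_le z hz (Fin.succ 0) i.succ.succ) (abs_nonneg _) zero_le_one
  rw [abs_neg, he', hl.map_add, hl.map_smul, hl.map_smul]
  exact (abs_add_le _ _).trans (by simp only [smul_eq_mul]; linarith)

theorem IsUniformFrame.abs_d_radial_sub_le {e : ℂ} (he : ‖e‖ ≤ 1) (i : Fin (2 * m + 1)) :
    |-dTube m α (b, z) (0, e) (v i, 0) - -dTube m α (b, 0) (0, e) (v i, 0)| ≤ 2 * C * ‖z‖ := by
  have hl := isLinearMap_dTube_left m α (b, z) (v i, 0)
  have hl0 := isLinearMap_dTube_left m α (b, 0) (v i, 0)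
  have he' : ((0, e) : 𝔼 × ℂ) = e.re • (0, 1) + e.im • (0, Complex.I) := by
    simp [Complex.re_add_im]
  have h1 : |e.re * (dTube m α (b, z) (0, 1) (v i, 0) - dTube m α (b, 0) (0, 1) (v i, 0))| ≤
      1 * (C * ‖z‖) := by
    rw [abs_mul]
    exact mul_le_mul ((Complex.abs_re_le_norm e).trans he) (hv.abs_d_sub_le z hz 0 i.succ.succ)
      (abs_nonneg _) zero_le_one
  have h2 : |e.im * (dTube m α (b, z) (0, Complex.I) (v i, 0) -
      dTube m α (b, 0) (0, Complex.I) (v i, 0))| ≤ 1 * (C * ‖z‖) := by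
    rw [abs_mul]
    exact mul_le_mul ((Complex.abs_im_le_norm e).trans he)
      (hv.abs_d_sub_le z hz (Fin.succ 0) i.succ.succ) (abs_nonneg _) zero_le_one
  rw [he', hl.map_add, hl.map_smul, hl.map_smul, hl0.map_add, hl0.map_smul, hl0.map_smul]
  rw [abs_le] at *
  simp only [smul_eq_mul]
  constructor <;> nlinarith

variable (hL : 0 < L) (hm : IsWedgeLipschitz m (5 * C) L)

include hL hm

theorem IsUniformFrame.abs_mixVolume_le {κ : ℝ} (h0 : 0 ≤ κ) (h1 : κ ≤ 1) :
    |wedgeOnePow m (mixForm m α b z κ) (mixD m α b z κ) fun i ↦ (v i, 0)| ≤ L :=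
  hm.abs_le (fun i ↦ (hv.abs_mixForm_le hC hρ hz h0 h1 i.succ.succ).trans (by linarith))
    fun i j ↦ (hv.abs_mixD_le hC hρ hz h0 h1 i.succ.succ j.succ.succ).trans (by linarith)

theorem IsUniformFrame.le_mixVolume {κ : ℝ} (h0 : 0 ≤ κ) (h1 : κ ≤ 1) :
    1 / C - L * (C * ‖z‖) ≤
      wedgeOnePow m (mixForm m α b z κ) (mixD m α b z κ) fun i ↦ (v i, 0) := by
  have h0z : ‖(0 : ℂ)‖ ≤ ρ := by simpa using hρ
  have h2 : bindingVolume m α b v = wedgeOnePow m (covectorAt m α (b, 0)) (dTube m α (b, 0))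
    fun i ↦ (v i, 0) := wedgeOnePow_congr (fun _ ↦ rfl) fun _ _ ↦ rfl
  have h3 := hm.abs_sub_le (a := mixForm m α b z κ) (w := mixD m α b z κ)
    (a' := covectorAt m α (b, 0)) (w' := dTube m α (b, 0)) (v := fun i ↦ (v i, 0))
    (δ := C * ‖z‖) (by positivity)
    (fun i ↦ (hv.abs_mixForm_le hC hρ hz h0 h1 i.succ.succ).trans (by linarith))
    (fun i ↦ (hv.abs_form_le 0 h0z i.succ.succ).trans (by linarith))
    (fun i j ↦ (hv.abs_mixD_le hC hρ hz h0 h1 i.succ.succ j.succ.succ).trans (by linarith))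
    (fun i j ↦ (hv.abs_d_le 0 h0z i.succ.succ j.succ.succ).trans (by linarith))
    (hv.abs_mixForm_sub_le hC hρ hz h0 h1) (hv.abs_mixD_sub_le hC hρ hz h0 h1)
  have h4 := hv.binding_volume
  rw [h2] at h4
  linarith [(abs_le.1 h3).1]

/-- On TB the form α_B - α vanishes at z = 0. The resulting factor ‖z‖ is what compensates the large
derivative of κ on the pages. -/
theorem IsUniformFrame.abs_gapVolume_le {κ : ℝ} (h0 : 0 ≤ κ) (h1 : κ ≤ 1) :
    |wedgeOnePow m (formGap m α b z) (mixD m α b z κ) fun i ↦ (v i, 0)| ≤ L * (C * ‖z‖) := by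
  have h0z : ‖(0 : ℂ)‖ ≤ ρ := by simpa using hρ
  have h2 : (wedgeOnePow m (formGap m α b z) (mixD m α b z κ) fun i ↦ ((v i, 0) : 𝔼 × ℂ)) =
      wedgeOnePow m (covectorAt m α (b, 0)) (mixD m α b z κ) (fun i ↦ (v i, 0)) -
      wedgeOnePow m (covectorAt m α (b, z)) (mixD m α b z κ) (fun i ↦ (v i, 0)) := by
    have h := wedgeOnePow_linear_left m 1 (-1) (covectorAt m α (b, 0)) (covectorAt m α (b, z))
      (mixD m α b z κ) fun i ↦ ((v i, 0) : 𝔼 × ℂ)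
    rw [sub_eq_add_neg, ← one_mul (wedgeOnePow m (covectorAt m α (b, 0)) _ _), ← neg_one_mul, ← h]
    refine wedgeOnePow_congr (fun i ↦ ?_) fun _ _ ↦ rfl
    simp only [formGap]
    ring
  rw [h2]
  refine hm.abs_sub_le (by positivity)
    (fun i ↦ (hv.abs_form_le 0 h0z i.succ.succ).trans (by linarith))
    (fun i ↦ (hv.abs_form_le z hz i.succ.succ).trans (by linarith))
    (fun i j ↦ (hv.abs_mixD_le hC hρ hz h0 h1 i.succ.succ j.succ.succ).trans (by linarith))
    (fun i j ↦ (hv.abs_mixD_le hC hρ hz h0 h1 i.succ.succ j.succ.succ).trans (by linarith))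
    (fun i ↦ ?_) fun i j ↦ by rw [sub_self, abs_zero]; positivity
  rw [abs_sub_comm]
  exact hv.abs_form_sub_le z hz i.succ.succ

theorem IsUniformFrame.abs_radialVolume_sub_le {κ : ℝ} (h0 : 0 ≤ κ) (h1 : κ ≤ 1) {e : ℂ}
    (he : ‖e‖ ≤ 1) :
    |wedgeOnePow m (fun u ↦ -dTube m α (b, z) (0, e) u) (mixD m α b z κ) (fun i ↦ (v i, 0)) -
      pageVolume m α b 0 e v| ≤ L * (2 * C * ‖z‖) := by
  have h0z : ‖(0 : ℂ)‖ ≤ ρ := by simpa using hρ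
  have hn : 0 ≤ C * ‖z‖ := by positivity
  refine hm.abs_sub_le (by positivity)
    (fun i ↦ (hv.abs_d_radial_le hC hρ hz he i).trans (by linarith))
    (fun i ↦ (hv.abs_d_radial_le hC hρ h0z he i).trans (by linarith))
    (fun i j ↦ (hv.abs_mixD_le hC hρ hz h0 h1 i.succ.succ j.succ.succ).trans (by linarith))
    (fun i j ↦ (hv.abs_d_le 0 h0z i.succ.succ j.succ.succ).trans (by linarith))
    (fun i ↦ hv.abs_d_radial_sub_le hC hρ hz he i)
    (fun i j ↦ (hv.abs_mixD_sub_le hC hρ hz h0 h1 i j).trans (by linarith))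

omit hz in
-- The value on B is the limit of positive values along the ray of direction e, so it is
-- nonnegative, though possibly zero.
theorem IsUniformFrame.pageVolume_zero_nonneg (hρ0 : 0 < ρ) (hρ1 : ρ ≤ 1) {e : ℂ} (he : ‖e‖ = 1)
    (hpage : ∀ r : ℝ, 0 < r → r ≤ 1 → 0 < pageVolume m α b (r * e) e v) :
    0 ≤ pageVolume m α b 0 e v := by
  by_contra! h
  set p := pageVolume m α b 0 e v
  -- Chosen so that the Lipschitz error L · 2C · r is at most -p/2, which would make the page volume
  -- at radius r negative.
  set r := min ρ (-p / (2 * (L * (2 * C))))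
  have hr : 0 < r := lt_min hρ0 (div_pos (by linarith) (by positivity))
  have hn : ‖(r : ℂ) * e‖ = r := by
    rw [norm_mul, he, mul_one, Complex.norm_real, Real.norm_of_nonneg hr.le]
  have h1 := hv.abs_radialVolume_sub_le hC hρ (z := r * e) (by rw [hn]; exact min_le_left _ _) hL hm
    le_rfl zero_le_one he.le
  rw [mixD_zero, hn] at h1
  have h2 := hpage r hr ((min_le_left _ _).trans hρ1)
  have h3 := (abs_le.1 h1).2
  have h4 : r * (2 * (L * (2 * C))) ≤ -p := (le_div_iff₀ (by positivity)).1 (min_le_right _ _)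
  unfold pageVolume at h2
  nlinarith

theorem IsUniformFrame.le_radialVolume (hρ0 : 0 < ρ) (hρ1 : ρ ≤ 1) {κ : ℝ} (h0 : 0 ≤ κ)
    (h1 : κ ≤ 1) {e : ℂ} (he : ‖e‖ = 1)
    (hpage : ∀ r : ℝ, 0 < r → r ≤ 1 → 0 < pageVolume m α b (r * e) e v) :
    -(L * (2 * C * ‖z‖)) ≤
      wedgeOnePow m (fun u ↦ -dTube m α (b, z) (0, e) u) (mixD m α b z κ) (fun i ↦ (v i, 0)) := by
  have h2 := hv.abs_radialVolume_sub_le hC hρ hz hL hm h0 h1 he.le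
  have h3 := hv.pageVolume_zero_nonneg hC hρ hL hm hρ0 hρ1 he hpage
  linarith [(abs_le.1 h2).1]

omit hm
-- The value is affine in t, so bounds at t = 0 and t = 1 suffice. At t = 1 the coefficients of the
-- 2-form are at most C + 2C + 2C = 5C, the bound on which L is based.
theorem IsUniformFrame.abs_gapTwistVolume_le (hm1 : IsWedgeLipschitz (m + 1) (5 * C) L) {κ : ℝ}
    (h0 : 0 ≤ κ) (h1 : κ ≤ 1) {e : ℂ} (he : ‖e‖ ≤ 1) (t : ℝ) :
    |wedgeOnePow (m + 1) (mixForm m α b z κ) (fun u v ↦ mixD m α b z κ u v +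
      t * ((e.re * u.2.re + e.im * u.2.im) * formGap m α b z v -
        (e.re * v.2.re + e.im * v.2.im) * formGap m α b z u)) (tubeFrame m v)| ≤
      L * (1 + 2 * |t|) := by
  have hξ : ∀ i, |e.re * (tubeFrame m v i).2.re + e.im * (tubeFrame m v i).2.im| ≤ 1 := by
    intro i
    refine Fin.cases ?_ (Fin.cases ?_ fun i ↦ ?_) i
    · simpa [tubeFrame] using (Complex.abs_re_le_norm e).trans he
    · simpa [tubeFrame] using (Complex.abs_im_le_norm e).trans he
    · simp [tubeFrame]
  have h2 := wedgeOnePow_affine (m + 1) (mixForm m α b z κ)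
    (fun u : 𝔼 × ℂ ↦ e.re * u.2.re + e.im * u.2.im) (formGap m α b z) (mixD m α b z κ)
    (tubeFrame m v) t
  have h3 : |wedgeOnePow (m + 1) (mixForm m α b z κ) (mixD m α b z κ) (tubeFrame m v)| ≤ L :=
    hm1.abs_le (fun i ↦ (hv.abs_mixForm_le hC hρ hz h0 h1 i).trans (by linarith))
      fun i j ↦ (hv.abs_mixD_le hC hρ hz h0 h1 i j).trans (by linarith)
  have h4 : |wedgeOnePow (m + 1) (mixForm m α b z κ) (fun u v ↦ mixD m α b z κ u v +
      ((e.re * u.2.re + e.im * u.2.im) * formGap m α b z v -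
        (e.re * v.2.re + e.im * v.2.im) * formGap m α b z u)) (tubeFrame m v)| ≤ L := by
    refine hm1.abs_le (fun i ↦ (hv.abs_mixForm_le hC hρ hz h0 h1 i).trans (by linarith))
      fun i j ↦ ?_
    have h5 : ∀ i j, |(e.re * (tubeFrame m v i).2.re + e.im * (tubeFrame m v i).2.im) *
        formGap m α b z (tubeFrame m v j)| ≤ 1 * (2 * C) := fun i j ↦ by
      rw [abs_mul]
      exact mul_le_mul (hξ i) (hv.abs_formGap_le hC hρ hz j) (abs_nonneg _) zero_le_one
    exact (abs_add_le _ _).trans (by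
      linarith [hv.abs_mixD_le hC hρ hz h0 h1 i j, h5 i j, h5 j i,
        abs_sub ((e.re * (tubeFrame m v i).2.re + e.im * (tubeFrame m v i).2.im) *
        formGap m α b z (tubeFrame m v j)) ((e.re * (tubeFrame m v j).2.re +
          e.im * (tubeFrame m v j).2.im) * formGap m α b z (tubeFrame m v i))])
  rw [h2]
  refine (abs_add_le _ _).trans ?_
  rw [abs_mul]
  have h6 := (abs_sub _ _).trans (add_le_add h4 h3)
  nlinarith [abs_nonneg t, mul_le_mul_of_nonneg_left h6 (abs_nonneg t)]

end Frame

end UniformEstimates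

/-! ### Choice of the constants and positivity of the two volumes. -/

section Positivity

/-- The constants `c` and `K` are large compared to `1 / r₀`, and `r₀` is small. -/
structure IsTwistConstants (m : ℕ) (C ρ L S r₀ c K : ℝ) : Prop where
  C_pos : 0 < C
  ρ_pos : 0 < ρ
  ρ_lt_one : ρ < 1
  L_pos : 0 < L
  S_pos : 0 < S
  r₀_pos : 0 < r₀
  c_pos : 0 < c
  K_pos : 0 < K
  wedge_binding : IsWedgeLipschitz m (5 * C) L
  wedge_tube : IsWedgeLipschitz (m + 1) (5 * C) L
  ρ_small : L * (C * ρ) ≤ 1 / (2 * C)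
  abs_deriv_stepDown_le : ∀ x, |deriv stepDown x| ≤ S
  r₀_le : 2 * r₀ ≤ ρ
  -- This keeps h ≤ 2, since `dropProfile` is at most 2r₀² for q ≥ 0.
  c_le : c * (2 * r₀ ^ 2) ≤ 1
  -- Against c/C stand two errors on the pages, each with a factor r removed: the lower bound for X,
  -- and the derivative of κ.
  c_large : 4 * (L * C) + 8 * (S * L * C) / r₀ < c / C
  -- K outweighs h V, whose 2-form contains 2rκ', of size at most 4S/r₀.
  K_large : 2 * (L * (1 + 8 * S / r₀)) < K / C
  -- The loss from cutting off f must stay below the volume 1/C of α itself.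
  K_small : (m + 1) * (8 * K * r₀ ^ 2 * S / ρ ^ 2 * L) < 1 / C

/-- Both lower bounds are of order 1/r₀, so c = A/r₀ and K = D/r₀ with A, D independent of r₀
satisfy them once r₀ < 1. The upper bounds involve only c r₀² = A r₀ and K r₀² = D r₀, so r₀ is
chosen last, after ρ'. -/
theorem exists_isTwistConstants (m : ℕ) {C ρ : ℝ} (hC : 0 < C) (hρ : 0 < ρ) (hρ1 : ρ < 1) :
    ∃ ρ' L S r₀ c K, ρ' ≤ ρ ∧ IsTwistConstants m C ρ' L S r₀ c K := by
  obtain ⟨L₁, hL₁, h₁⟩ := exists_isWedgeLipschitz m (5 * C)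
  obtain ⟨L₂, hL₂, h₂⟩ := exists_isWedgeLipschitz (m + 1) (5 * C)
  obtain ⟨S, hS, hS'⟩ := exists_deriv_stepDown_bound
  set L := max L₁ L₂
  have hL : 0 < L := lt_max_of_lt_left hL₁
  set ρ' := min ρ (1 / (2 * C) / (L * C))
  have hρ' : 0 < ρ' := by positivity
  have hρ'1 : ρ' < 1 := (min_le_left _ _).trans_lt hρ1
  set A := C * (4 * (L * C) + 8 * (S * L * C) + 1)
  set D := C * (2 * (L * (1 + 8 * S)) + 1)
  have hA : 0 < A := by positivity
  have hD : 0 < D := by positivity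
  set M := (m + 1) * (8 * D * S / ρ' ^ 2 * L)
  have hM : 0 < M := by positivity
  set r₀ := min (ρ' / 2) (min (1 / (2 * A)) (1 / (2 * (M * C))))
  have hr : 0 < r₀ := by positivity
  have hr1 : r₀ ≤ ρ' / 2 := min_le_left _ _
  have hr2 : r₀ ≤ 1 / (2 * A) := (min_le_right _ _).trans (min_le_left _ _)
  have hr3 : r₀ ≤ 1 / (2 * (M * C)) := (min_le_right _ _).trans (min_le_right _ _)
  have hr4 : r₀ < 1 := by linarith
  have hinv : 1 < 1 / r₀ := (one_lt_div hr).2 hr4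
  refine ⟨ρ', L, S, r₀, A / r₀, D / r₀, min_le_left _ _, ⟨hC, hρ', hρ'1, hL, hS, hr, by positivity,
    by positivity, h₁.mono (le_max_left _ _), h₂.mono (le_max_right _ _), ?_, hS', by linarith, ?_,
    ?_, ?_, ?_⟩⟩
  · have : ρ' ≤ 1 / (2 * C) / (L * C) := min_le_right _ _
    rw [le_div_iff₀ (by positivity)] at this
    linarith
  · rw [le_div_iff₀ (by positivity)] at hr2
    have : A / r₀ * (2 * r₀ ^ 2) = r₀ * (2 * A) := by
      field_simp
    linarith
  · have e1 : A / r₀ / C = (4 * (L * C) + 8 * (S * L * C) + 1) * (1 / r₀) := by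
      simp only [A]
      field_simp
    have e2 : 8 * (S * L * C) / r₀ = 8 * (S * L * C) * (1 / r₀) := by ring
    have e3 : 0 < L * C := by positivity
    rw [e1, e2]
    nlinarith
  · have e1 : D / r₀ / C = (2 * (L * (1 + 8 * S)) + 1) * (1 / r₀) := by
      simp only [D]
      field_simp
    have e2 : 8 * S / r₀ = 8 * S * (1 / r₀) := by ring
    rw [e1, e2]
    nlinarith
  · have e1 : (m + 1) * (8 * (D / r₀) * r₀ ^ 2 * S / ρ' ^ 2 * L) = M * r₀ := by
      simp only [M]
      field_simp
    rw [le_div_iff₀ (by positivity)] at hr3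
    rw [e1, lt_div_iff₀ hC]
    linarith

variable (m : ℕ) {B : Type*} [TopologicalSpace B]
  [ChartedSpace (EuclideanSpace ℝ (Fin (2 * m + 1))) B]

local notation "𝔼" => EuclideanSpace ℝ (Fin (2 * m + 1))

/-- The modification of `α` near `B`. The parameter `s` turns on the twisting, and the parameter `u`
makes the form rotationally symmetric near `B`. -/
def twistedForm (ρ r₀ c K s u : ℝ) (α : OneForm (bindingModel m) (B × ℂ)) :
    OneForm (bindingModel m) (B × ℂ) :=
  interpolatedForm m (fun q ↦ 1 + s * c * dropProfile (r₀ ^ 2) q)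
    (fun q ↦ u * stepDown (2 * (r₀ ^ 2)⁻¹ * q)) (fun q ↦ s * K * twistProfile (r₀ ^ 2) (ρ ^ 2) q) α

variable {m} [IsManifold (𝓡 (2 * m + 1)) ∞ B]

section

variable {α : OneForm (bindingModel m) (B × ℂ)} {C ρ L S r₀ c K : ℝ}

theorem hasDerivAt_twist (hT : IsTwistConstants m C ρ L S r₀ c K) (s u q : ℝ) :
    HasDerivAt (fun q ↦ 1 + s * c * dropProfile (r₀ ^ 2) q)
      (s * c * deriv (dropProfile (r₀ ^ 2)) q) q ∧
    HasDerivAt (fun q ↦ u * stepDown (2 * (r₀ ^ 2)⁻¹ * q))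
      (u * (2 * (r₀ ^ 2)⁻¹ * deriv stepDown (2 * (r₀ ^ 2)⁻¹ * q))) q ∧
    HasDerivAt (fun q ↦ s * K * twistProfile (r₀ ^ 2) (ρ ^ 2) q)
      (s * K * deriv (twistProfile (r₀ ^ 2) (ρ ^ 2)) q) q := by
  have h0 : 0 < r₀ ^ 2 := pow_pos hT.r₀_pos 2
  refine ⟨?_, (hasDerivAt_stepDown_div _ q).const_mul u, ?_⟩
  · exact (((contDiff_dropProfile _).differentiable (by norm_num) q).hasDerivAt.const_mul _).const_add
      1
  · exact ((contDiff_twistProfile h0 _).differentiable (by norm_num) q).hasDerivAt.const_mul _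

theorem one_le_twist (hT : IsTwistConstants m C ρ L S r₀ c K) {s : ℝ} (hs : 0 ≤ s) (q : ℝ) :
    1 ≤ 1 + s * c * dropProfile (r₀ ^ 2) q := by
  have := dropProfile_nonneg (pow_pos hT.r₀_pos 2) q
  have := hT.c_pos
  have : 0 ≤ s * c * dropProfile (r₀ ^ 2) q := by positivity
  linarith

theorem twist_le_two (hT : IsTwistConstants m C ρ L S r₀ c K) {s q : ℝ} (hs : 0 ≤ s) (hs1 : s ≤ 1)
    (hq : 0 ≤ q) : 1 + s * c * dropProfile (r₀ ^ 2) q ≤ 2 := by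
  have h0 : 0 < r₀ ^ 2 := pow_pos hT.r₀_pos 2
  have h1 := mul_le_mul_of_nonneg_left (dropProfile_le h0 hq) hT.c_pos.le
  have h2 := mul_nonneg hT.c_pos.le (dropProfile_nonneg h0 q)
  have h3 := hT.c_le
  nlinarith

theorem step_eq_zero {r₀ r : ℝ} (hr₀ : 0 < r₀) (h : r₀ ≤ r) :
    stepDown (2 * (r₀ ^ 2)⁻¹ * r ^ 2) = 0 ∧ deriv stepDown (2 * (r₀ ^ 2)⁻¹ * r ^ 2) = 0 := by
  have : 2 ≤ 2 * (r₀ ^ 2)⁻¹ * r ^ 2 := by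
    have : 1 ≤ (r₀ ^ 2)⁻¹ * r ^ 2 := by
      rw [le_inv_mul_iff₀ (by positivity), mul_one]
      gcongr
    linarith
  exact ⟨stepDown_eq_zero this, deriv_stepDown_of_ge this⟩

theorem abs_step_deriv_le (hT : IsTwistConstants m C ρ L S r₀ c K) {u : ℝ} (hu : 0 ≤ u)
    (hu1 : u ≤ 1) (x : ℝ) : |u * (2 * (r₀ ^ 2)⁻¹ * deriv stepDown x)| ≤ 2 * (r₀ ^ 2)⁻¹ * S := by
  have := hT.r₀_pos
  rw [abs_mul, abs_mul, abs_of_nonneg hu, abs_of_pos (show 0 < 2 * (r₀ ^ 2)⁻¹ by positivity)]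
  refine (mul_le_of_le_one_left (by positivity) hu1).trans ?_
  exact mul_le_mul_of_nonneg_left (hT.abs_deriv_stepDown_le x) (by positivity)

theorem IsTwistConstants.half_le_mixVolume (hT : IsTwistConstants m C ρ L S r₀ c K) {b : B}
    {v : Fin (2 * m + 1) → 𝔼} (hv : IsUniformFrame m α C ρ b v) {z : ℂ} (hz : ‖z‖ ≤ ρ)
    {κ : ℝ} (h0 : 0 ≤ κ) (h1 : κ ≤ 1) :
    1 / (2 * C) ≤ wedgeOnePow m (mixForm m α b z κ) (mixD m α b z κ) fun i ↦ (v i, 0) := by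
  have h2 := hv.le_mixVolume hT.C_pos hT.ρ_pos.le hz hT.L_pos hT.wedge_binding h0 h1
  have h3 : L * (C * ‖z‖) ≤ L * (C * ρ) := by
    have := hT.C_pos
    have := hT.L_pos
    gcongr
  have h4 : 1 / C = 1 / (2 * C) + 1 / (2 * C) := by
    have := hT.C_pos
    field_simp
    norm_num
  linarith [hT.ρ_small]

/-- Where κ vanishes, the terms with X and with -h' have the right sign. Where κ is active, s = 1
and -h' = c, and 2r c N ≥ (c/C) r beats both error terms, which are linear in r. -/
theorem pageVolume_twistedForm_pos (hα : OneForm.SmoothOn (bindingModel m) α (solidTube B 1))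
    (hT : IsTwistConstants m C ρ L S r₀ c K) {b : B} {v : Fin (2 * m + 1) → 𝔼}
    (hv : IsUniformFrame m α C ρ b v) {e : ℂ} (he : ‖e‖ = 1)
    (hpage : ∀ r : ℝ, 0 < r → r ≤ 1 → 0 < pageVolume m α b (r * e) e v) {s u : ℝ}
    (hs : s ∈ Icc (0 : ℝ) 1) (hu : u ∈ Icc (0 : ℝ) 1) (hsu : u = 0 ∨ s = 1) {r : ℝ} (hr : 0 < r)
    (hr1 : r ≤ 1) : 0 < pageVolume m (twistedForm m ρ r₀ c K s u α) b (r * e) e v := by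
  obtain ⟨d1, d2, d3⟩ := hasDerivAt_twist hT s u (r ^ 2)
  have hr₀ := hT.r₀_pos
  have hC := hT.C_pos
  have hL := hT.L_pos
  have hS := hT.S_pos
  have hc := hT.c_pos
  have h0 : 0 < r₀ ^ 2 := by positivity
  have hn : ‖(r : ℂ) * e‖ = r := by
    rw [norm_mul, he, mul_one, Complex.norm_real, Real.norm_of_nonneg hr.le]
  rw [twistedForm, pageVolume_interpolatedForm hα b he hr.le hr1 d1 d2 d3]
  have hh := one_le_twist hT hs.1 (r ^ 2)
  refine mul_pos (by positivity) ?_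
  have hκ0 : 0 ≤ u * stepDown (2 * (r₀ ^ 2)⁻¹ * r ^ 2) := mul_nonneg hu.1 (stepDown_nonneg _)
  have hκ1 : u * stepDown (2 * (r₀ ^ 2)⁻¹ * r ^ 2) ≤ 1 :=
    mul_le_one₀ hu.2 (stepDown_nonneg _) (stepDown_le_one _)
  -- The cut-off in κ vanishes to first order from r = r₀ on, so either condition gives κ = κ' = 0.
  by_cases hA : u = 0 ∨ r₀ ≤ r
  · have hz : u * stepDown (2 * (r₀ ^ 2)⁻¹ * r ^ 2) = 0 ∧
        u * (2 * (r₀ ^ 2)⁻¹ * deriv stepDown (2 * (r₀ ^ 2)⁻¹ * r ^ 2)) = 0 := by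
      rcases hA with h | h
      · simp [h]
      · simp [step_eq_zero hr₀ h]
    rw [hz.1, hz.2, mixD_zero]
    have hX := hpage r hr hr1
    rw [pageVolume] at hX
    have hN : s * c * deriv (dropProfile (r₀ ^ 2)) (r ^ 2) *
        wedgeOnePow m (mixForm m α b (r * e) 0) (dTube m α (b, r * e)) (fun i ↦ (v i, 0)) ≤ 0 := by
      rcases le_or_gt r ρ with h | h
      · have h1 := hT.half_le_mixVolume hv (z := r * e) (by rwa [hn]) le_rfl zero_le_one
        rw [mixD_zero] at h1
        have h2 : 0 < 1 / (2 * C) := by positivity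
        exact mul_nonpos_of_nonpos_of_nonneg (mul_nonpos_of_nonneg_of_nonpos
          (mul_nonneg hs.1 hc.le) (deriv_dropProfile_nonpos h0 _)) (by linarith)
      -- Beyond ρ there is no lower bound for N, but h is constant there because 2r₀² ≤ ρ².
      · rw [deriv_dropProfile_of_ge h0 (by nlinarith [hT.r₀_le])]
        simp
    have h3 := mul_pos (zero_lt_one.trans_le hh) hX
    nlinarith
  · push Not at hA
    have hs1 := hsu.resolve_left hA.1
    have hrρ : r ≤ ρ := by linarith [hT.r₀_le]
    have hN := hT.half_le_mixVolume hv (z := r * e) (by rwa [hn]) hκ0 hκ1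
    have hX := hv.le_radialVolume hC hT.ρ_pos.le (z := r * e) (by rwa [hn]) hL hT.wedge_binding
      hT.ρ_pos hT.ρ_lt_one.le hκ0 hκ1 he hpage
    have hD := hv.abs_gapVolume_le hC hT.ρ_pos.le (z := r * e) (by rwa [hn]) hL hT.wedge_binding
      hκ0 hκ1
    rw [hn] at hX hD
    have hκ' := abs_step_deriv_le hT hu.1 hu.2 (2 * (r₀ ^ 2)⁻¹ * r ^ 2)
    have hdd := deriv_dropProfile_of_le h0 (q := r ^ 2) (by
      have := hA.2
      gcongr)
    have hh2 := twist_le_two hT hs.1 hs.2 (sq_nonneg r)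
    rw [hdd, hs1]
    rw [hs1] at hh hh2
    generalize u * (2 * (r₀ ^ 2)⁻¹ * deriv stepDown (2 * (r₀ ^ 2)⁻¹ * r ^ 2)) = κ' at *
    generalize u * stepDown (2 * (r₀ ^ 2)⁻¹ * r ^ 2) = κ at *
    generalize 1 + 1 * c * dropProfile (r₀ ^ 2) (r ^ 2) = h at *
    generalize (wedgeOnePow m (mixForm m α b (r * e) κ) (mixD m α b (r * e) κ) fun i ↦ (v i, 0)) = N
      at *
    generalize (wedgeOnePow m (fun u ↦ -dTube m α (b, r * e) (0, e) u) (mixD m α b (r * e) κ)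
      fun i ↦ (v i, 0)) = X at *
    generalize (wedgeOnePow m (formGap m α b (r * e)) (mixD m α b (r * e) κ) fun i ↦ (v i, 0)) = D
      at *
    have e1 : -(4 * (L * C) * r) ≤ h * (1 - κ) * X := by
      have h1 : 0 ≤ h * (1 - κ) := mul_nonneg (by linarith) (by linarith)
      have h2 : h * (1 - κ) ≤ 2 := by nlinarith
      have h3 : 0 ≤ L * (2 * C * r) := by positivity
      have h4 := mul_le_mul_of_nonneg_left hX h1
      nlinarith
    -- |κ'| ≤ 2S/r₀² and |D| ≤ L C r give a quadratic bound in r/r₀, and r < r₀ turns it into a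
    -- linear one.
    have e2 : |2 * r * h * κ' * D| ≤ 8 * (S * L * C) / r₀ * r := by
      have h1 : |2 * r * h * κ' * D| ≤ 2 * r * 2 * (2 * (r₀ ^ 2)⁻¹ * S) * (L * (C * r)) := by
        rw [abs_mul, abs_mul, abs_of_nonneg (show 0 ≤ 2 * r * h by positivity)]
        gcongr
      have h2 : 2 * r * 2 * (2 * (r₀ ^ 2)⁻¹ * S) * (L * (C * r)) =
          8 * (S * L * C) / r₀ * r * (r / r₀) := by
        field_simp
        ring
      have h3 : r / r₀ ≤ 1 := (div_le_one hr₀).2 hA.2.le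
      rw [h2] at h1
      exact h1.trans (mul_le_of_le_one_right (by positivity) h3)
    have e3 : c / C * r ≤ 2 * r * c * N := by
      have h1 : c / C * r = 2 * r * c * (1 / (2 * C)) := by
        field_simp
      rw [h1]
      gcongr
    have e4 := mul_lt_mul_of_pos_right hT.c_large hr
    have e5 := (abs_le.1 e2).2
    nlinarith

/-- The term f r · (page volume) is nonnegative by the previous result. Where κ vanishes, the volume
of α outweighs the small negative part of (q f)'; where κ is active, (q f)' = K outweighs everything
else. -/
theorem tubeVolume_twistedForm_pos (hα : OneForm.SmoothOn (bindingModel m) α (solidTube B 1))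
    (hT : IsTwistConstants m C ρ L S r₀ c K) {b : B} {v : Fin (2 * m + 1) → 𝔼}
    (hv : IsUniformFrame m α C ρ b v) {e : ℂ} (he : ‖e‖ = 1)
    (hpage : ∀ r : ℝ, 0 < r → r ≤ 1 → 0 < pageVolume m α b (r * e) e v)
    (hvol : ∀ z : ℂ, ‖z‖ ≤ 1 → 0 < tubeVolume m α (b, z) (tubeFrame m v)) {s u : ℝ}
    (hs : s ∈ Icc (0 : ℝ) 1) (hu : u ∈ Icc (0 : ℝ) 1) (hsu : u = 0 ∨ s = 1) {r : ℝ} (hr : 0 ≤ r)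
    (hr1 : r ≤ 1) :
    0 < tubeVolume m (twistedForm m ρ r₀ c K s u α) (b, r * e) (tubeFrame m v) := by
  obtain ⟨d1, d2, d3⟩ := hasDerivAt_twist hT s u (r ^ 2)
  have hr₀ := hT.r₀_pos
  have hC := hT.C_pos
  have hL := hT.L_pos
  have hS := hT.S_pos
  have hK := hT.K_pos
  have hρ := hT.ρ_pos
  have h0 : 0 < r₀ ^ 2 := by positivity
  have hQ0 : 0 < ρ ^ 2 := by positivity
  have hQ : 2 * r₀ ^ 2 ≤ ρ ^ 2 := by nlinarith [hT.r₀_le]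
  have hn : ‖(r : ℂ) * e‖ = r := by
    rw [norm_mul, he, mul_one, Complex.norm_real, Real.norm_of_nonneg hr]
  have hP : 0 ≤ s * K * twistProfile (r₀ ^ 2) (ρ ^ 2) (r ^ 2) * r *
      ((m + 1) * pageVolume m (twistedForm m ρ r₀ c K s u α) b (r * e) e v) := by
    rcases hr.eq_or_lt with h | h
    · rw [← h]
      simp
    · have h1 := pageVolume_twistedForm_pos hα hT hv he hpage hs hu hsu h hr1
      have h2 := twistProfile_nonneg h0 (ρ ^ 2) (r ^ 2)
      have h3 := hs.1
      positivity
  have key := tubeVolume_interpolatedForm hα b he hr hr1 d1 d2 d3 v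
  rw [← twistedForm] at key
  rw [key]
  refine add_pos_of_pos_of_nonneg ?_ hP
  clear hP key d1 d2 d3
  have hh := one_le_twist hT hs.1 (r ^ 2)
  have hκ0 : 0 ≤ u * stepDown (2 * (r₀ ^ 2)⁻¹ * r ^ 2) := mul_nonneg hu.1 (stepDown_nonneg _)
  have hκ1 : u * stepDown (2 * (r₀ ^ 2)⁻¹ * r ^ 2) ≤ 1 :=
    mul_le_one₀ hu.2 (stepDown_nonneg _) (stepDown_le_one _)
  -- Both remaining terms contain h^(m+1), so only h V + (m+1) g N has to be positive.
  have factor : ∀ h V g N : ℝ, 1 ≤ h → 0 < h * V + (m + 1) * g * N →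
      0 < h ^ (m + 2) * V + (m + 1) * g * (h ^ (m + 1) * N) := by
    intro h V g N h1 h2
    have : h ^ (m + 2) * V + (m + 1) * g * (h ^ (m + 1) * N) =
        h ^ (m + 1) * (h * V + (m + 1) * g * N) := by ring
    rw [this]
    positivity
  refine factor _ _ _ _ hh ?_
  by_cases hA : u = 0 ∨ r₀ ≤ r
  · have hz : u * stepDown (2 * (r₀ ^ 2)⁻¹ * r ^ 2) = 0 ∧
        u * (2 * (r₀ ^ 2)⁻¹ * deriv stepDown (2 * (r₀ ^ 2)⁻¹ * r ^ 2)) = 0 := by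
      rcases hA with h | h
      · simp [h]
      · simp [step_eq_zero hr₀ h]
    rw [hz.1, hz.2, mixD_zero, mixForm_zero]
    simp only [zero_mul, add_zero]
    change 0 < _ * tubeVolume m α (b, r * e) (tubeFrame m v) + _
    rcases le_or_gt r ρ with h | h
    · have h1 := hT.half_le_mixVolume hv (z := r * e) (by rwa [hn]) le_rfl zero_le_one
      have h2 := hv.abs_mixVolume_le hC hρ.le (z := r * e) (by rwa [hn]) hL hT.wedge_binding
        le_rfl zero_le_one
      rw [mixD_zero, mixForm_zero] at h1 h2
      have h3 := hv.volume (r * e) (by rwa [hn])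
      have h4 := twistProfile_add_mul_deriv_ge h0 hQ0 (sq_nonneg r) hT.abs_deriv_stepDown_le
      have h5 := hT.K_small
      generalize (wedgeOnePow m (covectorAt m α (b, r * e)) (dTube m α (b, r * e))
        fun i ↦ (v i, 0)) = N at *
      generalize tubeVolume m α (b, r * e) (tubeFrame m v) = V at *
      generalize 1 + s * c * dropProfile (r₀ ^ 2) (r ^ 2) = h at *
      have hN0 : 0 ≤ N := by
        have : 0 < 1 / (2 * C) := by positivity
        linarith
      have hNL := (abs_le.1 h2).2
      have e1 : -(8 * K * r₀ ^ 2 * S / ρ ^ 2) ≤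
          2 * (s * K * twistProfile (r₀ ^ 2) (ρ ^ 2) (r ^ 2) +
            r ^ 2 * (s * K * deriv (twistProfile (r₀ ^ 2) (ρ ^ 2)) (r ^ 2))) := by
        have e2 : 0 ≤ 2 * (s * K) := mul_nonneg zero_le_two (mul_nonneg hs.1 hK.le)
        have e3 := mul_le_mul_of_nonneg_left h4 e2
        have e4 : 2 * (s * K) * (4 * r₀ ^ 2 * S / ρ ^ 2) ≤ 8 * K * r₀ ^ 2 * S / ρ ^ 2 := by
          have : 2 * (s * K) * (4 * r₀ ^ 2 * S / ρ ^ 2) = s * (8 * K * r₀ ^ 2 * S / ρ ^ 2) := by ring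
          rw [this]
          exact mul_le_of_le_one_left (by positivity) hs.2
        linarith
      generalize 2 * (s * K * twistProfile (r₀ ^ 2) (ρ ^ 2) (r ^ 2) +
            r ^ 2 * (s * K * deriv (twistProfile (r₀ ^ 2) (ρ ^ 2)) (r ^ 2))) = g at *
      have e5 : -(8 * K * r₀ ^ 2 * S / ρ ^ 2 * L) ≤ g * N := by
        have e6 := mul_le_mul_of_nonneg_right e1 hN0
        have e7 : 8 * K * r₀ ^ 2 * S / ρ ^ 2 * N ≤ 8 * K * r₀ ^ 2 * S / ρ ^ 2 * L := by gcongr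
        linarith
      have e8 : V ≤ h * V := le_mul_of_one_le_left ((by positivity : (0:ℝ) ≤ 1 / C).trans h3) hh
      have e9 := mul_le_mul_of_nonneg_left e5 (by positivity : (0 : ℝ) ≤ m + 1)
      linarith
    -- Outside radius ρ the rotation term is gone, and adaptedness of α replaces the frame
    -- estimates.
    · have hq : ρ ^ 2 ≤ r ^ 2 := by gcongr
      rw [twistProfile_of_ge hQ0 hq, deriv_twistProfile_of_ge h0 hQ0 hq]
      have h1 := hvol (r * e) (by rwa [hn])
      simp only [mul_zero, add_zero, zero_mul]
      exact mul_pos (by linarith) h1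
  · push Not at hA
    have hs1 := hsu.resolve_left hA.1
    have hrρ : r ≤ ρ := by linarith [hT.r₀_le]
    have hlt : r ^ 2 < r₀ ^ 2 := by
      have := hA.2
      gcongr
    have hN := hT.half_le_mixVolume hv (z := r * e) (by rwa [hn]) hκ0 hκ1
    have hκ' := abs_step_deriv_le hT hu.1 hu.2 (2 * (r₀ ^ 2)⁻¹ * r ^ 2)
    have hh2 := twist_le_two hT hs.1 hs.2 (sq_nonneg r)
    have hV := hv.abs_gapTwistVolume_le hC hT.ρ_pos.le (z := r * e) (by rwa [hn]) hL
      hT.wedge_tube hκ0 hκ1 he.le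
      (2 * r * (u * (2 * (r₀ ^ 2)⁻¹ * deriv stepDown (2 * (r₀ ^ 2)⁻¹ * r ^ 2))))
    rw [twistProfile_of_le h0 hQ hlt.le, deriv_twistProfile_of_le h0 hQ hlt, hs1]
    rw [hs1] at hh hh2
    generalize u * (2 * (r₀ ^ 2)⁻¹ * deriv stepDown (2 * (r₀ ^ 2)⁻¹ * r ^ 2)) = κ' at *
    generalize u * stepDown (2 * (r₀ ^ 2)⁻¹ * r ^ 2) = κ at *
    generalize 1 + 1 * c * dropProfile (r₀ ^ 2) (r ^ 2) = h at *
    generalize (wedgeOnePow m (mixForm m α b (r * e) κ) (mixD m α b (r * e) κ) fun i ↦ (v i, 0)) = N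
      at *
    have hfun : (fun u v : 𝔼 × ℂ ↦ mixD m α b (r * e) κ u v +
          κ' * ((2 * r * (e.re * u.2.re + e.im * u.2.im)) * formGap m α b (r * e) v -
          (2 * r * (e.re * v.2.re + e.im * v.2.im)) * formGap m α b (r * e) u)) =
        fun u v ↦ mixD m α b (r * e) κ u v +
          (2 * r * κ') * ((e.re * u.2.re + e.im * u.2.im) * formGap m α b (r * e) v -
          (e.re * v.2.re + e.im * v.2.im) * formGap m α b (r * e) u) := by
      ext u v
      ring
    rw [hfun]
    generalize (wedgeOnePow (m + 1) (mixForm m α b (r * e) κ) (fun u v ↦ mixD m α b (r * e) κ u v +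
          (2 * r * κ') * ((e.re * u.2.re + e.im * u.2.im) * formGap m α b (r * e) v -
          (e.re * v.2.re + e.im * v.2.im) * formGap m α b (r * e) u)) (tubeFrame m v)) = V at *
    have ht : |2 * r * κ'| ≤ 4 * S / r₀ := by
      have h1 : |2 * r * κ'| ≤ 2 * r * (2 * (r₀ ^ 2)⁻¹ * S) := by
        rw [abs_mul, abs_of_nonneg (show 0 ≤ 2 * r by positivity)]
        gcongr
      have h2 : 2 * r * (2 * (r₀ ^ 2)⁻¹ * S) = 4 * S / r₀ * (r / r₀) := by
        field_simp
        ring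
      have h3 : r / r₀ ≤ 1 := (div_le_one hr₀).2 hA.2.le
      rw [h2] at h1
      exact h1.trans (mul_le_of_le_one_right (by positivity) h3)
    have hV2 : |V| ≤ L * (1 + 8 * S / r₀) := by
      refine hV.trans (mul_le_mul_of_nonneg_left ?_ hL.le)
      have : 8 * S / r₀ = 2 * (4 * S / r₀) := by ring
      rw [this]
      linarith
    have e1 : -(2 * (L * (1 + 8 * S / r₀))) ≤ h * V := by
      have h1 : |h * V| ≤ 2 * (L * (1 + 8 * S / r₀)) := by
        rw [abs_mul, abs_of_nonneg (by linarith)]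
        exact mul_le_mul hh2 hV2 (abs_nonneg _) zero_le_two
      exact (abs_le.1 h1).1
    have e2 : K / C ≤ (m + 1) * (2 * K) * N := by
      have h1 : K / C = 2 * K * (1 / (2 * C)) := by
        field_simp
      have h2 : 2 * K * (1 / (2 * C)) ≤ 2 * K * N := by gcongr
      have h3 : 0 ≤ 2 * K * N := h2.trans' (by positivity)
      have h4 : (0 : ℝ) ≤ m := Nat.cast_nonneg m
      rw [h1]
      nlinarith
    have e3 := hT.K_large
    simp only [mul_one, one_mul, mul_zero, add_zero]
    linarith

end

end Positivity

/-! ### Adaptedness from the sign of the volumes in one frame. -/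

section Adapted

/-- The block matrix `diag(1, A)`. -/
def consOneMatrix {N : ℕ} (A : Matrix (Fin N) (Fin N) ℝ) : Matrix (Fin (N + 1)) (Fin (N + 1)) ℝ :=
  Matrix.of (Fin.cons (Fin.cons 1 0) fun i ↦ Fin.cons 0 (A i))

theorem det_consOneMatrix {N : ℕ} (A : Matrix (Fin N) (Fin N) ℝ) :
    (consOneMatrix A).det = A.det := by
  rw [Matrix.det_succ_row_zero, Fin.sum_univ_succ]
  have h : (consOneMatrix A).submatrix Fin.succ Fin.succ = A := by
    ext i j
    simp [consOneMatrix]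
  simp only [Fin.succAbove_zero, h]
  simp [consOneMatrix]

theorem cons_eq_consOneMatrix_sum {V : Type*} [AddCommGroup V] [Module ℝ V] {N : ℕ}
    {A : Matrix (Fin N) (Fin N) ℝ} {u v : Fin N → V} (h : ∀ i, v i = ∑ j, A i j • u j) (e : V)
    (i : Fin (N + 1)) : (Fin.cons e v : Fin (N + 1) → V) i =
      ∑ j, consOneMatrix A i j • (Fin.cons e u : Fin (N + 1) → V) j := by
  rw [Fin.sum_univ_succ]
  refine Fin.cases ?_ (fun i ↦ ?_) i
  · simp [consOneMatrix]
  · simp [consOneMatrix, h]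

theorem exists_matrix_of_linearIndependent {V : Type*} [AddCommGroup V] [Module ℝ V] {N : ℕ}
    (hN : 0 < N) (hV : Module.finrank ℝ V = N) {u : Fin N → V} (hu : LinearIndependent ℝ u)
    (v : Fin N → V) : ∃ A : Matrix (Fin N) (Fin N) ℝ, ∀ i, v i = ∑ j, A i j • u j := by
  have : Nonempty (Fin N) := ⟨⟨0, hN⟩⟩
  let b := basisOfLinearIndependentOfCardEqFinrank hu (by rw [hV, Fintype.card_fin])
  refine ⟨Matrix.of fun i j ↦ b.repr (v i) j, fun i ↦ ?_⟩
  have := b.sum_repr (v i)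
  simpa [b, eq_comm] using this

variable {m : ℕ} {B : Type*} [TopologicalSpace B]
  [ChartedSpace (EuclideanSpace ℝ (Fin (2 * m + 1))) B]

local notation "𝔼" => EuclideanSpace ℝ (Fin (2 * m + 1))

theorem tubeVolume_tubeFrame_eq_mul (α : OneForm (bindingModel m) (B × ℂ)) (p : B × ℂ)
    {u v : Fin (2 * m + 1) → 𝔼} {A : Matrix (Fin (2 * m + 1)) (Fin (2 * m + 1)) ℝ}
    (hv : ∀ i, v i = ∑ j, A i j • u j) :
    tubeVolume m α p (tubeFrame m v) = A.det * tubeVolume m α p (tubeFrame m u) := by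
  have h1 : ∀ i, ((v i, 0) : 𝔼 × ℂ) = ∑ j, A i j • ((u j, 0) : 𝔼 × ℂ) := fun i ↦ by
    simp [Prod.ext_iff, Prod.fst_sum, Prod.snd_sum, hv i]
  have h2 := tubeVolume_eq_mul α p (v := tubeFrame m v) (u := tubeFrame m u)
    (consOneMatrix (consOneMatrix A))
    (cons_eq_consOneMatrix_sum (cons_eq_consOneMatrix_sum h1 (0, Complex.I)) (0, 1))
  rw [h2]
  congr 1
  exact (det_consOneMatrix _).trans (det_consOneMatrix _)

theorem pageVolume_eq_mul (α : OneForm (bindingModel m) (B × ℂ)) (b : B) (z e : ℂ)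
    {u v : Fin (2 * m + 1) → 𝔼} {A : Matrix (Fin (2 * m + 1)) (Fin (2 * m + 1)) ℝ}
    (hv : ∀ i, v i = ∑ j, A i j • u j) :
    pageVolume m α b z e v = A.det * pageVolume m α b z e u := by
  refine wedgeOnePow_update_eq_mul ?_ (isLinearMap_dTube_left m α (b, z))
    (isLinearMap_dTube_right m α (b, z)) A fun i ↦ by
      simp [Prod.ext_iff, Prod.fst_sum, Prod.snd_sum, hv i]
  exact (-((isLinearMap_dTube_right m α (b, z) (0, e)).mk' _)).isLinear

/-- The frame (-∂_r, v) spans the tangent space of the page, so any kernel vector is a combination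
of it and `eq_zero_of_wedgePow_ne_zero` applies. -/
theorem pageForm_nondegenerate {α : OneForm (bindingModel m) (B × ℂ)} {θ : ℝ} {b : B} {r : ℝ}
    {v : Fin (2 * m + 1) → 𝔼} (hv : LinearIndependent ℝ v)
    (hpos : wedgePow (m + 1) (pageForm m α θ b r)
      (Fin.cons ((0, -1) : 𝔼 × ℝ) fun i ↦ ((v i, 0) : 𝔼 × ℝ)) ≠ 0)
    (x : 𝔼 × ℝ) (hx : ∀ y, pageForm m α θ b r x y = 0) : x = 0 := by
  let T : 𝔼 × ℝ →ₗ[ℝ] 𝔼 × ℂ := LinearMap.prodMap LinearMap.id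
    (LinearMap.toSpanSingleton ℝ ℂ (Complex.exp (θ * Complex.I)))
  have hT : pageForm m α θ b r = fun x y ↦ dTube m α
      (b, (r : ℂ) * Complex.exp (θ * Complex.I)) (T x) (T y) := by
    ext x y
    simp [pageForm, dTube, T]
  have hw₁ : ∀ y, IsLinearMap ℝ fun x ↦ pageForm m α θ b r x y := fun y ↦ by
    rw [hT]
    exact ((isLinearMap_dTube_left m α _ (T y)).mk' _ ∘ₗ T).isLinear
  have hw₂ : ∀ x, IsLinearMap ℝ (pageForm m α θ b r x) := fun x ↦ by
    rw [hT]
    exact ((isLinearMap_dTube_right m α _ (T x)).mk' _ ∘ₗ T).isLinear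
  obtain ⟨A, hA⟩ := exists_matrix_of_linearIndependent (by omega) (by simp) hv fun _ ↦ x.1
  have hsum : x = ∑ i, (Fin.cons (-x.2) (A 0) : Fin (2 * m + 1 + 1) → ℝ) i •
      (Fin.cons ((0, -1) : 𝔼 × ℝ) fun i ↦ ((v i, 0) : 𝔼 × ℝ) : Fin (2 * m + 1 + 1) → 𝔼 × ℝ) i := by
    rw [Fin.sum_univ_succ]
    simp only [Fin.cons_zero, Fin.cons_succ]
    refine Prod.ext ?_ ?_
    · simpa [Prod.fst_sum] using hA 0
    · simp [Prod.snd_sum]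
  have hc := eq_zero_of_wedgePow_ne_zero hw₁ hw₂ (fun x y ↦ dTube_skew m α _ _ _) hpos
    (Fin.cons (-x.2) (A 0) : Fin (2 * m + 1 + 1) → ℝ) fun y ↦ by
      refine (congrArg (fun x ↦ pageForm m α θ b r x y) hsum).symm.trans (hx y)
  rw [hsum]
  exact Finset.sum_eq_zero fun i _ ↦ by
    rw [congrFun hc i]
    simp

variable [IsManifold (𝓡 (2 * m + 1)) ∞ B]

theorem pageVolume_pos {α : OneForm (bindingModel m) (B × ℂ)} (hα : IsAdaptedContactForm m α)
    {b : B} {v : Fin (2 * m + 1) → 𝔼} (hv : 0 < bindingVolume m α b v) {e : ℂ} (he : ‖e‖ = 1)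
    {r : ℝ} (hr : 0 < r) (hr1 : r ≤ 1) : 0 < pageVolume m α b (r * e) e v := by
  obtain ⟨θ, rfl⟩ := (Complex.norm_eq_one_iff e).1 he
  have h := hα.page_boundary θ b r hr hr1 v ((isPositiveBindingFrame_iff hα.contact.smooth b v).2 hv)
  rw [wedgePow_pageForm] at h
  exact pos_of_mul_pos_right h (by positivity)

theorem tubeVolume_pos {α : OneForm (bindingModel m) (B × ℂ)} (hα : IsAdaptedContactForm m α)
    {b : B} {v : Fin (2 * m + 1) → 𝔼} (hv : 0 < bindingVolume m α b v) {z : ℂ} (hz : ‖z‖ ≤ 1) :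
    0 < tubeVolume m α (b, z) (tubeFrame m v) :=
  hα.positive (b, z) (by simpa [solidTube] using hz) v
    ((isPositiveBindingFrame_iff hα.contact.smooth b v).2 hv)

theorem smoothOn_of_restrictBinding_eq_smul {α β : OneForm (bindingModel m) (B × ℂ)} {c : ℝ}
    (hα : OneForm.SmoothOn (𝓡 (2 * m + 1)) (restrictBinding m α) univ)
    (h : ∀ b, restrictBinding m β b = c • restrictBinding m α b) :
    OneForm.SmoothOn (𝓡 (2 * m + 1)) (restrictBinding m β) univ := by
  intro b hb
  have h1 := (contMDiffWithinAt_oneForm_iff (𝓡 (2 * m + 1)) (𝓡 (2 * m + 1)) id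
    (restrictBinding m α) univ b b (mem_chart_source _ b)).1 (hα b hb)
  refine (contMDiffWithinAt_oneForm_iff (𝓡 (2 * m + 1)) (𝓡 (2 * m + 1)) id
    (restrictBinding m β) univ b b (mem_chart_source _ b)).2 ⟨h1.1, ?_⟩
  have h2 : ContDiff ℝ ∞ fun x : 𝔼 →L[ℝ] ℝ ↦ c • x := contDiff_const_smul c
  refine (h2.contDiffAt.comp_contMDiffWithinAt h1.2).congr (fun y _ ↦ ?_) ?_
  · simp only [id, h]
    rfl
  · simp only [id, h]
    rfl

/-- One frame over each b suffices. Along B the contact volume is multiplied by c^(m+1) > 0, so α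
and β induce the same orientation; any other positive frame differs by a matrix of positive
determinant, which scales all volumes of β. -/
theorem isAdaptedContactForm_of_volumes {α β : OneForm (bindingModel m) (B × ℂ)}
    (hα : IsAdaptedContactForm m α) (hβ : OneForm.SmoothOn (bindingModel m) β (solidTube B 1))
    {c : ℝ} (hc : 0 < c) (hres : ∀ b, restrictBinding m β b = c • restrictBinding m α b)
    (hd : ∀ b u w, dTube m β (b, 0) (u, 0) (w, 0) = c * dTube m α (b, 0) (u, 0) (w, 0))
    (hvol : ∀ b, ∃ v, 0 < bindingVolume m α b v ∧
      (∀ z : ℂ, ‖z‖ ≤ 1 → 0 < tubeVolume m β (b, z) (tubeFrame m v)) ∧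
      ∀ e : ℂ, ‖e‖ = 1 → ∀ r : ℝ, 0 < r → r ≤ 1 → 0 < pageVolume m β b (r * e) e v) :
    IsAdaptedContactForm m β := by
  have hB : ∀ b v, bindingVolume m β b v = c * (c ^ m * bindingVolume m α b v) := by
    intro b v
    have h1 := wedgeOnePow_linear_left m c 0 (fun u : 𝔼 ↦ covectorAt m α (b, 0) (u, 0)) (fun _ ↦ 0)
      (fun u w : 𝔼 ↦ dTube m α (b, 0) (u, 0) (w, 0)) v
    have h2 : bindingVolume m β b v = wedgeOnePow m
        (fun u : 𝔼 ↦ c * covectorAt m α (b, 0) (u, 0) + 0 * 0)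
        (fun u w : 𝔼 ↦ c * dTube m α (b, 0) (u, 0) (w, 0)) v := by
      refine wedgeOnePow_congr (fun i ↦ ?_) fun i j ↦ hd b _ _
      have h2 := congrArg (fun a : 𝔼 →L[ℝ] ℝ ↦ a (v i)) (hres b)
      rw [zero_mul, add_zero]
      exact h2
    rw [h2, wedgeOnePow_smul_right, h1, bindingVolume]
    ring
  have hdet : ∀ b v v', 0 < bindingVolume m α b v → IsPositiveBindingFrame m β b v' →
      ∃ A : Matrix (Fin (2 * m + 1)) (Fin (2 * m + 1)) ℝ, 0 < A.det ∧
        ∀ i, v' i = ∑ j, A i j • v j := by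
    intro b v v' hv hv'
    obtain ⟨A, hA⟩ := exists_matrix_of_linearIndependent (by omega) (by simp)
      (linearIndependent_of_bindingVolume_ne_zero hv.ne') v'
    refine ⟨A, ?_, hA⟩
    rw [isPositiveBindingFrame_iff hβ, hB, bindingVolume_eq_mul α b A hA] at hv'
    have h1 := pos_of_mul_pos_right (pos_of_mul_pos_right hv' hc.le) (by positivity)
    exact pos_of_mul_pos_left h1 hv.le
  refine ⟨⟨hβ, ?_⟩, ?_, ⟨smoothOn_of_restrictBinding_eq_smul hα.binding_contact.smooth hres, ?_⟩,
    ?_, ?_⟩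
  · rintro ⟨b, z⟩ hz
    obtain ⟨v, -, hv, -⟩ := hvol b
    exact ⟨tubeFrame m v, (hv z (by simpa [solidTube] using hz)).ne'⟩
  · rintro ⟨b, z⟩ hz v' hv'
    obtain ⟨v, hv0, hv, -⟩ := hvol b
    obtain ⟨A, hA, hAv⟩ := hdet b v v' hv0 hv'
    have h1 := tubeVolume_tubeFrame_eq_mul β (b, z) hAv
    have h2 := mul_pos hA (hv z (by simpa [solidTube] using hz))
    rw [← h1] at h2
    exact h2
  · intro b _
    obtain ⟨v, hv0, -⟩ := hvol b
    refine ⟨v, ?_⟩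
    have h1 := contactVolume_restrictBinding hβ b v
    refine ne_of_eq_of_ne h1 ?_
    rw [hB]
    positivity
  · intro θ b r hr hr1
    obtain ⟨v, hv0, -, hv⟩ := hvol b
    refine pageForm_nondegenerate (linearIndependent_of_bindingVolume_ne_zero hv0.ne') ?_
    rw [wedgePow_pageForm]
    have := hv _ (Complex.norm_exp_ofReal_mul_I θ) r hr hr1
    positivity
  · intro θ b r hr hr1 v' hv'
    obtain ⟨v, hv0, -, hv⟩ := hvol b
    obtain ⟨A, hA, hAv⟩ := hdet b v v' hv0 hv'
    rw [wedgePow_pageForm, pageVolume_eq_mul β b _ _ hAv]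
    have := hv _ (Complex.norm_exp_ofReal_mul_I θ) r hr hr1
    positivity

end Adapted

/-! ### Joint smoothness in the parameter and the point. -/

section Family

variable {m : ℕ} {B : Type*} [TopologicalSpace B]
  [ChartedSpace (EuclideanSpace ℝ (Fin (2 * m + 1))) B] [IsManifold (𝓡 (2 * m + 1)) ∞ B]

local notation "𝔼" => EuclideanSpace ℝ (Fin (2 * m + 1))

theorem contMDiffAt_familyChart (b₀ : B) (x : ℝ × (B × ℂ))
    (hx : x.2.1 ∈ (chartAt 𝔼 b₀).source) :
    ContMDiffAt (𝓘(ℝ, ℝ).prod (bindingModel m)) 𝓘(ℝ, ℝ × (𝔼 × ℂ)) ∞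
      (fun y : ℝ × (B × ℂ) ↦ (y.1, (extChartAt (𝓡 (2 * m + 1)) b₀ y.2.1, y.2.2))) x := by
  refine ContMDiffAt.prodMk_space contMDiffAt_fst (ContMDiffAt.prodMk_space ?_ ?_)
  · have h1 : ContMDiffAt (𝓡 (2 * m + 1)) 𝓘(ℝ, 𝔼) ∞ (extChartAt (𝓡 (2 * m + 1)) b₀) x.2.1 :=
      contMDiffAt_extChartAt' hx
    exact h1.comp x (contMDiffAt_fst.comp x contMDiffAt_snd)
  · exact contMDiffAt_snd.comp x contMDiffAt_snd

theorem smoothFamilyOn_tubeForm {α : OneForm (bindingModel m) (B × ℂ)}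
    (hα : OneForm.SmoothOn (bindingModel m) α (solidTube B 1)) {P₁ P₂ P₃ : ℝ × ℝ → ℝ}
    (h₁ : ContDiff ℝ ∞ P₁) (h₂ : ContDiff ℝ ∞ P₂) (h₃ : ContDiff ℝ ∞ P₃) (T : Set ℝ) :
    OneForm.SmoothFamilyOn (bindingModel m)
      (fun t ↦ tubeForm m (fun q ↦ P₁ (t, q)) (fun q ↦ P₂ (t, q)) (fun q ↦ P₃ (t, q)) α) T
      (solidTube B 1) := by
  rintro ⟨t, b₀, z⟩ ⟨ht, hz⟩
  have hz : ‖z‖ ≤ 1 := by simpa [solidTube] using hz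
  have hb : ∀ b ∈ (chartAt 𝔼 b₀).source, b ∈ (extChartAt (𝓡 (2 * m + 1)) b₀).source :=
    fun b hb ↦ by rwa [extChartAt_source]
  refine (contMDiffWithinAt_oneForm_iff (bindingModel m) (𝓘(ℝ, ℝ).prod (bindingModel m)) Prod.snd
    (fun q : ℝ × (B × ℂ) ↦ tubeForm m (fun x ↦ P₁ (q.1, x)) (fun x ↦ P₂ (q.1, x))
      (fun x ↦ P₃ (q.1, x)) α q.2) _ _ (b₀, (0 : ℂ)) ?_).2 ⟨contMDiffWithinAt_snd, ?_⟩
  · simp [chartAt_self_eq]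
  let G := OneForm.inChart (bindingModel m) α (b₀, 0)
  let Γ : ℝ × (𝔼 × ℂ) → 𝔼 × ℂ →L[ℝ] ℝ := fun x ↦
    P₁ (x.1, ‖x.2.2‖ ^ 2) • G x.2 + P₂ (x.1, ‖x.2.2‖ ^ 2) • (G (x.2.1, 0)).comp
      ((ContinuousLinearMap.inl ℝ 𝔼 ℂ).comp (ContinuousLinearMap.fst ℝ 𝔼 ℂ)) +
      P₃ (x.1, ‖x.2.2‖ ^ 2) • (rotationForm x.2.2).comp (ContinuousLinearMap.snd ℝ 𝔼 ℂ)
  have hΓ : ContDiffOn ℝ ∞ Γ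
      (univ ×ˢ ((extChartAt (𝓡 (2 * m + 1)) b₀).target ×ˢ Metric.closedBall 0 1)) := by
    have hG := contDiffOn_inChart m hα b₀
    have hr : ContDiff ℝ ∞ fun x : ℝ × (𝔼 × ℂ) ↦ (x.1, ‖x.2.2‖ ^ 2) :=
      contDiff_fst.prodMk ((contDiff_snd.comp contDiff_snd).norm_sq ℝ)
    have hG1 : ContDiffOn ℝ ∞ (fun x : ℝ × (𝔼 × ℂ) ↦ G x.2)
        (univ ×ˢ ((extChartAt (𝓡 (2 * m + 1)) b₀).target ×ˢ Metric.closedBall 0 1)) :=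
      hG.comp contDiff_snd.contDiffOn fun x hx ↦ hx.2
    have hG0 : ContDiffOn ℝ ∞ (fun x : ℝ × (𝔼 × ℂ) ↦ G (x.2.1, 0))
        (univ ×ˢ ((extChartAt (𝓡 (2 * m + 1)) b₀).target ×ˢ Metric.closedBall 0 1)) :=
      hG.comp ((contDiff_fst.comp contDiff_snd).prodMk contDiff_const).contDiffOn
        fun x hx ↦ ⟨hx.2.1, by simp⟩
    have hrot : ContDiff ℝ ∞ fun x : ℝ × (𝔼 × ℂ) ↦ rotationForm x.2.2 :=
      rotationForm.contDiff.comp (contDiff_snd.comp contDiff_snd)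
    exact (((h₁.comp hr).contDiffOn.smul hG1).add ((h₂.comp hr).contDiffOn.smul
      (hG0.clm_comp contDiffOn_const))).add ((h₃.comp hr).smul
        (hrot.clm_comp contDiff_const)).contDiffOn
  have hmap := (contMDiffAt_familyChart (m := m) b₀ (t, (b₀, z)) (mem_chart_source _ b₀)).contMDiffWithinAt
    (s := (T ×ˢ solidTube B 1) ∩ {x | x.2.1 ∈ (chartAt 𝔼 b₀).source})
  have hN : {x : ℝ × (B × ℂ) | x.2.1 ∈ (chartAt 𝔼 b₀).source} ∈ 𝓝 (t, (b₀, z)) :=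
    (continuous_fst.comp continuous_snd).continuousAt.preimage_mem_nhds
      (chart_source_mem_nhds 𝔼 b₀)
  have hΓt := hΓ (t, (extChartAt (𝓡 (2 * m + 1)) b₀ b₀, z))
    ⟨trivial, mem_extChartAt_target b₀, by simpa using hz⟩
  have hcomp := ContDiffWithinAt.comp_contMDiffWithinAt (f := fun y : ℝ × (B × ℂ) ↦
    (y.1, (extChartAt (𝓡 (2 * m + 1)) b₀ y.2.1, y.2.2))) hΓt hmap
    (by
      intro x hx
      exact ⟨trivial, (extChartAt (𝓡 (2 * m + 1)) b₀).map_source (hb _ hx.2), hx.1.2.2⟩)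
  refine (contMDiffWithinAt_inter hN).1 (hcomp.congr_of_mem (fun x hx ↦ ?_)
    ⟨⟨ht, ⟨trivial, by simpa using hz⟩⟩, mem_chart_source 𝔼 b₀⟩)
  obtain ⟨t', b, w⟩ := x
  have h4 := inChart_tubeForm (fun x ↦ P₁ (t', x)) (fun x ↦ P₂ (t', x)) (fun x ↦ P₃ (t', x)) α b₀
    (extChartAt (𝓡 (2 * m + 1)) b₀ b) w ((extChartAt (𝓡 (2 * m + 1)) b₀).map_source (hb _ hx.2))
  refine Eq.trans ?_ h4
  rw [OneForm.inChart, chartCovector]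
  have h5 : (extChartAt (bindingModel m) (b₀, (0 : ℂ))) (b, w) =
      (extChartAt (𝓡 (2 * m + 1)) b₀ b, w) := by
    rw [extChartAt_bindingModel]
    rfl
  have h6 : (extChartAt (bindingModel m) (b₀, (0 : ℂ))).symm
      (extChartAt (𝓡 (2 * m + 1)) b₀ b, w) = (b, w) := by
    rw [extChartAt_bindingModel]
    exact Prod.ext ((extChartAt (𝓡 (2 * m + 1)) b₀).left_inv (hb _ hx.2)) rfl
  rw [h5, h6]

theorem OneForm.SmoothFamilyOn.smoothOn {A : ℝ → OneForm (bindingModel m) (B × ℂ)} {T : Set ℝ}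
    {s : Set (B × ℂ)} (h : OneForm.SmoothFamilyOn (bindingModel m) A T s) {t : ℝ} (ht : t ∈ T) :
    OneForm.SmoothOn (bindingModel m) (A t) s :=
  ContMDiffOn.comp (g := fun q : ℝ × (B × ℂ) ↦ Bundle.TotalSpace.mk' (𝔼 × ℂ →L[ℝ] ℝ)
      (E := fun p : B × ℂ ↦ (TangentSpace (bindingModel m) p →L[ℝ] ℝ)) q.2 (A q.1 q.2)) h
    (f := fun p ↦ (t, p)) (contMDiff_const.prodMk contMDiff_id).contMDiffOn
    fun _ hp ↦ ⟨ht, hp⟩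

end Family

/-! ### The page-preserving embedding. -/

section Scaling

variable {m : ℕ} {B : Type*} [TopologicalSpace B]
  [ChartedSpace (EuclideanSpace ℝ (Fin (2 * m + 1))) B]

local notation "𝔼" => EuclideanSpace ℝ (Fin (2 * m + 1))

/-- The map `(b, z) ↦ (b, l z)`. -/
def radialScaling (B : Type*) (l : ℝ) : B × ℂ → B × ℂ := Prod.map id fun z : ℂ ↦ l • z

theorem contMDiff_radialScaling (l : ℝ) :
    ContMDiff (bindingModel m) (bindingModel m) ∞ (radialScaling B l) :=
  contMDiff_id.prodMap (contDiff_const_smul l).contMDiff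

theorem mfderiv_radialScaling (l : ℝ) (p : B × ℂ) :
    mfderiv (bindingModel m) (bindingModel m) (radialScaling B l) p =
      (ContinuousLinearMap.id ℝ 𝔼).prodMap (l • ContinuousLinearMap.id ℝ ℂ) := by
  obtain ⟨b, z⟩ := p
  have h1 : MDifferentiableAt (𝓡 (2 * m + 1)) (𝓡 (2 * m + 1)) (id : B → B) b := mdifferentiableAt_id
  have h2 : HasFDerivAt (fun z : ℂ ↦ l • z) (l • ContinuousLinearMap.id ℝ ℂ) z :=
    (hasFDerivAt_id z).const_smul l
  have h3 := mfderiv_prodMap (p := (b, z)) h1 h2.differentiableAt.mdifferentiableAt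
  rw [mfderiv_id, mfderiv_eq_fderiv, h2.fderiv] at h3
  exact h3

theorem mfderivWithin_radialScaling [IsManifold (𝓡 (2 * m + 1)) 1 B] (l : ℝ) {ε : ℝ} (hε : 0 < ε)
    {p : B × ℂ} (hp : p ∈ solidTube B ε) :
    mfderivWithin (bindingModel m) (bindingModel m) (radialScaling B l) (solidTube B ε) p =
      (ContinuousLinearMap.id ℝ 𝔼).prodMap (l • ContinuousLinearMap.id ℝ ℂ) := by
  rw [← mfderiv_radialScaling l p]
  have h1 : UniqueMDiffOn 𝓘(ℝ, ℂ) (Metric.closedBall (0 : ℂ) ε) :=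
    uniqueMDiffOn_iff_uniqueDiffOn.2 (uniqueDiffOn_convex (convex_closedBall _ _) (by
      rw [interior_closedBall _ hε.ne']
      exact ⟨0, by simpa using hε⟩))
  exact mfderivWithin_eq_mfderiv ((uniqueMDiffOn_univ.prod h1) p hp)
    ((contMDiff_radialScaling l).mdifferentiable (by norm_num) p)

theorem isSmoothEmbeddingOn_radialScaling [IsManifold (𝓡 (2 * m + 1)) 1 B] {l : ℝ} (hl : l ≠ 0)
    {ε : ℝ} (hε : 0 < ε) :
    IsSmoothEmbeddingOn (bindingModel m) (radialScaling B l) (solidTube B ε) where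
  smooth := (contMDiff_radialScaling l).contMDiffOn
  immersion p hp := by
    rw [mfderivWithin_radialScaling l hε hp]
    rintro ⟨u, w⟩ ⟨u', w'⟩ h
    have h' : ((u, l • w) : 𝔼 × ℂ) = (u', l • w') := h
    rw [Prod.mk.injEq] at h'
    exact Prod.ext h'.1 (smul_right_injective ℂ hl h'.2)
  embedding := by
    have : IsEmbedding (radialScaling B l) :=
      ((Homeomorph.refl B).prodCongr (Homeomorph.smulOfNeZero l hl)).isEmbedding
    exact this.comp .subtypeVal

end Scaling

/-! ### The path of twisted forms. -/

section Twisting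

variable {m : ℕ} {B : Type*} [TopologicalSpace B]
  [ChartedSpace (EuclideanSpace ℝ (Fin (2 * m + 1))) B] [IsManifold (𝓡 (2 * m + 1)) ∞ B]
  {α : OneForm (bindingModel m) (B × ℂ)} {C ρ L S r₀ c K : ℝ}

local notation "𝔼" => EuclideanSpace ℝ (Fin (2 * m + 1))

omit [IsManifold (𝓡 (2 * m + 1)) ∞ B] in
theorem interpolatedForm_eq_self {h κ f : ℝ → ℝ} (p : B × ℂ) (hh : h (‖p.2‖ ^ 2) = 1)
    (hκ : κ (‖p.2‖ ^ 2) = 0) (hf : f (‖p.2‖ ^ 2) = 0) : interpolatedForm m h κ f α p = α p := by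
  obtain ⟨b, z⟩ := p
  refine ContinuousLinearMap.ext fun v ↦ ?_
  refine (covectorAt_interpolatedForm h κ f α b z v).trans ?_
  rw [hh, hκ, hf, mixForm_zero, one_mul, zero_mul, add_zero]
  rfl

omit [IsManifold (𝓡 (2 * m + 1)) ∞ B] in
theorem twistedForm_zero_zero (p : B × ℂ) : twistedForm m ρ r₀ c K 0 0 α p = α p :=
  interpolatedForm_eq_self p (by simp) (by simp) (by simp)

omit [IsManifold (𝓡 (2 * m + 1)) ∞ B] in
theorem twistedForm_eq_self (hT : IsTwistConstants m C ρ L S r₀ c K) (s u : ℝ) (p : B × ℂ)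
    (hp : ρ ≤ ‖p.2‖) : twistedForm m ρ r₀ c K s u α p = α p := by
  have hr₀ := hT.r₀_pos
  have hρ := hT.ρ_pos
  have hle := hT.r₀_le
  have hq : ρ ^ 2 ≤ ‖p.2‖ ^ 2 := by gcongr
  refine interpolatedForm_eq_self p ?_ ?_ ?_
  · rw [dropProfile_of_ge (by positivity) (by nlinarith)]
    simp
  · rw [(step_eq_zero hr₀ (by linarith)).1, mul_zero]
  · rw [twistProfile_of_ge (by positivity) hq, mul_zero]

omit [IsManifold (𝓡 (2 * m + 1)) ∞ B] in
-- On TB at z = 0 the forms α and α_B agree, so κ has no effect, and η vanishes at the origin: only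
-- h(0) remains.
theorem restrictBinding_interpolatedForm (h κ f : ℝ → ℝ) (b : B) :
    restrictBinding m (interpolatedForm m h κ f α) b = h 0 • restrictBinding m α b := by
  refine ContinuousLinearMap.ext fun v ↦ ?_
  have h1 := covectorAt_interpolatedForm h κ f α b 0 ((v, 0) : 𝔼 × ℂ)
  have h2 : mixForm m α b 0 (κ (‖(0 : ℂ)‖ ^ 2)) ((v, 0) : 𝔼 × ℂ) =
      covectorAt m α (b, 0) ((v, 0) : 𝔼 × ℂ) := by
    simp only [mixForm]
    ring
  rw [h2] at h1
  rw [norm_zero, Complex.zero_re, Complex.zero_im, zero_mul, sub_zero, mul_zero, add_zero,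
    zero_pow two_ne_zero] at h1
  exact h1

theorem dTube_interpolatedForm_binding (hα : OneForm.SmoothOn (bindingModel m) α (solidTube B 1))
    {h κ f : ℝ → ℝ} {h' κ' f' : ℝ} (hh : HasDerivAt h h' 0) (hκ : HasDerivAt κ κ' 0)
    (hf : HasDerivAt f f' 0) (b : B) (u w : 𝔼) :
    dTube m (interpolatedForm m h κ f α) (b, 0) (u, 0) (w, 0) =
      h 0 * dTube m α (b, 0) (u, 0) (w, 0) := by
  have h0 : ‖(0 : ℂ)‖ ^ 2 = 0 := by simp
  rw [dTube_interpolatedForm hα b 0 (by simp) (by rwa [h0]) (by rwa [h0]) (by rwa [h0])]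
  simp only [mixD, h0, Complex.zero_re, Complex.zero_im]
  ring

theorem isAdaptedContactForm_twistedForm (hα : IsAdaptedContactForm m α)
    (hT : IsTwistConstants m C ρ L S r₀ c K) (hframe : ∀ b, ∃ v, IsUniformFrame m α C ρ b v)
    {s u : ℝ} (hs : s ∈ Icc (0 : ℝ) 1) (hu : u ∈ Icc (0 : ℝ) 1) (hsu : u = 0 ∨ s = 1)
    (hsmooth : OneForm.SmoothOn (bindingModel m) (twistedForm m ρ r₀ c K s u α) (solidTube B 1)) :
    IsAdaptedContactForm m (twistedForm m ρ r₀ c K s u α) := by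
  obtain ⟨d1, d2, d3⟩ := hasDerivAt_twist hT s u 0
  refine isAdaptedContactForm_of_volumes hα hsmooth
    (zero_lt_one.trans_le (one_le_twist hT hs.1 0))
    (restrictBinding_interpolatedForm _ _ _) (dTube_interpolatedForm_binding hα.contact.smooth d1 d2 d3)
    fun b ↦ ?_
  obtain ⟨v, hv⟩ := hframe b
  have hv0 : 0 < bindingVolume m α b v :=
    (one_div_pos.2 hT.C_pos).trans_le hv.binding_volume
  refine ⟨v, hv0, fun z hz ↦ ?_, fun e he r hr hr1 ↦ pageVolume_twistedForm_pos hα.contact.smooth hT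
    hv he (fun r hr hr1 ↦ pageVolume_pos hα hv0 he hr hr1) hs hu hsu hr hr1⟩
  have h1 := tubeVolume_twistedForm_pos hα.contact.smooth hT hv
    (Complex.norm_exp_ofReal_mul_I z.arg) (fun r hr hr1 ↦ pageVolume_pos hα hv0
      (Complex.norm_exp_ofReal_mul_I z.arg) hr hr1) (fun z hz ↦ tubeVolume_pos hα hv0 hz) hs hu hsu
    (norm_nonneg z) hz
  rwa [Complex.norm_mul_exp_arg_mul_I] at h1

theorem smoothFamilyOn_twistedForm (hα : OneForm.SmoothOn (bindingModel m) α (solidTube B 1))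
    (hT : IsTwistConstants m C ρ L S r₀ c K) {s u : ℝ → ℝ} (hs : ContDiff ℝ ∞ s)
    (hu : ContDiff ℝ ∞ u) (T : Set ℝ) :
    OneForm.SmoothFamilyOn (bindingModel m) (fun t ↦ twistedForm m ρ r₀ c K (s t) (u t) α) T
      (solidTube B 1) := by
  have h0 : 0 < r₀ ^ 2 := pow_pos hT.r₀_pos 2
  have hs' : ContDiff ℝ ∞ fun x : ℝ × ℝ ↦ s x.1 := hs.comp contDiff_fst
  have hu' : ContDiff ℝ ∞ fun x : ℝ × ℝ ↦ u x.1 := hu.comp contDiff_fst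
  have hh : ContDiff ℝ ∞ fun x : ℝ × ℝ ↦ 1 + s x.1 * c * dropProfile (r₀ ^ 2) x.2 :=
    contDiff_const.add ((hs'.mul contDiff_const).mul ((contDiff_dropProfile _).comp contDiff_snd))
  have hκ : ContDiff ℝ ∞ fun x : ℝ × ℝ ↦ u x.1 * stepDown (2 * (r₀ ^ 2)⁻¹ * x.2) :=
    hu'.mul (contDiff_stepDown.comp (contDiff_const.mul contDiff_snd))
  have hf : ContDiff ℝ ∞ fun x : ℝ × ℝ ↦ s x.1 * K * twistProfile (r₀ ^ 2) (ρ ^ 2) x.2 :=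
    (hs'.mul contDiff_const).mul ((contDiff_twistProfile h0 _).comp contDiff_snd)
  exact smoothFamilyOn_tubeForm hα (hh.mul (contDiff_const.sub hκ)) (hh.mul hκ) hf T

omit [IsManifold (𝓡 (2 * m + 1)) ∞ B] in
-- For r ≤ r₀/2 all profiles sit in their inner regimes: κ = 1, h is linear in r², and f = K. In
-- particular α enters only through α_B.
theorem twistedForm_one_one_apply (hT : IsTwistConstants m C ρ L S r₀ c K) {b : B} {z : ℂ}
    (hz : ‖z‖ ≤ r₀ / 2) (v : 𝔼 × ℂ) :
    covectorAt m (twistedForm m ρ r₀ c K 1 1 α) (b, z) v =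
      (1 + c * (2 * r₀ ^ 2 - ‖z‖ ^ 2)) * restrictBinding m α b v.1 +
        K * (z.re * v.2.im - z.im * v.2.re) := by
  have hr₀ := hT.r₀_pos
  have hρ := hT.ρ_pos
  have hle := hT.r₀_le
  have h0 : 0 < r₀ ^ 2 := by positivity
  have hq : ‖z‖ ^ 2 ≤ (r₀ / 2) ^ 2 := by gcongr
  rw [twistedForm, covectorAt_interpolatedForm, dropProfile_of_le h0 (by nlinarith),
    twistProfile_of_le h0 (by nlinarith) (by nlinarith), stepDown_eq_one]
  · simp only [mixForm, mul_one, one_mul, sub_self, zero_mul, zero_add]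
    rfl
  · rw [mul_assoc, ← le_div_iff₀' two_pos, inv_mul_le_iff₀ h0]
    nlinarith

end Twisting

theorem exists_uniform_tube {B : Type*} [TopologicalSpace B] [CompactSpace B] {U : Set (B × ℂ)}
    (hU : IsOpen U) (hBU : ∀ b : B, ((b, 0) : B × ℂ) ∈ U) :
    ∃ δ : ℝ, 0 < δ ∧ ∀ (b : B) (z : ℂ), ‖z‖ < δ → (b, z) ∈ U := by
  obtain ⟨u, v, -, hv, hu, h0, huv⟩ := generalized_tube_lemma (isCompact_univ (X := B))
    (isCompact_singleton (x := (0 : ℂ))) hU (by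
      rintro ⟨b, z⟩ ⟨-, hz⟩
      rw [mem_singleton_iff] at hz
      subst hz
      exact hBU b)
  obtain ⟨δ, hδ, h⟩ := Metric.isOpen_iff.1 hv 0 (h0 rfl)
  exact ⟨δ, hδ, fun b z hz ↦ huv ⟨hu trivial, h (by simpa using hz)⟩⟩

end

/-! ### Assembly of the path, the embedding and the normal form. -/

theorem proposition3p1 (m : ℕ) {B : Type*} [TopologicalSpace B] [T2Space B] [CompactSpace B]
    [ChartedSpace (EuclideanSpace ℝ (Fin (2 * m + 1))) B] [IsManifold (𝓡 (2 * m + 1)) ∞ B]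
    (α : OneForm (bindingModel m) (B × ℂ)) (hα : IsAdaptedContactForm m α)
    (U : Set (B × ℂ)) (hU : IsOpen U) (hBU : ∀ b : B, ((b, 0) : B × ℂ) ∈ U) :
    ∃ ε₀ : ℝ, 0 < ε₀ ∧ ∀ ε : ℝ, 0 < ε → ε ≤ ε₀ →
      ∃ (αt : ℝ → OneForm (bindingModel m) (B × ℂ)) (Ψ : B × ℂ → B × ℂ) (h₁ h₂ : ℝ → ℝ),
        -- the isotopic modification `αt 1` of `α` near `B`
        (OneForm.SmoothFamilyOn (bindingModel m) αt (Icc 0 1) (solidTube B 1) ∧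
          (∀ p ∈ solidTube B 1, αt 0 p = α p) ∧
          (∀ t ∈ Icc (0 : ℝ) 1, ∀ p ∈ solidTube B 1, p ∉ U → αt t p = α p) ∧
          (∀ t ∈ Icc (0 : ℝ) 1, IsAdaptedContactForm m (αt t)) ∧
          (∀ t ∈ Icc (0 : ℝ) 1, ∃ c : ℝ, 0 < c ∧
            ∀ b : B, restrictBinding m (αt t) b = c • restrictBinding m α b)) ∧
        -- the page-preserving embedding
        (IsSmoothEmbeddingOn (bindingModel m) Ψ (solidTube B ε) ∧
          MapsTo Ψ (solidTube B ε) (solidTube B 1) ∧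
          (∀ θ : ℝ, MapsTo Ψ (page B θ ∩ solidTube B ε) (page B θ)) ∧
          (∀ b : B, Ψ (b, 0) = (b, 0))) ∧
        -- the normal form
        (∀ p ∈ solidTube B ε, ∀ (u : EuclideanSpace ℝ (Fin (2 * m + 1))) (w : ℂ),
          OneForm.pullbackWithin (bindingModel m) Ψ (solidTube B ε) (αt 1) p (u, w) =
            h₁ ‖p.2‖ * restrictBinding m α p.1 u + h₂ ‖p.2‖ * angularForm p.2 w) ∧
        ContDiffOn ℝ ∞ h₁ (Icc 0 ε) ∧ ContDiffOn ℝ ∞ h₂ (Icc 0 ε) ∧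
        0 < h₁ 0 ∧
        (∃ δ : ℝ, 0 < δ ∧ ∀ r : ℝ, 0 ≤ r → r ≤ δ → h₂ r = r ^ 2) ∧
        (∀ r ∈ Ioc (0 : ℝ) ε,
          0 < h₁ r ^ m *
            (h₁ r * derivWithin h₂ (Icc 0 ε) r - derivWithin h₁ (Icc 0 ε) r * h₂ r)) ∧
        (∀ r ∈ Ioc (0 : ℝ) ε, derivWithin h₁ (Icc 0 ε) r < 0) := by
  obtain ⟨C, ρ₁, hC, hρ₁, hρ₁1, hframe⟩ := exists_uniformFrame hα
  obtain ⟨δ, hδ, hδU⟩ := exists_uniform_tube hU hBU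
  -- The bound ρ ≤ δ/2 places the modification, which is supported in r ≤ ρ, inside U.
  obtain ⟨ρ, L, S, r₀, c, K, hρle, hT⟩ := exists_isTwistConstants m (ρ := min ρ₁ (δ / 2)) hC
    (lt_min hρ₁ (half_pos hδ)) ((min_le_left _ _).trans_lt hρ₁1)
  replace hframe : ∀ b, ∃ v, IsUniformFrame m α C ρ b v := fun b ↦ by
    obtain ⟨v, hv⟩ := hframe b
    exact ⟨v, hv.mono hC le_rfl (hρle.trans (min_le_left _ _))⟩
  have hr₀ := hT.r₀_pos
  have hK := hT.K_pos
  have hc := hT.c_pos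
  have hsK : 0 < √K := Real.sqrt_pos.2 hK
  have hr₀1 : r₀ / 2 ≤ 1 := by linarith [hT.r₀_le, hT.ρ_lt_one]
  -- The embedding divides radii by √K, so the tube of this radius lands in r ≤ r₀/2, where the
  -- twisted form is rotationally symmetric.
  refine ⟨√K * (r₀ / 2), by positivity, fun ε hε hε₀ ↦ ?_⟩
  -- s rises on [0, 1/2] and u on [1/2, 1], so that u = 0 or s = 1 at every time, as the positivity
  -- results require.
  set s : ℝ → ℝ := fun t ↦ Real.smoothTransition (2 * t)
  set u : ℝ → ℝ := fun t ↦ Real.smoothTransition (2 * t - 1)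
  have hs : ContDiff ℝ ∞ s := Real.smoothTransition.contDiff.comp (contDiff_const.mul contDiff_id)
  have hu : ContDiff ℝ ∞ u := Real.smoothTransition.contDiff.comp
    ((contDiff_const.mul contDiff_id).sub contDiff_const)
  have hsI : ∀ t, s t ∈ Icc (0 : ℝ) 1 := fun t ↦
    ⟨Real.smoothTransition.nonneg _, Real.smoothTransition.le_one _⟩
  have huI : ∀ t, u t ∈ Icc (0 : ℝ) 1 := fun t ↦
    ⟨Real.smoothTransition.nonneg _, Real.smoothTransition.le_one _⟩
  have hsu : ∀ t, u t = 0 ∨ s t = 1 := fun t ↦ by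
    rcases le_total (2 * t) 1 with h | h
    · exact .inl (Real.smoothTransition.zero_of_nonpos (by linarith))
    · exact .inr (Real.smoothTransition.one_of_one_le h)
  have hs0 : s 0 = 0 := Real.smoothTransition.zero_of_nonpos (by norm_num)
  have hu0 : u 0 = 0 := Real.smoothTransition.zero_of_nonpos (by norm_num)
  have hs1 : s 1 = 1 := Real.smoothTransition.one_of_one_le (by norm_num)
  have hu1 : u 1 = 1 := Real.smoothTransition.one_of_one_le (by norm_num)
  have hfam := smoothFamilyOn_twistedForm hα.contact.smooth hT hs hu (Icc 0 1)
  have hscale : ∀ r, 0 ≤ r → r ≤ ε → (√K)⁻¹ * r ≤ r₀ / 2 := fun r hr hrε ↦ by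
    rw [inv_mul_le_iff₀ hsK]
    linarith
  have hKinv : (√K)⁻¹ ^ 2 = K⁻¹ := by rw [inv_pow, Real.sq_sqrt hK.le]
  have hnorm : ∀ z : ℂ, ‖(√K)⁻¹ • z‖ = (√K)⁻¹ * ‖z‖ := fun z ↦ by
    rw [norm_smul, Real.norm_of_nonneg (by positivity)]
  have htube : ∀ p ∈ solidTube B ε, ‖p.2‖ ≤ ε := fun p hp ↦ by simpa [solidTube] using hp
  have hd₁ : ∀ r ∈ Ioc (0 : ℝ) ε, derivWithin (fun r ↦ 1 + c * (2 * r₀ ^ 2 - r ^ 2 / K)) (Icc 0 ε) r =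
      -(2 * c * r / K) := fun r hr ↦ by
    have h1 : HasDerivAt (fun r : ℝ ↦ 1 + c * (2 * r₀ ^ 2 - r ^ 2 / K)) (-(2 * c * r / K)) r := by
      have h2 := ((((hasDerivAt_pow 2 r).div_const K).const_sub (2 * r₀ ^ 2)).const_mul c).const_add 1
      refine h2.congr_deriv ?_
      norm_num
      ring
    exact h1.hasDerivWithinAt.derivWithin (uniqueDiffOn_Icc hε r ⟨hr.1.le, hr.2⟩)
  have hd₂ : ∀ r ∈ Ioc (0 : ℝ) ε, derivWithin (fun r : ℝ ↦ r ^ 2) (Icc 0 ε) r = 2 * r := fun r hr ↦ by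
    have h1 : HasDerivAt (fun r : ℝ ↦ r ^ 2) (2 * r) r := by simpa using hasDerivAt_pow 2 r
    exact h1.hasDerivWithinAt.derivWithin (uniqueDiffOn_Icc hε r ⟨hr.1.le, hr.2⟩)
  have hneg : ∀ r ∈ Ioc (0 : ℝ) ε, 0 < 2 * c * r / K := fun r hr ↦ by
    have := hr.1
    positivity
  refine ⟨fun t ↦ twistedForm m ρ r₀ c K (s t) (u t) α, radialScaling B (√K)⁻¹,
    -- Under the scaling r² becomes r²/K, so K r² dθ becomes r² dθ on the whole tube, and h₁ has
    -- derivative -2cr/K.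
    fun r ↦ 1 + c * (2 * r₀ ^ 2 - r ^ 2 / K), fun r ↦ r ^ 2,
    ⟨hfam, fun p _ ↦ ?_, fun t _ p _ hpU ↦ ?_, fun t ht ↦ ?_, fun t _ ↦ ?_⟩,
    ⟨isSmoothEmbeddingOn_radialScaling (by positivity) hε, fun p hp ↦ ?_, fun θ p hp ↦ ?_, fun b ↦ ?_⟩,
    ?_, ?_, ?_, ?_, ⟨1, one_pos, fun r _ _ ↦ rfl⟩, ?_, ?_⟩
  · simp only [hs0, hu0]
    exact twistedForm_zero_zero p
  · refine twistedForm_eq_self hT _ _ p ?_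
    by_contra! h
    exact hpU (hδU p.1 p.2 (by linarith [hρle.trans (min_le_right ρ₁ (δ / 2))]))
  · exact isAdaptedContactForm_twistedForm hα hT hframe (hsI t) (huI t) (hsu t) (hfam.smoothOn ht)
  · exact ⟨_, zero_lt_one.trans_le (one_le_twist hT (hsI t).1 0),
      restrictBinding_interpolatedForm _ _ _⟩
  · refine ⟨trivial, ?_⟩
    rw [mem_closedBall_zero_iff]
    exact (hnorm p.2).le.trans ((hscale _ (norm_nonneg _) (htube p hp)).trans hr₀1)
  · obtain ⟨⟨r, hr, -, hpr⟩, hp⟩ := hp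
    have hpn : ‖p.2‖ = r := by
      rw [hpr, norm_mul, Complex.norm_exp_ofReal_mul_I, mul_one, Complex.norm_real,
        Real.norm_of_nonneg hr]
    refine ⟨(√K)⁻¹ * r, by positivity, (hscale r hr (hpn ▸ htube p hp)).trans hr₀1, ?_⟩
    change (√K)⁻¹ • p.2 = _
    rw [hpr, Complex.real_smul]
    push_cast
    ring
  · simp [radialScaling]
  · rintro ⟨b, z⟩ hp v w
    have hz : ‖(√K)⁻¹ • z‖ ≤ r₀ / 2 :=
      (hnorm z).le.trans (hscale _ (norm_nonneg _) (htube (b, z) hp))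
    have h1 : OneForm.pullbackWithin (bindingModel m) (radialScaling B (√K)⁻¹) (solidTube B ε)
        (twistedForm m ρ r₀ c K (s 1) (u 1) α) (b, z) (v, w) =
        covectorAt m (twistedForm m ρ r₀ c K 1 1 α) (b, (√K)⁻¹ • z) (v, (√K)⁻¹ • w) := by
      rw [OneForm.pullbackWithin, mfderivWithin_radialScaling _ hε hp, hs1, hu1]
      rfl
    refine h1.trans ?_
    rw [twistedForm_one_one_apply hT hz, hnorm, mul_pow, hKinv]
    have h2 : ‖z‖ ^ 2 * angularForm z w = z.re * w.im - z.im * w.re := by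
      rcases eq_or_ne z 0 with rfl | h
      · simp
      · exact mul_div_cancel₀ _ (by positivity)
    change _ = (1 + c * (2 * r₀ ^ 2 - ‖z‖ ^ 2 / K)) * restrictBinding m α b v +
      ‖z‖ ^ 2 * angularForm z w
    rw [h2]
    have h3 : K * (√K)⁻¹ ^ 2 = 1 := by
      rw [hKinv]
      exact mul_inv_cancel₀ hK.ne'
    simp only [Complex.smul_re, Complex.smul_im, smul_eq_mul]
    rw [div_eq_inv_mul]
    linear_combination (z.re * w.im - z.im * w.re) * h3
  · exact ContDiff.contDiffOn (by fun_prop)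
  · exact ContDiff.contDiffOn (by fun_prop)
  · have : 0 < c * (2 * r₀ ^ 2) := by positivity
    simp only [ne_eq, OfNat.ofNat_ne_zero, not_false_eq_true, zero_pow, zero_div, sub_zero]
    linarith
  · intro r hr
    rw [hd₁ r hr, hd₂ r hr]
    -- The scaled radius r/√K is at most r₀/2, which keeps h₁ above 1.
    have h1 : r ^ 2 / K ≤ 2 * r₀ ^ 2 := by
      have h2 := pow_le_pow_left₀ (by have := hr.1; positivity) (hscale r hr.1.le hr.2) 2
      rw [mul_pow, hKinv, ← div_eq_inv_mul] at h2
      nlinarith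
    have h3 : 0 < 1 + c * (2 * r₀ ^ 2 - r ^ 2 / K) := by
      have := mul_nonneg hc.le (sub_nonneg.2 h1)
      linarith
    have h4 := hneg r hr
    have h5 := hr.1
    have h6 : 0 < (1 + c * (2 * r₀ ^ 2 - r ^ 2 / K)) * (2 * r) - -(2 * c * r / K) * r ^ 2 := by
      rw [neg_mul, sub_neg_eq_add]
      positivity
    positivity
  · intro r hr
    rw [hd₁ r hr]
    linarith [hneg r hr]
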